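/- Let $d\ge 1$, $\beta>0$, and consider the classical gas in $\mathbb R^d$ with pair interaction $\phi(|x-y|)$, where $\phi:[0,\infty)\to[0,\infty]$ is measurable (so the interaction is repulsive and may contain a hard core), and assume $$C(\beta)=\int_{\mathbb R^d}\bigl|e^{-\beta\phi(|x|)}-1\bigr|\,dx<\infty .$$ *Virial expansion.* For a bounded measurable $\Lambda\subset\mathbb R^d$ of positive volume let $$\Xi_\Lambda(z)=1+\sum_{N\ge1}\frac{z^N}{N!}\int_{\Lambda^N}e^{-\beta\sum_{i<j}\phi(|x_i-x_j|)}dx_1\cdots dx_N,\qquad \beta P_\Lambda(z)=\frac{1}{|\Lambda|}\ln\Xi_\Lambda(z),$$ and let $\sum_{n\ge1}\frac{b_n(\Lambda)}{n!}z^n$ be the Taylor series of $\beta P_\Lambda$ at $z=0$. The finite-volume virial coefficients $\beta_n(\Lambda)$ are defined by composing this series, as a formal power series, with the compositional inverse $z(\rho_\Lambda)$ of the density series $\rho_\Lambda=z\,\partial_z(\beta P_\Lambda)$, so that $\beta P_\Lambda=\sum_{n\ge1}\frac{\beta_n(\Lambda)}{n!}\rho_\Lambda^n$. The virial coefficients are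 $\beta_n=\lim_{\Lambda\uparrow\mathbb R^d}\beta_n(\Lambda)$, the limit being taken in the sense of van Hove (for every $h>0$, the volume of the set of points at distance at most $h$ from $\partial\Lambda$, divided by $|\Lambda|$, tends to $0$), and $\mathcal R_{\mathrm{Vir}}$ is the radius of convergence of $\sum_{n\ge1}\frac{\beta_n}{n!}\rho^n$. *Vertex sum and tree sum.* Let $$\varphi_n(x;x_1,\dots,x_n)=\prod_{1\le i\le n}\bigl[1-e^{-\beta\phi(|x-x_i|)}\bigr]\prod_{1\le i<j\le n}e^{-\beta\phi(|x_i-x_j|)},$$ $$\Psi(\mu)=1+\sum_{n\ge1}\frac{\mu^n}{n!}\int_{\mathbb R^{dn}}\varphi_n(0;x_1,\dots,x_n)\,dx_1\cdots dx_n .$$ For a tree $\tau$ on the vertices $\{0,1,\dots,n\}$ rooted at $0$, let $s_i$ be the number of children of the vertex $i$, and let $(i,1),\dots,(i,s_i)$ be these children. Let $$B_n(x_0;x_1,\dots,x_n)=\sum_{\tau}\prod_{i=0}^n\varphi_{s_i}\bigl(x_i;x_{(i,1)},\dots,x_{(i,s_i)}\bigr),\qquad \mathcal B(r)=1+\sum_{n\ge1}\frac{r^n}{n!}\int_{\mathbb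 R^{dn}}B_n(0;x_1,\dots,x_n)\,dx_1\cdots dx_n ,$$ where $\tau$ runs over all such trees and $\varphi_0=1$. Let $r^{**}\in[0,\infty]$ be the radius of convergence of $\mathcal B$, and $$R^*=\sup_{0\le r\le r^{**},\,r<\infty}\frac{r\,\mathcal B(r)}{2\mathcal B(r)-1}.$$ *Claim.* All the limits $\beta_n$ exist. If $C(\beta)\neq0$, then the function $\mu\mapsto\mu/\Psi(\mu)$ has exactly one maximizer $\mu^*$ on $[0,\infty)$; in the trivial case $C(\beta)=0$, where $\Psi=1$, put $\mu^*=\infty$. The radius of convergence of the virial expansion satisfies $$\mathcal R_{\mathrm{Vir}}\;\ge\;R^*\;\ge\;M^*:=\sup_{0\le\mu\le\mu^*,\,\mu<\infty}\frac{\mu}{2\Psi(\mu)-1}$$ (as an inequality in $[0,\infty]$). -/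

import Mathlib

open scoped NNReal ENNReal PowerSeries Topology

noncomputable section

namespace RepulsiveGas

/-- The space `ℝ^d` with its Euclidean norm. -/
abbrev Space (d : ℕ) := EuclideanSpace ℝ (Fin d)

/-- The Boltzmann factor `exp (-β u)` of an energy `u ∈ [0, ∞]`, with `exp (-∞) = 0`. -/
def boltzmann (β : ℝ) (u : ℝ≥0∞) : ℝ :=
  if u = ⊤ then 0 else Real.exp (-(β * u.toReal))

variable (d : ℕ) (β : ℝ) (φ : ℝ≥0 → ℝ≥0∞)

/-- `exp (-β φ(|x - y|))`. -/
def pairWeight (x y : Space d) : ℝ := boltzmann β (φ ‖x - y‖₊)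

/-- `C(β) = ∫ |exp (-β φ(|x|)) - 1| dx`. -/
def tempered : ℝ≥0∞ :=
  ∫⁻ x : Space d, ENNReal.ofReal |pairWeight d β φ x 0 - 1|

/-! ### Finite volume -/

/-- The energy `U_N(x_1, …, x_N) = ∑_{i < j} φ(|x_i - x_j|)`. -/
def energy {N : ℕ} (x : Fin N → Space d) : ℝ≥0∞ :=
  ∑ i, ∑ j ∈ Finset.Ioi i, φ ‖x i - x j‖₊

/-- The grand canonical partition function `Ξ_Λ(z)`, at a real fugacity `z`. -/
def partitionFunction (Λ : Set (Space d)) (z : ℝ) : ℝ :=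
  1 + ∑' N : ℕ, z ^ (N + 1) / ((N + 1).factorial : ℝ) *
    ∫ x in Set.univ.pi (fun _ : Fin (N + 1) => Λ), boltzmann β (energy d φ x)

/-- `β P_Λ(z) = |Λ|⁻¹ log Ξ_Λ(z)`. -/
def betaPressure (Λ : Set (Space d)) (z : ℝ) : ℝ :=
  Real.log (partitionFunction d β φ Λ z) / MeasureTheory.volume.real Λ

/-- The finite-volume cluster coefficient `b_n(Λ)`: the `n`-th derivative of `β P_Λ` at `0`. -/
def clusterCoeff (Λ : Set (Space d)) (n : ℕ) : ℝ :=
  iteratedDeriv n (betaPressure d β φ Λ) 0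

/-- The finite-volume cluster expansion `∑ b_n(Λ) z^n / n!` as a formal power series in `z`. -/
def clusterSeries (Λ : Set (Space d)) : ℝ⟦X⟧ :=
  PowerSeries.mk fun n => clusterCoeff d β φ Λ n / (n.factorial : ℝ)

/-- The density `ρ_Λ = z ∂(β P_Λ)/∂z` as a formal power series in the fugacity `z`. -/
def densitySeries (Λ : Set (Space d)) : ℝ⟦X⟧ :=
  PowerSeries.X * PowerSeries.derivative ℝ (clusterSeries d β φ Λ)

open Classical in
/-- The compositional inverse of a formal power series without constant term whose linear
coefficient is not zero (and `0` if the linear coefficient is zero). -/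
def compInverse (f : ℝ⟦X⟧) : ℝ⟦X⟧ :=
  if h : IsUnit (f.coeff 1) then f.substInvOfIsUnit h else 0

/-- The finite-volume virial expansion, as a formal power series in the density: the cluster
series composed with the inverse `z(ρ_Λ)` of the density series. -/
def virialSeries (Λ : Set (Space d)) : ℝ⟦X⟧ :=
  (clusterSeries d β φ Λ).subst (compInverse (densitySeries d β φ Λ))

/-- The finite-volume virial coefficient `β_n(Λ)`, where `β P_Λ = ∑ β_n(Λ) ρ_Λ^n / n!`. -/
def virialCoeff (Λ : Set (Space d)) (n : ℕ) : ℝ :=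
  (n.factorial : ℝ) * (virialSeries d β φ Λ).coeff n

/-! ### Infinite volume -/

/-- A sequence of bounded measurable regions of positive volume tends to `ℝ^d` in the sense of
van Hove: for every `h > 0`, the volume of the set of points at distance at most `h` from the
boundary is asymptotically negligible with respect to the volume of the region. -/
structure IsVanHove (Λ : ℕ → Set (Space d)) : Prop where
  measurableSet : ∀ k, MeasurableSet (Λ k)
  isBounded : ∀ k, Bornology.IsBounded (Λ k)
  volume_pos : ∀ k, 0 < MeasureTheory.volume (Λ k)
  boundary : ∀ h : ℝ, 0 < h → Filter.Tendsto
    (fun k => MeasureTheory.volume (Metric.cthickening h (frontier (Λ k))) /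
      MeasureTheory.volume (Λ k)) Filter.atTop (𝓝 0)

/-- `F(Λ)` tends to `a` as `Λ ↑ ℝ^d`, in the sense of van Hove. -/
def IsThermodynamicLimit (F : Set (Space d) → ℝ) (a : ℝ) : Prop :=
  ∀ Λ : ℕ → Set (Space d), IsVanHove d Λ →
    Filter.Tendsto (fun k => F (Λ k)) Filter.atTop (𝓝 a)

/-- The radius of convergence of the power series `∑ a_n z^n`. -/
def convergenceRadius (a : ℕ → ℝ) : ℝ≥0∞ :=
  (FormalMultilinearSeries.ofScalars ℝ a).radius

/-! ### Vertex sum and tree sum -/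

/-- The weight of a vertex at `x₀` whose children are the `i ∈ s`, located at the `x i`:
`∏_{i ∈ s} (1 - exp (-β φ(x₀, x_i))) ∏_{i < j, i, j ∈ s} exp (-β φ(x_i, x_j))`. -/
def vertexWeight {ι : Type} [LinearOrder ι] (x₀ : Space d) (s : Finset ι) (x : ι → Space d) :
    ℝ :=
  (∏ i ∈ s, (1 - pairWeight d β φ x₀ (x i))) *
    ∏ i ∈ s, ∏ j ∈ s with i < j, pairWeight d β φ (x i) (x j)

/-- `g(n)`, the integral of the weight of a vertex at the origin with `n` children. -/
def vertexIntegral (n : ℕ) : ℝ≥0∞ :=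
  ∫⁻ x : Fin n → Space d, ENNReal.ofReal (vertexWeight d β φ 0 Finset.univ x)

/-- The vertex sum `Ψ(μ) = 1 + ∑_{n ≥ 1} μ^n g(n) / n!`. -/
def vertexSum (μ : ℝ≥0) : ℝ≥0∞ :=
  1 + ∑' n : ℕ, (μ : ℝ≥0∞) ^ (n + 1) / ((n + 1).factorial : ℝ≥0∞) * vertexIntegral d β φ (n + 1)

open Classical in
/-- The children of the vertex `i` in a tree on `{0, …, n}` rooted at `0`. -/
def children {n : ℕ} (τ : SimpleGraph (Fin (n + 1))) (i : Fin (n + 1)) : Finset (Fin (n + 1)) :=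
  {j | τ.Adj i j ∧ τ.dist 0 j = τ.dist 0 i + 1}

open Classical in
/-- `B_n(x_0; x_1, …, x_n)`: the sum over all trees on `{0, …, n}`, rooted at `0`, of the product
over all vertices of the vertex weights. -/
def treeWeight {n : ℕ} (x : Fin (n + 1) → Space d) : ℝ :=
  ∑ τ : SimpleGraph (Fin (n + 1)) with τ.IsTree,
    ∏ i, vertexWeight d β φ (x i) (children τ i) x

/-- `∫ B_n(0; x_1, …, x_n) dx_1 ⋯ dx_n` (equal to `1` for `n = 0`). -/
def treeIntegral (n : ℕ) : ℝ≥0∞ :=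
  ∫⁻ x : Fin n → Space d,
    ENNReal.ofReal (treeWeight d β φ (Fin.cons (0 : Space d) x : Fin (n + 1) → Space d))

/-- The tree sum `𝓑(r) = 1 + ∑_{n ≥ 1} (r^n / n!) ∫ B_n(0; x_1, …, x_n) dx_1 ⋯ dx_n`, with values
in `[0, ∞]`. -/
def treeSum (r : ℝ≥0) : ℝ≥0∞ :=
  1 + ∑' n : ℕ, (r : ℝ≥0∞) ^ (n + 1) / ((n + 1).factorial : ℝ≥0∞) * treeIntegral d β φ (n + 1)

/-- The radius of convergence `r**` of the tree sum. -/
def treeRadius : ℝ≥0∞ :=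
  convergenceRadius fun n => (treeIntegral d β φ n).toReal / (n.factorial : ℝ)

/-! ### The two lower bounds -/

/-- `R* = sup_{0 ≤ r ≤ r**} r 𝓑(r) / (2 𝓑(r) - 1)`, the supremum being over finite `r`. -/
def RStar : ℝ≥0∞ :=
  ⨆ (r : ℝ≥0) (_ : (r : ℝ≥0∞) ≤ treeRadius d β φ),
    (r * treeSum d β φ r) / (2 * treeSum d β φ r - 1)

/-- `m` maximizes `μ / Ψ(μ)` over `μ ≥ 0`. -/
def IsMaximizer (m : ℝ≥0) : Prop :=
  ∀ μ : ℝ≥0, (μ : ℝ≥0∞) / vertexSum d β φ μ ≤ (m : ℝ≥0∞) / vertexSum d β φ m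

/-- `μ*`, the (smallest) maximizer of `μ / Ψ(μ)` over `μ ≥ 0`; it is `∞` if there is none, as for
the ideal gas, for which `Ψ = 1`. -/
def muStar : ℝ≥0∞ :=
  sInf ((fun m : ℝ≥0 => (m : ℝ≥0∞)) '' {m : ℝ≥0 | IsMaximizer d β φ m})

/-- `M* = sup_{0 ≤ μ ≤ μ*} μ / (2 Ψ(μ) - 1)`, the supremum being over finite `μ`. -/
def MStar : ℝ≥0∞ :=
  ⨆ (μ : ℝ≥0) (_ : (μ : ℝ≥0∞) ≤ muStar d β φ), (μ : ℝ≥0∞) / (2 * vertexSum d β φ μ - 1)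

end RepulsiveGas

end

noncomputable section

namespace RepulsiveGas

open MeasureTheory Finset

variable {d : ℕ} {β : ℝ} {φ : ℝ≥0 → ℝ≥0∞}

/-! ### Boltzmann factors and products of pair weights -/

lemma boltzmann_nonneg (β : ℝ) (u : ℝ≥0∞) : 0 ≤ boltzmann β u := by
  unfold boltzmann; split_ifs <;> positivity

lemma boltzmann_le_one (hβ : 0 < β) (u : ℝ≥0∞) : boltzmann β u ≤ 1 := by
  unfold boltzmann
  split_ifs
  · exact zero_le_one
  · have : 0 ≤ β * u.toReal := by positivity
    simpa using this

lemma boltzmann_add (β : ℝ) (u v : ℝ≥0∞) :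
    boltzmann β (u + v) = boltzmann β u * boltzmann β v := by
  unfold boltzmann
  by_cases hu : u = ⊤
  · simp [hu]
  by_cases hv : v = ⊤
  · simp [hv]
  · rw [if_neg hu, if_neg hv, if_neg (by simp [hu, hv]), ENNReal.toReal_add hu hv, ← Real.exp_add]
    ring_nf

lemma boltzmann_sum {ι : Type*} (β : ℝ) (s : Finset ι) (u : ι → ℝ≥0∞) :
    boltzmann β (∑ i ∈ s, u i) = ∏ i ∈ s, boltzmann β (u i) := by
  classical
  induction s using Finset.induction_on with
  | empty => simp [boltzmann]
  | insert a s ha ih => rw [sum_insert ha, prod_insert ha, boltzmann_add, ih]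

lemma measurable_boltzmann (β : ℝ) : Measurable (boltzmann β) := by
  unfold boltzmann
  refine Measurable.ite (measurableSet_singleton _) measurable_const ?_
  exact Real.measurable_exp.comp ((measurable_const.mul ENNReal.measurable_toReal).neg)

lemma pairWeight_nonneg (x y : Space d) : 0 ≤ pairWeight d β φ x y := boltzmann_nonneg _ _

lemma pairWeight_le_one (hβ : 0 < β) (x y : Space d) : pairWeight d β φ x y ≤ 1 :=
  boltzmann_le_one hβ _

lemma pairWeight_comm (x y : Space d) : pairWeight d β φ x y = pairWeight d β φ y x := by
  have h : ‖x - y‖₊ = ‖y - x‖₊ := NNReal.eq (norm_sub_rev x y)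
  rw [pairWeight, pairWeight, h]

lemma pairWeight_add_right (x y v : Space d) :
    pairWeight d β φ (x + v) (y + v) = pairWeight d β φ x y := by
  simp [pairWeight]

lemma measurable_pairWeight (hφ : Measurable φ) {X : Type*} [MeasurableSpace X]
    {f g : X → Space d} (hf : Measurable f) (hg : Measurable g) :
    Measurable fun a => pairWeight d β φ (f a) (g a) :=
  (measurable_boltzmann β).comp (hφ.comp (hf.sub hg).nnnorm)

variable (d β φ) in
/-- The product of the pair weights over all pairs of points of a finite configuration. -/
def pairProd {ι : Type*} [Fintype ι] [LinearOrder ι] (y : ι → Space d) : ℝ :=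
  ∏ i, ∏ j with i < j, pairWeight d β φ (y i) (y j)

variable (d β φ) in
/-- The product of the pair weights between the points of two finite configurations. -/
def crossProd {ι κ : Type*} [Fintype ι] [Fintype κ] (x : ι → Space d) (y : κ → Space d) : ℝ :=
  ∏ i, ∏ j, pairWeight d β φ (x i) (y j)

lemma boltzmann_energy {N : ℕ} (y : Fin N → Space d) :
    boltzmann β (energy d φ y) = pairProd d β φ y := by
  unfold energy pairProd
  rw [boltzmann_sum]
  refine prod_congr rfl fun i _ => ?_
  rw [boltzmann_sum]
  refine prod_congr ?_ fun j _ => rfl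
  ext j; simp

lemma vertexWeight_univ {m : ℕ} (a : Space d) (y : Fin m → Space d) :
    vertexWeight d β φ a univ y = (∏ i, (1 - pairWeight d β φ a (y i))) * pairProd d β φ y := rfl

section Bounds

variable {ι κ : Type*} [Fintype ι] [Fintype κ]

lemma pairProd_nonneg [LinearOrder ι] (y : ι → Space d) : 0 ≤ pairProd d β φ y :=
  prod_nonneg fun _ _ => prod_nonneg fun _ _ => pairWeight_nonneg _ _

lemma pairProd_le_one [LinearOrder ι] (hβ : 0 < β) (y : ι → Space d) : pairProd d β φ y ≤ 1 :=
  prod_le_one (fun _ _ => prod_nonneg fun _ _ => pairWeight_nonneg _ _) fun _ _ =>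
    prod_le_one (fun _ _ => pairWeight_nonneg _ _) fun _ _ => pairWeight_le_one hβ _ _

lemma crossProd_nonneg (x : ι → Space d) (y : κ → Space d) : 0 ≤ crossProd d β φ x y :=
  prod_nonneg fun _ _ => prod_nonneg fun _ _ => pairWeight_nonneg _ _

lemma crossProd_le_one (hβ : 0 < β) (x : ι → Space d) (y : κ → Space d) :
    crossProd d β φ x y ≤ 1 :=
  prod_le_one (fun _ _ => prod_nonneg fun _ _ => pairWeight_nonneg _ _) fun _ _ =>
    prod_le_one (fun _ _ => pairWeight_nonneg _ _) fun _ _ => pairWeight_le_one hβ _ _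

lemma measurable_pairProd [LinearOrder ι] (hφ : Measurable φ) {X : Type*} [MeasurableSpace X]
    {f : X → ι → Space d} (hf : Measurable f) : Measurable fun a => pairProd d β φ (f a) :=
  Finset.measurable_prod _ fun i _ => Finset.measurable_prod _ fun j _ =>
    measurable_pairWeight hφ ((measurable_pi_apply i).comp hf) ((measurable_pi_apply j).comp hf)

lemma measurable_crossProd (hφ : Measurable φ) {X : Type*} [MeasurableSpace X]
    {f : X → ι → Space d} {g : X → κ → Space d} (hf : Measurable f) (hg : Measurable g) :
    Measurable fun a => crossProd d β φ (f a) (g a) :=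
  Finset.measurable_prod _ fun i _ => Finset.measurable_prod _ fun j _ =>
    measurable_pairWeight hφ ((measurable_pi_apply i).comp hf) ((measurable_pi_apply j).comp hg)

end Bounds

lemma vertexWeight_nonneg {ι : Type} [LinearOrder ι] (hβ : 0 < β) (a : Space d) (s : Finset ι)
    (x : ι → Space d) : 0 ≤ vertexWeight d β φ a s x :=
  mul_nonneg (prod_nonneg fun _ _ => sub_nonneg.2 (pairWeight_le_one hβ _ _))
    (prod_nonneg fun _ _ => prod_nonneg fun _ _ => pairWeight_nonneg _ _)

lemma vertexWeight_le_prod {ι : Type} [LinearOrder ι] (hβ : 0 < β) (a : Space d) (s : Finset ι)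
    (x : ι → Space d) :
    vertexWeight d β φ a s x ≤ ∏ i ∈ s, (1 - pairWeight d β φ a (x i)) :=
  mul_le_of_le_one_right (prod_nonneg fun _ _ => sub_nonneg.2 (pairWeight_le_one hβ _ _))
    (prod_le_one (fun _ _ => prod_nonneg fun _ _ => pairWeight_nonneg _ _) fun _ _ =>
      prod_le_one (fun _ _ => pairWeight_nonneg _ _) fun _ _ => pairWeight_le_one hβ _ _)

lemma vertexWeight_le_one {ι : Type} [LinearOrder ι] (hβ : 0 < β) (a : Space d) (s : Finset ι)
    (x : ι → Space d) : vertexWeight d β φ a s x ≤ 1 :=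
  (vertexWeight_le_prod hβ a s x).trans
    (prod_le_one (fun _ _ => sub_nonneg.2 (pairWeight_le_one hβ _ _))
      fun _ _ => sub_le_self _ (pairWeight_nonneg _ _))

lemma measurable_vertexWeight {ι : Type} [LinearOrder ι] (hφ : Measurable φ) {X : Type*}
    [MeasurableSpace X] {a : X → Space d} (s : Finset ι) {f : X → ι → Space d}
    (ha : Measurable a) (hf : Measurable f) :
    Measurable fun t => vertexWeight d β φ (a t) s (f t) := by
  unfold vertexWeight
  refine (Finset.measurable_prod _ fun i _ => measurable_const.sub
    (measurable_pairWeight hφ ha ((measurable_pi_apply i).comp hf))).mul ?_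
  exact Finset.measurable_prod _ fun i _ => Finset.measurable_prod _ fun j _ =>
    measurable_pairWeight hφ ((measurable_pi_apply i).comp hf) ((measurable_pi_apply j).comp hf)

lemma vertexWeight_add_right {ι : Type} [LinearOrder ι] (a v : Space d) (s : Finset ι)
    (x : ι → Space d) :
    vertexWeight d β φ (a + v) s (fun i => x i + v) = vertexWeight d β φ a s x := by
  simp [vertexWeight, pairWeight_add_right]

lemma crossProd_add_right {ι κ : Type*} [Fintype ι] [Fintype κ] (x : ι → Space d)
    (y : κ → Space d) (v : Space d) :
    crossProd d β φ (fun i => x i + v) (fun i => y i + v) = crossProd d β φ x y := by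
  simp [crossProd, pairWeight_add_right]

/-- The vertex integral does not depend on the position of the vertex. -/
lemma lintegral_vertexWeight (m : ℕ) (a : Space d) :
    ∫⁻ y : Fin m → Space d, ENNReal.ofReal (vertexWeight d β φ a univ y) =
      vertexIntegral d β φ m := by
  unfold vertexIntegral
  rw [← lintegral_add_right_eq_self
    (fun y : Fin m → Space d => ENNReal.ofReal (vertexWeight d β φ a univ y)) (fun _ => a)]
  refine lintegral_congr fun y => ?_
  congr 1
  have := vertexWeight_add_right (β := β) (φ := φ) 0 a univ y
  rw [zero_add] at this
  exact this

/-! ### The exploration coefficients -/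

variable (d β φ) in
/-- The weight of exploring the point `x 0` of a configuration, which has the new neighbours `y`:
these are not neighbours of the remaining points of the configuration. -/
def stepWeight {k m : ℕ} (x : Fin (k + 1) → Space d) (y : Fin m → Space d) : ℝ :=
  vertexWeight d β φ (x 0) univ y * crossProd d β φ (Fin.tail x) y

lemma stepWeight_nonneg (hβ : 0 < β) {k m : ℕ} (x : Fin (k + 1) → Space d) (y : Fin m → Space d) :
    0 ≤ stepWeight d β φ x y :=
  mul_nonneg (vertexWeight_nonneg hβ _ _ _) (crossProd_nonneg _ _)

lemma stepWeight_le (hβ : 0 < β) {k m : ℕ} (x : Fin (k + 1) → Space d) (y : Fin m → Space d) :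
    stepWeight d β φ x y ≤ vertexWeight d β φ (x 0) univ y :=
  mul_le_of_le_one_right (vertexWeight_nonneg hβ _ _ _) (crossProd_le_one hβ _ _)

lemma stepWeight_le_one (hβ : 0 < β) {k m : ℕ} (x : Fin (k + 1) → Space d)
    (y : Fin m → Space d) : stepWeight d β φ x y ≤ 1 :=
  (stepWeight_le hβ x y).trans (vertexWeight_le_one hβ _ _ _)

lemma measurable_tail {k : ℕ} : Measurable (Fin.tail : (Fin (k + 1) → Space d) → _) :=
  measurable_pi_lambda _ fun i => measurable_pi_apply i.succ

lemma measurable_append {k m : ℕ} {X : Type*} [MeasurableSpace X] {f : X → Fin k → Space d}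
    {g : X → Fin m → Space d} (hf : Measurable f) (hg : Measurable g) :
    Measurable fun a => Fin.append (f a) (g a) := by
  refine measurable_pi_lambda _ fun i => ?_
  refine Fin.addCases (fun i => ?_) (fun i => ?_) i
  · simp only [Fin.append_left]
    exact (measurable_pi_apply i).comp hf
  · simp only [Fin.append_right]
    exact (measurable_pi_apply i).comp hg

lemma measurable_stepWeight (hφ : Measurable φ) {k m : ℕ} {X : Type*} [MeasurableSpace X]
    {f : X → Fin (k + 1) → Space d} {g : X → Fin m → Space d} (hf : Measurable f)
    (hg : Measurable g) : Measurable fun a => stepWeight d β φ (f a) (g a) := by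
  have h0 : Measurable fun a => f a 0 := (measurable_pi_apply 0).comp hf
  have ht : Measurable fun a => Fin.tail (f a) := measurable_tail.comp hf
  unfold stepWeight
  exact (measurable_vertexWeight hφ univ h0 hg).mul (measurable_crossProd hφ ht hg)

lemma stepWeight_add_right {k m : ℕ} (x : Fin (k + 1) → Space d) (y : Fin m → Space d)
    (v : Space d) :
    stepWeight d β φ (fun i => x i + v) (fun i => y i + v) = stepWeight d β φ x y := by
  unfold stepWeight
  rw [vertexWeight_add_right, ← crossProd_add_right _ y v]
  rfl

variable (d β φ) in
/-- The total weight of the explorations in the region `Λ` of `N` points in all which start with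
the active points `x` and stop as soon as exactly `s` active points are left. An exploration step
removes the first active point and adds its new neighbours. For `s = 0` this is, up to signs, a
coefficient of the fugacity expansion of a ratio of partition functions. -/
def explore (s : ℕ) (Λ : Set (Space d)) : ℕ → (k : ℕ) → (Fin k → Space d) → ℝ≥0∞
  | 0, k, _ => if k = s ∧ s = 0 then 1 else 0
  | _ + 1, 0, _ => 0
  | N + 1, k + 1, x =>
    if k + 1 = s then (if N + 1 = s then 1 else 0) else
      ∑' m : ℕ, ((m.factorial : ℝ≥0∞))⁻¹ * ∫⁻ y in Set.univ.pi (fun _ : Fin m => Λ),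
        ENNReal.ofReal (stepWeight d β φ x y) *
          explore s Λ N (k + m) (Fin.append (Fin.tail x) y)

lemma explore_succ_succ {s : ℕ} (Λ : Set (Space d)) (N k : ℕ) (x : Fin (k + 1) → Space d)
    (hk : k + 1 ≠ s) :
    explore d β φ s Λ (N + 1) (k + 1) x =
      ∑' m : ℕ, ((m.factorial : ℝ≥0∞))⁻¹ * ∫⁻ y in Set.univ.pi (fun _ : Fin m => Λ),
        ENNReal.ofReal (stepWeight d β φ x y) *
          explore d β φ s Λ N (k + m) (Fin.append (Fin.tail x) y) := by
  rw [explore, if_neg hk]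

lemma explore_eq_zero_of_lt (s : ℕ) (Λ : Set (Space d)) {N k : ℕ} (h : N < k)
    (x : Fin k → Space d) : explore d β φ s Λ N k x = 0 := by
  induction N generalizing k with
  | zero => rw [explore, if_neg (by omega)]
  | succ N ih =>
    obtain _ | k := k
    · omega
    · rw [explore]
      split_ifs
      · omega
      · rfl
      · simp only [ENNReal.tsum_eq_zero]
        intro m
        simp [ih (show N < k + m by omega)]

lemma measurable_explore (hφ : Measurable φ) (s : ℕ) (Λ : Set (Space d)) (N k : ℕ) :
    Measurable (explore d β φ s Λ N k) := by
  induction N generalizing k with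
  | zero => simp only [explore]; exact measurable_const
  | succ N ih =>
    obtain _ | k := k
    · simp only [explore]; exact measurable_const
    · simp only [explore]
      split_ifs
      · exact measurable_const
      · exact measurable_const
      · refine Measurable.tsum fun m => Measurable.const_mul ?_ _
        refine Measurable.lintegral_prod_right'
          (f := fun p : (Fin (k + 1) → Space d) × (Fin m → Space d) =>
            ENNReal.ofReal (stepWeight d β φ p.1 p.2) *
              explore d β φ s Λ N (k + m) (Fin.append (Fin.tail p.1) p.2)) ?_
        exact (measurable_stepWeight hφ measurable_fst measurable_snd).ennreal_ofReal.mul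
          ((ih (k + m)).comp (measurable_append (measurable_tail.comp measurable_fst)
            measurable_snd))

lemma explore_mono (s : ℕ) {Λ Λ' : Set (Space d)} (h : Λ ⊆ Λ') (N k : ℕ) (x : Fin k → Space d) :
    explore d β φ s Λ N k x ≤ explore d β φ s Λ' N k x := by
  induction N generalizing k with
  | zero => simp [explore]
  | succ N ih =>
    obtain _ | k := k
    · simp [explore]
    · simp only [explore]
      split_ifs
      · exact le_rfl
      · exact le_rfl
      · refine ENNReal.tsum_le_tsum fun m => mul_le_mul_right ?_ _
        refine lintegral_mono' (Measure.restrict_mono (Set.pi_mono fun _ _ => h) le_rfl) ?_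
        exact fun y => mul_le_mul_right (ih _ _) _

lemma explore_add_right (s : ℕ) (Λ : Set (Space d)) (v : Space d) (N k : ℕ)
    (x : Fin k → Space d) :
    explore d β φ s ((· + v) ⁻¹' Λ) N k x = explore d β φ s Λ N k (fun i => x i + v) := by
  induction N generalizing k with
  | zero => simp [explore]
  | succ N ih =>
    obtain _ | k := k
    · simp [explore]
    · simp only [explore]
      split_ifs
      · rfl
      · rfl
      · refine tsum_congr fun m => congrArg _ ?_
        have hmp : MeasurePreserving (fun y : Fin m → Space d => y + fun _ => v) :=
          measurePreserving_add_right volume _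
        have hemb : MeasurableEmbedding (fun y : Fin m → Space d => y + fun _ => v) :=
          measurableEmbedding_addRight _
        refine Eq.trans ?_ (hmp.setLIntegral_comp_preimage_emb hemb (fun y =>
          ENNReal.ofReal (stepWeight d β φ (fun i => x i + v) y) *
            explore d β φ s Λ N (k + m) (Fin.append (Fin.tail fun i => x i + v) y))
          (Set.univ.pi fun _ => Λ))
        refine lintegral_congr fun y => ?_
        rw [ih]
        congr 1
        · rw [← stepWeight_add_right x y v]
          rfl
        · congr 1
          funext i
          refine Fin.addCases (fun i => ?_) (fun i => ?_) i
          · simp [Fin.tail]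
          · simp

end RepulsiveGas

end

noncomputable section

namespace RepulsiveGas

open MeasureTheory Finset

/-! ### Forests with vertex weights depending on the number of children -/

/-- The sum over all rooted forests with `N` vertices and `k` roots, divided by the factorial of
the number of vertices that are not roots, of the product over the vertices of the weights
`g (number of children)`. -/
def forestCoeff (g : ℕ → ℝ≥0∞) : ℕ → ℕ → ℝ≥0∞
  | 0, k => if k = 0 then 1 else 0
  | _ + 1, 0 => 0
  | N + 1, k + 1 => ∑' m : ℕ, ((m.factorial : ℝ≥0∞))⁻¹ * (g m * forestCoeff g N (k + m))

section Forest

variable (g : ℕ → ℝ≥0∞)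

lemma forestCoeff_zero_right (N : ℕ) : forestCoeff g N 0 = if N = 0 then 1 else 0 := by
  cases N <;> simp [forestCoeff]

lemma forestCoeff_eq_zero_of_lt {N k : ℕ} (h : N < k) : forestCoeff g N k = 0 := by
  induction N generalizing k with
  | zero => rw [forestCoeff, if_neg (by omega)]
  | succ N ih =>
    obtain _ | k := k
    · omega
    · rw [forestCoeff]
      simp only [ENNReal.tsum_eq_zero]
      intro m
      simp [ih (show N < k + m by omega)]

lemma forestCoeff_add (N k l : ℕ) :
    forestCoeff g N (k + l) = ∑ p ∈ antidiagonal N, forestCoeff g p.1 k * forestCoeff g p.2 l := by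
  induction N generalizing k with
  | zero => cases k <;> cases l <;> simp [forestCoeff]
  | succ N ih =>
    obtain _ | k := k
    · rw [Nat.antidiagonal_succ]
      simp [forestCoeff_zero_right]
    · rw [Nat.antidiagonal_succ, sum_cons, sum_map, show k + 1 + l = k + l + 1 by ring]
      simp only [forestCoeff, Function.Embedding.prodMap, Function.Embedding.coeFn_mk,
        Prod.map]
      rw [if_neg (by omega), zero_mul, zero_add]
      simp only [Function.Embedding.refl_apply, ← ENNReal.tsum_mul_right]
      rw [← Summable.tsum_finsetSum fun _ _ => ENNReal.summable]
      refine tsum_congr fun m => ?_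
      rw [show k + l + m = k + m + l by ring, ih, mul_sum, mul_sum]
      exact sum_congr rfl fun p _ => by ring

/-- The generating function of the forests with `k` roots. -/
def forestSum (r : ℝ≥0∞) (k : ℕ) : ℝ≥0∞ := ∑' N, forestCoeff g N k * r ^ N

lemma tsum_mul_tsum_antidiagonal (a b : ℕ → ℝ≥0∞) :
    (∑' n, a n) * ∑' n, b n = ∑' n, ∑ p ∈ antidiagonal n, a p.1 * b p.2 := by
  rw [← ENNReal.tsum_mul_right]
  simp_rw [← ENNReal.tsum_mul_left]
  rw [← ENNReal.tsum_prod, ← Finset.HasAntidiagonal.sigmaAntidiagonalEquivProd.tsum_eq, ENNReal.tsum_sigma']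
  refine tsum_congr fun n => ?_
  rw [tsum_fintype]
  exact Finset.sum_coe_sort (antidiagonal n) fun p => a p.1 * b p.2

lemma forestSum_zero (r : ℝ≥0∞) : forestSum g r 0 = 1 := by
  unfold forestSum
  rw [tsum_eq_single 0]
  · simp [forestCoeff]
  · intro N hN
    simp [forestCoeff_zero_right, hN]

lemma forestSum_add (r : ℝ≥0∞) (k l : ℕ) :
    forestSum g r (k + l) = forestSum g r k * forestSum g r l := by
  unfold forestSum
  rw [tsum_mul_tsum_antidiagonal]
  refine tsum_congr fun n => ?_
  rw [forestCoeff_add, sum_mul]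
  refine sum_congr rfl fun p hp => ?_
  rw [← mem_antidiagonal.1 hp, pow_add]
  ring

lemma forestSum_eq_pow (r : ℝ≥0∞) (k : ℕ) : forestSum g r k = forestSum g r 1 ^ k := by
  induction k with
  | zero => rw [forestSum_zero, pow_zero]
  | succ k ih => rw [forestSum_add, ih, pow_succ]

lemma forestSum_one (r : ℝ≥0∞) :
    forestSum g r 1 = r * ∑' N, forestCoeff g (N + 1) 1 * r ^ N := by
  unfold forestSum
  rw [tsum_eq_zero_add' ENNReal.summable, forestCoeff, if_neg one_ne_zero, zero_mul, zero_add,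
    ← ENNReal.tsum_mul_left]
  exact tsum_congr fun N => by ring

/-- The functional equation of the generating function of the trees. -/
lemma tsum_forestCoeff_one (r : ℝ≥0∞) :
    ∑' N, forestCoeff g (N + 1) 1 * r ^ N =
      ∑' m : ℕ, ((m.factorial : ℝ≥0∞))⁻¹ * (g m * forestSum g r 1 ^ m) := by
  simp_rw [← forestSum_eq_pow]
  simp only [forestSum, forestCoeff, ← ENNReal.tsum_mul_left, ← ENNReal.tsum_mul_right, zero_add]
  rw [ENNReal.tsum_comm]
  exact tsum_congr fun m => tsum_congr fun N => by ring

/-- The generating function of the trees is the smallest solution of its functional equation. -/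
lemma forestSum_le {r a : ℝ≥0∞}
    (h : r * (∑' m : ℕ, ((m.factorial : ℝ≥0∞))⁻¹ * (g m * a ^ m)) ≤ a) :
    forestSum g r 1 ≤ a := by
  have key : ∀ n k, ∑ N ∈ range n, forestCoeff g N k * r ^ N ≤ a ^ k := by
    intro n
    induction n with
    | zero => simp
    | succ n ih =>
      intro k
      rw [sum_range_succ']
      obtain _ | k := k
      · simp [forestCoeff]
      · simp only [forestCoeff, if_neg (Nat.succ_ne_zero k), zero_mul,
          add_zero]
        calc ∑ N ∈ range n, (∑' m : ℕ, ((m.factorial : ℝ≥0∞))⁻¹ *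
                (g m * forestCoeff g N (k + m))) * r ^ (N + 1)
            = r * ∑' m : ℕ, ((m.factorial : ℝ≥0∞))⁻¹ *
                (g m * ∑ N ∈ range n, forestCoeff g N (k + m) * r ^ N) := by
              simp only [mul_sum, ← ENNReal.tsum_mul_right, ← ENNReal.tsum_mul_left]
              rw [← Summable.tsum_finsetSum fun _ _ => ENNReal.summable]
              exact tsum_congr fun m => sum_congr rfl fun N _ => by ring
          _ ≤ r * ∑' m : ℕ, ((m.factorial : ℝ≥0∞))⁻¹ * (g m * a ^ (k + m)) := by
              gcongr with m
              exact ih _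
          _ = (r * ∑' m : ℕ, ((m.factorial : ℝ≥0∞))⁻¹ * (g m * a ^ m)) * a ^ k := by
              simp only [← ENNReal.tsum_mul_right, ← ENNReal.tsum_mul_left]
              exact tsum_congr fun m => by ring
          _ ≤ a * a ^ k := by gcongr
          _ = a ^ (k + 1) := by ring
  unfold forestSum
  rw [ENNReal.tsum_eq_iSup_nat]
  exact iSup_le fun n => (key n 1).trans_eq (pow_one a)

end Forest

variable {d : ℕ} {β : ℝ} {φ : ℝ≥0 → ℝ≥0∞}

/-- The exploration coefficients are bounded by sums over forests. -/
lemma explore_le_forestCoeff (hβ : 0 < β) (hφ : Measurable φ) (Λ : Set (Space d)) (N k : ℕ)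
    (x : Fin k → Space d) :
    explore d β φ 0 Λ N k x ≤ forestCoeff (vertexIntegral d β φ) N k := by
  induction N generalizing k with
  | zero => simp [explore, forestCoeff]
  | succ N ih =>
    obtain _ | k := k
    · simp [explore]
    · rw [explore_succ_succ Λ N k x k.succ_ne_zero, forestCoeff]
      refine ENNReal.tsum_le_tsum fun m => mul_le_mul_right ?_ _
      calc ∫⁻ y in Set.univ.pi (fun _ : Fin m => Λ), ENNReal.ofReal (stepWeight d β φ x y) *
              explore d β φ 0 Λ N (k + m) (Fin.append (Fin.tail x) y)
          ≤ ∫⁻ y : Fin m → Space d, ENNReal.ofReal (vertexWeight d β φ (x 0) univ y) *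
              forestCoeff (vertexIntegral d β φ) N (k + m) := by
            refine (setLIntegral_le_lintegral _ _).trans (lintegral_mono fun y => ?_)
            exact mul_le_mul' (ENNReal.ofReal_le_ofReal (stepWeight_le hβ x y)) (ih _ _)
        _ = _ := by
            have hm : Measurable fun y : Fin m → Space d =>
                ENNReal.ofReal (vertexWeight d β φ (x 0) univ y) :=
              (measurable_vertexWeight hφ univ measurable_const measurable_id).ennreal_ofReal
            rw [lintegral_mul_const _ hm, lintegral_vertexWeight]

end RepulsiveGas

end

noncomputable section

namespace RepulsiveGas

open MeasureTheory Finset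

/-! ### Parent functions of rooted forests -/

section Parent

variable {ι : Type*} [DecidableEq ι]

/-- `p` maps every vertex in `U` to its parent, in a forest on `A ∪ U` with set of roots `A`; all
the other points are fixed. -/
def IsForest (A U : Finset ι) (p : ι → ι) : Prop :=
  (∀ i ∉ U, p i = i) ∧ ∀ u ∈ U, ∃ k, p^[k] u ∈ A

variable {A U S : Finset ι} {a : ι}

lemma IsForest.removeRoot {p : ι → ι} (hAU : Disjoint A U) (hp : IsForest A U p) :
    IsForest (A.erase a ∪ {u ∈ U | p u = a}) (U \ {u ∈ U | p u = a})
      (fun i => if i ∈ U ∧ p i = a then i else p i) := by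
  set p' : ι → ι := fun i => if i ∈ U ∧ p i = a then i else p i with hp'
  constructor
  · intro i hi
    by_cases h : i ∈ U ∧ p i = a
    · simp [hp', h]
    · have hiU : i ∉ U := fun hiU => hi (by simp_all)
      simp [hp', hiU, hp.1 i hiU]
  · have key : ∀ k, ∀ u ∈ U, p u ≠ a → p^[k] u ∈ A →
        ∃ k', p'^[k'] u ∈ A.erase a ∪ {u ∈ U | p u = a} := by
      intro k
      induction k with
      | zero => intro u hu _ hA; exact absurd hu (disjoint_left.1 hAU hA)
      | succ k ih =>
        intro u hu hpu hk
        rw [Function.iterate_succ_apply] at hk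
        have hpu' : p' u = p u := by simp [hp', hpu]
        by_cases hv : p u ∈ U
        · by_cases hva : p (p u) = a
          · exact ⟨1, by simp [hpu', hv, hva]⟩
          · obtain ⟨k', hk'⟩ := ih _ hv hva hk
            exact ⟨k' + 1, by rwa [Function.iterate_succ_apply, hpu']⟩
        · rw [Function.iterate_fixed (hp.1 _ hv)] at hk
          exact ⟨1, by simp [hpu', hk, hpu]⟩
    intro u hu
    simp only [mem_sdiff, mem_filter, not_and] at hu
    obtain ⟨k, hk⟩ := hp.2 u hu.1
    exact key k u hu.1 (hu.2 hu.1) hk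

lemma IsForest.addRoot {p : ι → ι} (hAU : Disjoint A U) (ha : a ∈ A) (hS : S ⊆ U)
    (hp : IsForest (A.erase a ∪ S) (U \ S) p) :
    IsForest A U (fun i => if i ∈ S then a else p i) ∧
      {u ∈ U | (if u ∈ S then a else p u) = a} = S := by
  set p' : ι → ι := fun i => if i ∈ S then a else p i with hp'
  have haU : a ∉ U := disjoint_left.1 hAU ha
  refine ⟨⟨?_, ?_⟩, ?_⟩
  · intro i hi
    have hiS : i ∉ S := fun h => hi (hS h)
    simp [hp', hiS, hp.1 i (by simp [hi])]
  · have key : ∀ k u, u ∈ U → u ∉ S → p^[k] u ∈ A.erase a ∪ S → ∃ k', p'^[k'] u ∈ A := by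
      intro k
      induction k with
      | zero =>
        intro u hu huS hk
        have : u ∉ A := disjoint_right.1 hAU hu
        simp_all
      | succ k ih =>
        intro u hu huS hk
        rw [Function.iterate_succ_apply] at hk
        have hpu : p' u = p u := by simp [hp', huS]
        by_cases hvS : p u ∈ S
        · refine ⟨2, ?_⟩
          rw [Function.iterate_succ_apply, hpu]
          simpa [hp', hvS] using ha
        by_cases hv : p u ∈ U
        · obtain ⟨k', hk'⟩ := ih _ hv hvS hk
          exact ⟨k' + 1, by rwa [Function.iterate_succ_apply, hpu]⟩
        · rw [Function.iterate_fixed (hp.1 _ (by simp [hv]))] at hk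
          refine ⟨1, ?_⟩
          simp only [mem_union, mem_erase, hvS, or_false] at hk
          simpa [hpu] using hk.2
    intro u hu
    by_cases huS : u ∈ S
    · exact ⟨1, by simpa [hp', huS] using ha⟩
    · obtain ⟨k, hk⟩ := hp.2 u (by simp [hu, huS])
      exact key k u hu huS hk
  · ext u
    simp only [mem_filter]
    constructor
    · rintro ⟨hu, h⟩
      by_contra huS
      rw [if_neg huS] at h
      obtain ⟨k, hk⟩ := hp.2 u (by simp [hu, huS])
      obtain _ | k := k
      · have : u ∉ A := disjoint_right.1 hAU hu
        simp_all
      · rw [Function.iterate_succ_apply, h, Function.iterate_fixed (hp.1 a (by simp [haU]))] at hk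
        have : a ∉ S := fun h => haU (hS h)
        simp_all
    · intro h
      exact ⟨hS h, by simp [h]⟩

variable [Fintype ι] {R : Type*} [CommSemiring R]

open Classical in
/-- The sum over all forests on `A ∪ U` with set of roots `A` of the product over the vertices of
weights which depend on the vertex and on its set of children. -/
def forestTotal (G : ι → Finset ι → R) (A U : Finset ι) : R :=
  ∑ p : ι → ι with IsForest A U p, ∏ i ∈ A ∪ U, G i {u ∈ U | p u = i}

lemma forestTotal_empty_left (G : ι → Finset ι → R) (U : Finset ι) :
    forestTotal G ∅ U = if U = ∅ then 1 else 0 := by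
  classical
  unfold forestTotal
  split_ifs with h
  · subst h
    have : ({p : ι → ι | IsForest ∅ ∅ p} : Finset _) = {id} := by
      ext p
      simp [IsForest, funext_iff]
    rw [this]
    simp
  · refine sum_eq_zero fun p hp => ?_
    obtain ⟨u, hu⟩ := nonempty_iff_ne_empty.2 h
    obtain ⟨k, hk⟩ := (mem_filter.1 hp).2.2 u hu
    simp at hk

lemma forestTotal_eq_sum_powerset (G : ι → Finset ι → R) (hAU : Disjoint A U) (ha : a ∈ A) :
    forestTotal G A U =
      ∑ S ∈ U.powerset, G a S * forestTotal G (A.erase a ∪ S) (U \ S) := by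
  classical
  have haU : a ∉ U := disjoint_left.1 hAU ha
  unfold forestTotal
  rw [← sum_fiberwise_of_maps_to (t := U.powerset)
    (g := fun p : ι → ι => ({u ∈ U | p u = a} : Finset ι)) (by simp)]
  refine sum_congr rfl fun S hS => ?_
  rw [mem_powerset] at hS
  rw [mul_sum]
  refine sum_bij' (fun p _ => fun i => if i ∈ U ∧ p i = a then i else p i)
    (fun p _ => fun i => if i ∈ S then a else p i) ?_ ?_ ?_ ?_ ?_
  · intro p hp
    simp only [mem_filter, mem_univ, true_and] at hp ⊢
    have := hp.1.removeRoot (a := a) hAU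
    rwa [hp.2] at this
  · intro p hp
    simp only [mem_filter, mem_univ, true_and] at hp ⊢
    exact hp.addRoot hAU ha hS
  · intro p hp
    simp only [mem_filter, mem_univ, true_and] at hp
    funext i
    have hi : i ∈ S ↔ i ∈ U ∧ p i = a := by rw [← hp.2]; simp
    by_cases h : i ∈ S
    · simp [h, (hi.1 h).2]
    · simp only [h, if_false]
      rw [if_neg (fun h' => h (hi.2 h'))]
  · intro p hp
    simp only [mem_filter, mem_univ, true_and] at hp
    have hfib := (hp.addRoot hAU ha hS).2
    funext i
    have hi : (i ∈ U ∧ (if i ∈ S then a else p i) = a) ↔ i ∈ S := by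
      simpa only [mem_filter] using Finset.ext_iff.1 hfib i
    by_cases h : i ∈ S
    · rw [if_pos (hi.2 h), hp.1 i (by simp [h])]
    · rw [if_neg (fun h' => h (hi.1 h'))]
      exact if_neg h
  · intro p hp
    simp only [mem_filter, mem_univ, true_and] at hp
    have hset : A ∪ U = insert a (A.erase a ∪ S ∪ U \ S) := by
      ext i
      simp only [mem_union, mem_insert, mem_erase, mem_sdiff]
      by_cases h1 : i = a
      · simp [h1, ha]
      · by_cases h2 : i ∈ S
        · simp [h2, hS h2]
        · simp [h1, h2]
    have ha' : a ∉ A.erase a ∪ S ∪ U \ S := by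
      have : a ∉ S := fun h => haU (hS h)
      simp [haU, this]
    rw [hset, prod_insert ha', hp.2]
    congr 1
    refine prod_congr rfl fun i hi => ?_
    have hia : i ≠ a := fun h => ha' (h ▸ hi)
    congr 1
    ext u
    have hu : u ∈ S ↔ u ∈ U ∧ p u = a := by rw [← hp.2]; simp
    simp only [mem_filter, mem_sdiff]
    by_cases h : u ∈ S
    · simp [h, (hu.1 h).2, hia.symm]
    · rw [if_neg (fun h' => h (hu.2 h'))]
      simp [h]

end Parent

/-! ### Integration over the positions of the vertices of a forest -/

variable {d : ℕ} {β : ℝ} {φ : ℝ≥0 → ℝ≥0∞}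

section Marginal

variable {ι : Type} [LinearOrder ι]

variable (d β φ) in
/-- The vertex weights of a configuration with values in `[0, ∞]`. -/
def vertexWeightENN (x : ι → Space d) (i : ι) (S : Finset ι) : ℝ≥0∞ :=
  ENNReal.ofReal (vertexWeight d β φ (x i) S x)

lemma measurable_vertexWeightENN (hφ : Measurable φ) (i : ι) (S : Finset ι) :
    Measurable fun x : ι → Space d => vertexWeightENN d β φ x i S :=
  (measurable_vertexWeight hφ S (measurable_pi_apply i) measurable_id).ennreal_ofReal

lemma measurable_forestTotal [Fintype ι] (hφ : Measurable φ) (A U : Finset ι) :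
    Measurable fun x : ι → Space d => forestTotal (vertexWeightENN d β φ x) A U := by
  unfold forestTotal
  exact Finset.measurable_sum _ fun p _ => Finset.measurable_prod _ fun i _ =>
    measurable_vertexWeightENN hφ _ _

lemma vertexWeight_congr {x y : ι → Space d} (a : Space d) {S : Finset ι}
    (h : ∀ i ∈ S, x i = y i) : vertexWeight d β φ a S x = vertexWeight d β φ a S y := by
  unfold vertexWeight
  congr 1
  · exact prod_congr rfl fun i hi => by rw [h i hi]
  · refine prod_congr rfl fun i hi => prod_congr rfl fun j hj => ?_
    rw [h i hi, h j (mem_filter.1 hj).1]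

lemma vertexWeight_image {m : ℕ} (e : Fin m ↪o ι) (a : Space d) {S : Finset ι}
    (hS : univ.image e = S) (x : ι → Space d) :
    vertexWeight d β φ a S x = vertexWeight d β φ a univ (x ∘ e) := by
  subst hS
  unfold vertexWeight
  rw [prod_image (by simp [e.injective.injOn]), prod_image (by simp [e.injective.injOn])]
  congr 1
  refine prod_congr rfl fun i _ => ?_
  rw [filter_image, prod_image (by simp [e.injective.injOn])]
  simp

lemma lmarginal_vertexWeightENN (hφ : Measurable φ) (i : ι) (S : Finset ι) (hi : i ∉ S)
    (x : ι → Space d) :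
    (∫⋯∫⁻_S, (fun x => vertexWeightENN d β φ x i S) ∂(fun _ => volume)) x =
      vertexIntegral d β φ #S := by
  set e := S.orderEmbOfFin rfl with he
  have hS : univ.image e = S := by
    ext j; simp [he]
  set F : (Fin #S → Space d) → ℝ≥0∞ := fun y => ENNReal.ofReal (vertexWeight d β φ (x i) univ y)
  have hF : Measurable F := (measurable_vertexWeight hφ univ measurable_const
    measurable_id).ennreal_ofReal
  have h1 := lmarginal_image (μ := fun _ : ι => (volume : Measure (Space d))) (e := e)
    e.injective univ hF x
  rw [lmarginal_univ] at h1
  rw [← lintegral_vertexWeight #S (x i)]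
  refine Eq.trans ?_ h1
  rw [hS]
  unfold lmarginal
  refine lintegral_congr fun y => ?_
  simp only [vertexWeightENN, Function.comp_def, F]
  congr 1
  have h2 : Function.updateFinset x S y i = x i := by simp [Function.updateFinset, hi]
  rw [h2]
  rw [vertexWeight_image e (x i) hS]
  rfl

lemma lmarginal_sum {κ : Type*} (T : Finset κ) (U : Finset ι) (f : κ → (ι → Space d) → ℝ≥0∞)
    (hf : ∀ S, Measurable (f S)) (x : ι → Space d) :
    (∫⋯∫⁻_U, (fun x => ∑ S ∈ T, f S x) ∂(fun _ => volume)) x =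
      ∑ S ∈ T, (∫⋯∫⁻_U, f S ∂(fun _ => volume)) x := by
  unfold lmarginal
  rw [lintegral_finsetSum]
  exact fun S _ => (hf S).comp measurable_updateFinset

lemma lmarginal_mul_left (U : Finset ι) {f g : (ι → Space d) → ℝ≥0∞} (hg : Measurable g)
    (x : ι → Space d) (hf : ∀ y, f (Function.updateFinset x U y) = f x) :
    (∫⋯∫⁻_U, (fun x => f x * g x) ∂(fun _ => volume)) x =
      f x * (∫⋯∫⁻_U, g ∂(fun _ => volume)) x := by
  unfold lmarginal
  refine Eq.trans (lintegral_congr fun y => ?_)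
    (lintegral_const_mul _ (hg.comp measurable_updateFinset))
  simp only [hf]

lemma lmarginal_mul_const (U : Finset ι) {f : (ι → Space d) → ℝ≥0∞} (hf : Measurable f)
    (c : ℝ≥0∞) (x : ι → Space d) :
    (∫⋯∫⁻_U, (fun x => f x * c) ∂(fun _ => volume)) x =
      (∫⋯∫⁻_U, f ∂(fun _ => volume)) x * c := by
  unfold lmarginal
  exact lintegral_mul_const _ (hf.comp measurable_updateFinset)

lemma lmarginal_forestTotal [Fintype ι] (hφ : Measurable φ) (n : ℕ) (A U : Finset ι) (hn : #A + #U = n)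
    (hAU : Disjoint A U) (x : ι → Space d) :
    (∫⋯∫⁻_U, (fun x => forestTotal (vertexWeightENN d β φ x) A U) ∂(fun _ => volume)) x =
      (#U).factorial * forestCoeff (vertexIntegral d β φ) n #A := by
  induction n generalizing A U x with
  | zero =>
    obtain rfl : A = ∅ := card_eq_zero.1 (by omega)
    obtain rfl : U = ∅ := card_eq_zero.1 (by simpa using hn)
    simp [forestTotal_empty_left, forestCoeff]
  | succ n ih =>
    obtain rfl | ⟨a, ha⟩ := A.eq_empty_or_nonempty
    · have hU : U ≠ ∅ := by rintro rfl; simp at hn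
      simp only [forestTotal_empty_left, if_neg hU, card_empty, forestCoeff, mul_zero]
      simp [lmarginal]
    have haU : a ∉ U := disjoint_left.1 hAU ha
    have hA : #A = #(A.erase a) + 1 := (card_erase_add_one ha).symm
    simp_rw [forestTotal_eq_sum_powerset _ hAU ha]
    rw [lmarginal_sum U.powerset U (fun S x => vertexWeightENN d β φ x a S *
        forestTotal (vertexWeightENN d β φ x) (A.erase a ∪ S) (U \ S)) fun S =>
      (measurable_vertexWeightENN hφ a S).mul (measurable_forestTotal hφ _ _)]
    have hterm : ∀ S ∈ U.powerset, (∫⋯∫⁻_U, (fun x : ι → Space d => vertexWeightENN d β φ x a S *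
          forestTotal (vertexWeightENN d β φ x) (A.erase a ∪ S) (U \ S)) ∂(fun _ => volume)) x =
        vertexIntegral d β φ #S * ((#U - #S).factorial *
          forestCoeff (vertexIntegral d β φ) n (#(A.erase a) + #S)) := by
      intro S hS
      rw [mem_powerset] at hS
      have hmeas : Measurable fun x : ι → Space d => vertexWeightENN d β φ x a S *
          forestTotal (vertexWeightENN d β φ x) (A.erase a ∪ S) (U \ S) :=
        (measurable_vertexWeightENN hφ a S).mul (measurable_forestTotal hφ _ _)
      have hdisj : Disjoint (A.erase a) S :=
        (hAU.mono_left (erase_subset _ _)).mono_right hS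
      have hcard : #(A.erase a ∪ S) = #(A.erase a) + #S := card_union_of_disjoint hdisj
      have hcard' : #(U \ S) = #U - #S := card_sdiff_of_subset hS
      have hle := card_le_card hS
      have hunion := lmarginal_union (fun _ : ι => (volume : Measure (Space d))) _ hmeas
        (disjoint_sdiff : Disjoint S (U \ S))
      rw [union_sdiff_of_subset hS] at hunion
      rw [hunion]
      have hinner : ∀ z : ι → Space d, (∫⋯∫⁻_U \ S, (fun x : ι → Space d =>
            vertexWeightENN d β φ x a S * forestTotal (vertexWeightENN d β φ x)
              (A.erase a ∪ S) (U \ S)) ∂(fun _ => volume)) z =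
          vertexWeightENN d β φ z a S * ((#U - #S).factorial *
            forestCoeff (vertexIntegral d β φ) n (#(A.erase a) + #S)) := by
        intro z
        have hdisj' : Disjoint (A.erase a ∪ S) (U \ S) := by
          rw [disjoint_union_left]
          exact ⟨hAU.mono (erase_subset _ _) sdiff_subset, disjoint_sdiff⟩
        rw [lmarginal_mul_left _ (measurable_forestTotal hφ _ _),
          ih (A.erase a ∪ S) (U \ S) (by omega) hdisj' z, hcard', hcard]
        intro y
        unfold vertexWeightENN
        have hz : Function.updateFinset z (U \ S) y a = z a := by
          simp [Function.updateFinset, haU]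
        rw [hz, vertexWeight_congr (y := z)]
        intro i hi
        simp [Function.updateFinset, hi]
      rw [funext hinner, lmarginal_mul_const _ (measurable_vertexWeightENN hφ a S),
        lmarginal_vertexWeightENN hφ a S fun h => haU (hS h)]
    rw [sum_congr rfl hterm, sum_powerset_apply_card (fun m => vertexIntegral d β φ m *
      ((#U - m).factorial * forestCoeff (vertexIntegral d β φ) n (#(A.erase a) + m)))]
    rw [hA, forestCoeff, tsum_eq_sum (s := range (#U + 1)), mul_sum]
    · refine sum_congr rfl fun m hm => ?_
      have hm' : m ≤ #U := by simpa [Nat.lt_succ_iff] using hm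
      rw [nsmul_eq_mul]
      have hfac : ((#U).choose m : ℝ≥0∞) * ((#U - m).factorial : ℝ≥0∞) =
          ((#U).factorial : ℝ≥0∞) * ((m.factorial : ℝ≥0∞))⁻¹ := by
        rw [← Nat.choose_mul_factorial_mul_factorial hm']
        push_cast
        have h0 : (m.factorial : ℝ≥0∞) ≠ 0 := by exact_mod_cast m.factorial_ne_zero
        calc _ = ((#U).choose m : ℝ≥0∞) * ((#U - m).factorial : ℝ≥0∞) *
              ((m.factorial : ℝ≥0∞) * ((m.factorial : ℝ≥0∞))⁻¹) := by
              rw [ENNReal.mul_inv_cancel h0 (ENNReal.natCast_ne_top _), mul_one]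
          _ = _ := by ring
      calc _ = (((#U).choose m : ℝ≥0∞) * ((#U - m).factorial : ℝ≥0∞)) *
            (vertexIntegral d β φ m *
              forestCoeff (vertexIntegral d β φ) n (#(A.erase a) + m)) := by ring
        _ = _ := by rw [hfac]; ring
    · intro m hm
      have hm' : #U < m := by simpa using hm
      rw [forestCoeff_eq_zero_of_lt _ (by omega)]
      simp

end Marginal

end RepulsiveGas

end

noncomputable section

namespace RepulsiveGas

open MeasureTheory Finset

/-! ### Trees and parent functions -/

section Trees

variable {n : ℕ} {p : Fin (n + 1) → Fin (n + 1)}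

/-- The graph in which every point is joined to its image under `p`. -/
def parentGraph (p : Fin (n + 1) → Fin (n + 1)) : SimpleGraph (Fin (n + 1)) :=
  SimpleGraph.fromRel fun i j => p i = j

lemma parentGraph_adj {i j : Fin (n + 1)} :
    (parentGraph p).Adj i j ↔ i ≠ j ∧ (p i = j ∨ p j = i) := by
  simp [parentGraph, SimpleGraph.fromRel_adj]

lemma isForest_root_iff :
    IsForest {0} {0}ᶜ p ↔ p 0 = 0 ∧ ∀ u, ∃ k, p^[k] u = 0 := by
  simp only [IsForest, mem_compl, mem_singleton, not_not, forall_eq]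
  refine and_congr_right fun h => ⟨fun H u => ?_, fun H u _ => H u⟩
  by_cases hu : u = 0
  · exact ⟨0, hu⟩
  · exact H u hu

lemma exists_depth (hp : IsForest {0} {0}ᶜ p) :
    ∃ D : Fin (n + 1) → ℕ, D 0 = 0 ∧ ∀ u ≠ 0, D u = D (p u) + 1 := by
  obtain ⟨-, h⟩ := isForest_root_iff.1 hp
  classical
  refine ⟨fun u => Nat.find (h u), by simp, fun u hu => ?_⟩
  rw [Nat.find_eq_iff]
  refine ⟨?_, fun m hm hm0 => ?_⟩
  · rw [Function.iterate_succ_apply]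
    exact Nat.find_spec (h (p u))
  · obtain _ | m := m
    · exact hu hm0
    · rw [Function.iterate_succ_apply] at hm0
      exact Nat.find_min (h (p u)) (Nat.lt_of_succ_lt_succ hm) hm0

lemma ne_parent (hp : IsForest {0} {0}ᶜ p) {u : Fin (n + 1)} (hu : u ≠ 0) : u ≠ p u := by
  obtain ⟨D, -, hD⟩ := exists_depth hp
  intro h
  have := hD u hu
  rw [← h] at this
  omega

lemma parentGraph_adj_parent (hp : IsForest {0} {0}ᶜ p) {u : Fin (n + 1)} (hu : u ≠ 0) :
    (parentGraph p).Adj u (p u) :=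
  parentGraph_adj.2 ⟨ne_parent hp hu, Or.inl rfl⟩

lemma parentGraph_connected (hp : IsForest {0} {0}ᶜ p) : (parentGraph p).Connected := by
  have key : ∀ k u, p^[k] u = 0 → (parentGraph p).Reachable u 0 := by
    intro k
    induction k with
    | zero => rintro u rfl; rfl
    | succ k ih =>
      intro u hu
      by_cases h0 : u = 0
      · rw [h0]
      · exact (parentGraph_adj_parent hp h0).reachable.trans (ih _ hu)
  rw [SimpleGraph.connected_iff_exists_forall_reachable]
  exact ⟨0, fun u => by
    obtain ⟨k, hk⟩ := (isForest_root_iff.1 hp).2 u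
    exact (key k u hk).symm⟩

lemma parentGraph_isTree (hp : IsForest {0} {0}ᶜ p) : (parentGraph p).IsTree := by
  classical
  rw [SimpleGraph.isTree_iff_connected_and_card]
  have hc := parentGraph_connected hp
  refine ⟨hc, le_antisymm ?_ hc.card_vert_le_card_edgeSet_add_one⟩
  have hsub : (parentGraph p).edgeSet ⊆
      ((({0}ᶜ : Finset (Fin (n + 1))).image fun u => s(u, p u) : Finset _) : Set _) := by
    intro e
    induction e with
    | _ i j =>
      intro he
      rw [SimpleGraph.mem_edgeSet, parentGraph_adj] at he
      have h0 := (isForest_root_iff.1 hp).1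
      simp only [coe_image, Set.mem_image, mem_coe, mem_compl, mem_singleton]
      rcases he.2 with h | h
      · refine ⟨i, ?_, by rw [h]⟩
        rintro rfl
        exact he.1 (h0.symm.trans h)
      · refine ⟨j, ?_, by rw [h, Sym2.eq_swap]⟩
        rintro rfl
        exact he.1 (h.symm.trans h0)
  have h1 : Nat.card (parentGraph p).edgeSet ≤ n := by
    calc Nat.card (parentGraph p).edgeSet
        ≤ Nat.card ((({0}ᶜ : Finset (Fin (n + 1))).image fun u => s(u, p u) : Finset _) :
            Set (Sym2 (Fin (n + 1)))) := Nat.card_mono (Finset.finite_toSet _) hsub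
      _ = #(({0}ᶜ : Finset (Fin (n + 1))).image fun u => s(u, p u)) := by
          simp
      _ ≤ #({0}ᶜ : Finset (Fin (n + 1))) := card_image_le
      _ = n := by simp [card_compl]
  simpa using h1

lemma dist_parentGraph (hp : IsForest {0} {0}ᶜ p) {D : Fin (n + 1) → ℕ} (hD0 : D 0 = 0)
    (hD : ∀ u ≠ 0, D u = D (p u) + 1) (u : Fin (n + 1)) : (parentGraph p).dist 0 u = D u := by
  have hc := parentGraph_connected hp
  apply le_antisymm
  · have key : ∀ k u, D u = k → (parentGraph p).dist 0 u ≤ k := by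
      intro k
      induction k with
      | zero =>
        intro u hu
        by_cases h0 : u = 0
        · simp [h0]
        · have := hD u h0; omega
      | succ k ih =>
        intro u hu
        have h0 : u ≠ 0 := by rintro rfl; omega
        have h1 := ih (p u) (by have := hD u h0; omega)
        have h2 := hc.dist_triangle (u := 0) (v := p u) (w := u)
        have h3 := SimpleGraph.dist_eq_one_iff_adj.2 (parentGraph_adj_parent hp h0).symm
        omega
    exact key _ u rfl
  · have key : ∀ v w (W : (parentGraph p).Walk v w), D w ≤ D v + W.length := by
      intro v w W
      induction W with
      | nil => simp
      | @cons a b c hab W ih =>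
        have : D b ≤ D a + 1 := by
          rw [parentGraph_adj] at hab
          have h0 := (isForest_root_iff.1 hp).1
          rcases hab.2 with h | h
          · by_cases ha : a = 0
            · subst ha; exact absurd (h0.symm.trans h) hab.1
            · have := hD a ha; rw [h] at this; omega
          · by_cases hb : b = 0
            · subst hb; omega
            · have := hD b hb; rw [h] at this; omega
        simp only [SimpleGraph.Walk.length_cons]
        omega
    obtain ⟨W, hW⟩ := hc.exists_walk_length_eq_dist 0 u
    have := key 0 u W
    omega

lemma children_parentGraph (hp : IsForest {0} {0}ᶜ p) (i : Fin (n + 1)) :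
    children (parentGraph p) i = {u ∈ ({0}ᶜ : Finset (Fin (n + 1))) | p u = i} := by
  obtain ⟨D, hD0, hD⟩ := exists_depth hp
  have hdist := dist_parentGraph hp hD0 hD
  ext u
  simp only [children, mem_filter, mem_univ, true_and, mem_compl, mem_singleton, hdist,
    parentGraph_adj]
  constructor
  · rintro ⟨⟨hne, h⟩, h1⟩
    have hu : u ≠ 0 := by rintro rfl; omega
    refine ⟨hu, ?_⟩
    rcases h with h | h
    · by_cases hi : i = 0
      · subst hi
        have := (isForest_root_iff.1 hp).1
        exact absurd (this.symm.trans h) hne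
      · have := hD i hi
        rw [h] at this
        omega
    · exact h
  · rintro ⟨hu, rfl⟩
    exact ⟨⟨(ne_parent hp hu).symm, Or.inr rfl⟩, hD u hu⟩

lemma exists_adj_dist_add_one {τ : SimpleGraph (Fin (n + 1))} (hτ : τ.Connected)
    {u : Fin (n + 1)} (hu : u ≠ 0) : ∃ v, τ.Adj u v ∧ τ.dist 0 u = τ.dist 0 v + 1 := by
  obtain ⟨W, hW⟩ := hτ.exists_walk_length_eq_dist u 0
  cases W with
  | nil => exact absurd rfl hu
  | @cons _ v _ h W =>
    refine ⟨v, h, ?_⟩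
    have h1 := SimpleGraph.dist_le W
    have h2 := hτ.dist_triangle (u := 0) (v := v) (w := u)
    have h3 := SimpleGraph.dist_eq_one_iff_adj.2 h.symm
    rw [SimpleGraph.Walk.length_cons, SimpleGraph.dist_comm] at hW
    rw [SimpleGraph.dist_comm] at h1
    omega

lemma exists_parentGraph_eq {τ : SimpleGraph (Fin (n + 1))} (hτ : τ.IsTree) :
    ∃ p, IsForest {0} {0}ᶜ p ∧ parentGraph p = τ := by
  classical
  have hc := hτ.connected
  choose! q hq1 hq2 using fun u (hu : u ≠ (0 : Fin (n + 1))) => exists_adj_dist_add_one hc hu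
  set p : Fin (n + 1) → Fin (n + 1) := fun u => if u = 0 then 0 else q u with hpdef
  have hp : IsForest {0} {0}ᶜ p := by
    rw [isForest_root_iff]
    refine ⟨by simp [hpdef], ?_⟩
    have key : ∀ k u, τ.dist 0 u = k → ∃ k, p^[k] u = 0 := by
      intro k
      induction k with
      | zero =>
        intro u hu
        exact ⟨0, ((hc.dist_eq_zero_iff).1 hu).symm⟩
      | succ k ih =>
        intro u hu
        have h0 : u ≠ 0 := by rintro rfl; simp at hu
        have h1 := hq2 u h0
        obtain ⟨k', hk'⟩ := ih (q u) (by omega)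
        exact ⟨k' + 1, by rw [Function.iterate_succ_apply]; simpa [hpdef, h0] using hk'⟩
    exact fun u => key _ u rfl
  refine ⟨p, hp, ?_⟩
  have hle : parentGraph p ≤ τ := by
    intro i j hij
    rw [parentGraph_adj] at hij
    have aux : ∀ i j, i ≠ j → p i = j → τ.Adj i j := by
      intro i j hne h
      by_cases hi : i = 0
      · subst hi
        simp [hpdef] at h
        exact absurd h hne
      · simp only [hpdef, if_neg hi] at h
        exact h ▸ hq1 i hi
    rcases hij.2 with h | h
    · exact aux i j hij.1 h
    · exact (aux j i hij.1.symm h).symm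
  exact le_antisymm hle ((SimpleGraph.isTree_iff_minimal_connected.1 hτ).2
    (parentGraph_connected hp) hle)

lemma parentGraph_injOn {p q : Fin (n + 1) → Fin (n + 1)} (hp : IsForest {0} {0}ᶜ p)
    (hq : IsForest {0} {0}ᶜ q) (h : parentGraph p = parentGraph q) : p = q := by
  funext u
  by_cases hu : u = 0
  · rw [hu, (isForest_root_iff.1 hp).1, (isForest_root_iff.1 hq).1]
  · have h1 : u ∈ children (parentGraph p) (p u) := by
      rw [children_parentGraph hp]; simp [hu]
    rw [h, children_parentGraph hq] at h1
    exact (mem_filter.1 h1).2.symm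

open Classical in
/-- A sum over trees is a sum over parent functions. -/
lemma sum_isTree {R : Type*} [CommSemiring R] (G : Fin (n + 1) → Finset (Fin (n + 1)) → R) :
    ∑ τ : SimpleGraph (Fin (n + 1)) with τ.IsTree, ∏ i, G i (children τ i) =
      forestTotal G {0} {0}ᶜ := by
  unfold forestTotal
  symm
  refine sum_bij (fun p _ => parentGraph p) ?_ ?_ ?_ ?_
  · intro p hp
    simpa using parentGraph_isTree (mem_filter.1 hp).2
  · intro p hp q hq h
    exact parentGraph_injOn (mem_filter.1 hp).2 (mem_filter.1 hq).2 h
  · intro τ hτ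
    obtain ⟨p, hp, h⟩ := exists_parentGraph_eq (mem_filter.1 hτ).2
    exact ⟨p, by simpa using hp, h⟩
  · intro p hp
    rw [union_compl]
    exact prod_congr rfl fun i _ => by rw [children_parentGraph (mem_filter.1 hp).2]

end Trees

variable {d : ℕ} {β : ℝ} {φ : ℝ≥0 → ℝ≥0∞}

lemma ofReal_treeWeight (hβ : 0 < β) {n : ℕ} (x : Fin (n + 1) → Space d) :
    ENNReal.ofReal (treeWeight d β φ x) = forestTotal (vertexWeightENN d β φ x) {0} {0}ᶜ := by
  rw [← sum_isTree, treeWeight, ENNReal.ofReal_sum_of_nonneg]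
  · refine sum_congr rfl fun τ _ => ?_
    rw [ENNReal.ofReal_prod_of_nonneg fun i _ => vertexWeight_nonneg hβ _ _ _]
    rfl
  · exact fun τ _ => prod_nonneg fun i _ => vertexWeight_nonneg hβ _ _ _

/-- The integral of the sum over all trees. -/
lemma treeIntegral_eq (hβ : 0 < β) (hφ : Measurable φ) (n : ℕ) :
    treeIntegral d β φ n =
      n.factorial * forestCoeff (vertexIntegral d β φ) (n + 1) 1 := by
  set F : (Fin n → Space d) → ℝ≥0∞ := fun y =>
    forestTotal (vertexWeightENN d β φ (Fin.cons (0 : Space d) y : Fin (n + 1) → Space d))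
      {0} {0}ᶜ with hFdef
  have hcons : Measurable fun y : Fin n → Space d =>
      (Fin.cons (0 : Space d) y : Fin (n + 1) → Space d) := by
    refine measurable_pi_lambda _ fun i => ?_
    refine Fin.cases ?_ (fun i => ?_) i
    · simp
    · simpa using measurable_pi_apply i
  have hF : Measurable F := (measurable_forestTotal hφ _ _).comp hcons
  have h1 := lmarginal_image (μ := fun _ : Fin (n + 1) => (volume : Measure (Space d)))
    (e := Fin.succ) (Fin.succ_injective n) univ hF 0
  rw [lmarginal_univ] at h1
  have himg : univ.image Fin.succ = ({0}ᶜ : Finset (Fin (n + 1))) := by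
    ext i
    simp
  have h2 := lmarginal_forestTotal (d := d) (β := β) hφ (n + 1) ({0} : Finset (Fin (n + 1)))
    {0}ᶜ (by simp [card_compl, add_comm]) disjoint_compl_right 0
  simp only [card_compl, Fintype.card_fin, card_singleton, Nat.add_sub_cancel] at h2
  rw [← h2, treeIntegral]
  simp_rw [ofReal_treeWeight hβ]
  refine Eq.trans h1.symm ?_
  rw [himg]
  unfold lmarginal
  refine lintegral_congr fun y => ?_
  simp only [Function.comp_def, hFdef]
  congr 2
  funext i
  refine Fin.cases ?_ (fun i => ?_) i
  · simp [Function.updateFinset]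
  · simp

lemma vertexIntegral_zero : vertexIntegral d β φ 0 = 1 := by
  rw [vertexIntegral, volume_pi, Measure.pi_of_empty _ default, lintegral_dirac]
  simp [vertexWeight]

lemma treeIntegral_zero (hβ : 0 < β) (hφ : Measurable φ) : treeIntegral d β φ 0 = 1 := by
  rw [treeIntegral_eq hβ hφ, forestCoeff, tsum_eq_single 0]
  · simp [forestCoeff, vertexIntegral_zero]
  · intro m hm
    simp [forestCoeff, hm]

/-- The tree sum is the generating function of the trees. -/
lemma treeSum_eq (hβ : 0 < β) (hφ : Measurable φ) (r : ℝ≥0) :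
    treeSum d β φ r = ∑' n, forestCoeff (vertexIntegral d β φ) (n + 1) 1 * (r : ℝ≥0∞) ^ n := by
  have hterm : ∀ n : ℕ, (r : ℝ≥0∞) ^ n / (n.factorial : ℝ≥0∞) * treeIntegral d β φ n =
      forestCoeff (vertexIntegral d β φ) (n + 1) 1 * (r : ℝ≥0∞) ^ n := by
    intro n
    have h0 : (n.factorial : ℝ≥0∞) ≠ 0 := by exact_mod_cast n.factorial_ne_zero
    rw [treeIntegral_eq hβ hφ, ← mul_assoc,
      ENNReal.div_mul_cancel h0 (ENNReal.natCast_ne_top _), mul_comm]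
  unfold treeSum
  simp_rw [hterm]
  rw [tsum_eq_zero_add' (f := fun n => forestCoeff (vertexIntegral d β φ) (n + 1) 1 *
    (r : ℝ≥0∞) ^ n) ENNReal.summable, ← hterm 0, treeIntegral_zero hβ hφ]
  simp

end RepulsiveGas

end

noncomputable section

namespace RepulsiveGas

open MeasureTheory Finset

variable {d : ℕ} {β : ℝ} {φ : ℝ≥0 → ℝ≥0∞}

/-! ### The vertex integrals -/

lemma lintegral_prod_fin (f : Space d → ℝ≥0∞) (hf : Measurable f) (n : ℕ) :
    ∫⁻ y : Fin n → Space d, ∏ i, f (y i) = (∫⁻ x, f x) ^ n := by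
  induction n with
  | zero =>
    rw [volume_pi, Measure.pi_of_empty _ default, lintegral_dirac]
    simp
  | succ n ih =>
    have hmp := volume_preserving_piFinSuccAbove (fun _ : Fin (n + 1) => Space d) 0
    rw [← hmp.symm.lintegral_comp_emb (MeasurableEquiv.measurableEmbedding _), pow_succ', ← ih,
      Measure.volume_eq_prod, ← lintegral_prod_mul hf.aemeasurable]
    · refine lintegral_congr fun z => ?_
      rw [Fin.prod_univ_succ]
      rfl
    · exact (Finset.measurable_prod _ fun i _ => hf.comp (measurable_pi_apply i)).aemeasurable

lemma tempered_eq (hβ : 0 < β) :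
    tempered d β φ = ∫⁻ x : Space d, ENNReal.ofReal (1 - pairWeight d β φ 0 x) := by
  unfold tempered
  refine lintegral_congr fun x => ?_
  rw [abs_sub_comm, abs_of_nonneg (sub_nonneg.2 (pairWeight_le_one hβ _ _)), pairWeight_comm]

lemma vertexIntegral_le (hβ : 0 < β) (hφ : Measurable φ) (n : ℕ) :
    vertexIntegral d β φ n ≤ tempered d β φ ^ n := by
  have hm : Measurable fun x : Space d => ENNReal.ofReal (1 - pairWeight d β φ 0 x) :=
    (measurable_const.sub (measurable_pairWeight hφ measurable_const measurable_id)).ennreal_ofReal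
  rw [tempered_eq hβ, ← lintegral_prod_fin _ hm]
  refine lintegral_mono fun y => ?_
  rw [← ENNReal.ofReal_prod_of_nonneg fun i _ => sub_nonneg.2 (pairWeight_le_one hβ _ _)]
  exact ENNReal.ofReal_le_ofReal (vertexWeight_le_prod hβ _ _ _)

/-- A set of positive finite volume is not invariant under a translation. -/
lemma volume_eq_zero_of_invariant {S : Set (Space d)} (hS : MeasurableSet S)
    (hfin : volume S ≠ ⊤) {x : Space d} (hx : x ≠ 0)
    (h : ∀ᵐ y : Space d, y ∈ S → y - x ∈ S) : volume S = 0 := by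
  by_contra hpos
  have htrans : ∀ (v : Space d) {p : Space d → Prop}, (∀ᵐ y, p y) → ∀ᵐ y, p (y + v) :=
    fun v p hp => (measurePreserving_add_right volume v).quasiMeasurePreserving.ae hp
  have hk : ∀ k : ℕ, ∀ᵐ y : Space d, y + (k : ℝ) • x ∈ S → y ∈ S := by
    intro k
    induction k with
    | zero => simp
    | succ k ih =>
      have h' := htrans (((k + 1 : ℕ) : ℝ) • x) h
      filter_upwards [ih, h'] with y h1 h2 h3
      refine h1 ?_
      have := h2 h3
      rwa [Nat.cast_succ, add_smul, one_smul, ← add_assoc, add_sub_cancel_right] at this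
  obtain ⟨R, hR⟩ : ∃ R : ℕ, volume (S ∩ Metric.closedBall 0 R) ≠ 0 := by
    by_contra! hR
    refine hpos ?_
    rw [← Set.inter_univ S, ← Metric.iUnion_closedBall_nat 0, Set.inter_iUnion]
    exact measure_iUnion_null hR
  obtain ⟨m, hm⟩ := exists_nat_gt (2 * R / ‖x‖)
  have hx' : 0 < ‖x‖ := norm_pos_iff.2 hx
  have hm' : 2 * R < m * ‖x‖ := by rwa [div_lt_iff₀ hx'] at hm
  set A : ℕ → Set (Space d) := fun k =>
    (· + ((k * m : ℕ) : ℝ) • x) ⁻¹' (S ∩ Metric.closedBall 0 R) with hA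
  have hAmeas : ∀ k, MeasurableSet (A k) := fun k =>
    (measurable_add_const _) (hS.inter measurableSet_closedBall)
  have hAvol : ∀ k, volume (A k) = volume (S ∩ Metric.closedBall 0 R) := fun k =>
    (measurePreserving_add_right volume _).measure_preimage
      (hS.inter measurableSet_closedBall).nullMeasurableSet
  have hdisj : Pairwise (Function.onFun Disjoint A) := by
    intro k l hkl
    rw [Function.onFun, Set.disjoint_left]
    intro y hy1 hy2
    simp only [hA, Set.mem_preimage, Set.mem_inter_iff, mem_closedBall_zero_iff] at hy1 hy2
    have h1 : ‖(((k * m : ℕ) : ℝ) - ((l * m : ℕ) : ℝ)) • x‖ ≤ 2 * R := by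
      calc _ = ‖(y + ((k * m : ℕ) : ℝ) • x) - (y + ((l * m : ℕ) : ℝ) • x)‖ := by
            rw [sub_smul]; congr 1; abel
        _ ≤ R + R := (norm_sub_le _ _).trans (add_le_add hy1.2 hy2.2)
        _ = 2 * R := by ring
    rw [norm_smul, Real.norm_eq_abs] at h1
    have h2 : (m : ℝ) ≤ |((k * m : ℕ) : ℝ) - ((l * m : ℕ) : ℝ)| := by
      push_cast
      rw [← sub_mul, abs_mul, Nat.abs_cast]
      have h3 : (1 : ℝ) ≤ |(k : ℝ) - l| := by
        have : (1 : ℤ) ≤ |(k : ℤ) - l| := Int.one_le_abs (sub_ne_zero.2 (by exact_mod_cast hkl))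
        exact_mod_cast this
      exact le_mul_of_one_le_left (Nat.cast_nonneg _) h3
    have h4 := mul_le_mul_of_nonneg_right h2 hx'.le
    linarith
  have hle : volume (⋃ k, A k) ≤ volume S := by
    refine measure_mono_ae ?_
    have := ae_all_iff.2 hk
    filter_upwards [this] with y hy hyA
    obtain ⟨k, hk⟩ := Set.mem_iUnion.1 hyA
    exact hy (k * m) hk.1
  rw [measure_iUnion hdisj hAmeas] at hle
  simp_rw [hAvol] at hle
  rw [ENNReal.tsum_const_eq_top_of_ne_zero hR] at hle
  exact hfin (top_le_iff.1 hle)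

lemma vertexIntegral_two_ne_zero (hd : 1 ≤ d) (hβ : 0 < β) (hφ : Measurable φ)
    (hC : tempered d β φ ≠ ⊤) (hC0 : tempered d β φ ≠ 0) : vertexIntegral d β φ 2 ≠ 0 := by
  intro h0
  have : Nonempty (Fin d) := ⟨⟨0, hd⟩⟩
  set w : Space d → ℝ := fun x => pairWeight d β φ 0 x with hw
  have hwm : Measurable w := measurable_pairWeight hφ measurable_const measurable_id
  have hw1 : ∀ x, w x ≤ 1 := fun x => pairWeight_le_one hβ _ _
  have hw0 : ∀ x, 0 ≤ w x := fun x => pairWeight_nonneg _ _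
  set S : Set (Space d) := {x | w x ≠ 1} with hS
  set S₀ : Set (Space d) := {x | w x = 0} with hS₀
  have hSm : MeasurableSet S := (hwm (measurableSet_singleton 1)).compl
  have hS0m : MeasurableSet S₀ := hwm (measurableSet_singleton 0)
  have hsub : S₀ ⊆ S := fun x hx => by
    have hx' : w x = 0 := hx
    simp [hS, hx']
  have hum : Measurable fun x : Space d => ENNReal.ofReal (1 - w x) :=
    (measurable_const.sub hwm).ennreal_ofReal
  rw [tempered_eq hβ] at hC hC0
  have hS0fin : volume S₀ ≠ ⊤ := by
    refine ne_top_of_le_ne_top hC ?_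
    rw [← lintegral_indicator_one hS0m]
    refine lintegral_mono fun x => ?_
    by_cases hx : x ∈ S₀
    · have hx' : w x = 0 := hx
      change _ ≤ ENNReal.ofReal (1 - w x)
      simp [hx, hx']
    · simp [hx]
  have hSpos : volume S ≠ 0 := by
    intro hv
    refine hC0 ?_
    rw [lintegral_eq_zero_iff hum]
    filter_upwards [measure_eq_zero_iff_ae_notMem.1 hv] with x hx
    have : w x = 1 := by simpa [hS] using hx
    simp [this]
  have hae : ∀ᵐ x : Space d, ∀ᵐ y : Space d, x ∈ S → y ∈ S → y - x ∈ S₀ := by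
    have hmeas : Measurable fun z : Fin 2 → Space d =>
        ENNReal.ofReal (vertexWeight d β φ 0 univ z) :=
      (measurable_vertexWeight hφ univ measurable_const measurable_id).ennreal_ofReal
    have h1 := (lintegral_eq_zero_iff hmeas).1 h0
    have h2 := (volume_preserving_finTwoArrow (Space d)).symm.quasiMeasurePreserving.ae h1
    rw [Measure.volume_eq_prod] at h2
    have h3 := Measure.ae_ae_of_ae_prod h2
    filter_upwards [h3] with x hx
    filter_upwards [hx] with y hy hxS hyS
    have hv : vertexWeight d β φ 0 univ (![x, y] : Fin 2 → Space d) = 0 :=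
      le_antisymm (ENNReal.ofReal_eq_zero.1 hy) (vertexWeight_nonneg hβ _ _ _)
    have hpp : pairProd d β φ (![x, y] : Fin 2 → Space d) = pairWeight d β φ x y := by
      unfold pairProd
      have e0 : ({j | (0 : Fin 2) < j} : Finset (Fin 2)) = {1} := by decide
      have e1 : ({j | (1 : Fin 2) < j} : Finset (Fin 2)) = ∅ := by decide
      rw [Fin.prod_univ_two, e0, e1]
      simp
    rw [vertexWeight_univ, hpp, Fin.prod_univ_two] at hv
    have hx1 : 1 - w x ≠ 0 := sub_ne_zero.2 (Ne.symm hxS)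
    have hy1 : 1 - w y ≠ 0 := sub_ne_zero.2 (Ne.symm hyS)
    have hxy : pairWeight d β φ x y = 0 := by
      rcases mul_eq_zero.1 hv with h | h
      · rcases mul_eq_zero.1 h with h | h
        · exact absurd h hx1
        · exact absurd h hy1
      · exact h
    change w (y - x) = 0
    rw [← hxy, hw]
    have := pairWeight_add_right (β := β) (φ := φ) 0 (y - x) x
    simpa using this.symm
  have hne : ∀ᵐ x : Space d, x ≠ 0 := by
    rw [ae_iff]; simp
  obtain ⟨x, hx, hx0, hxS⟩ : ∃ x : Space d, (∀ᵐ y : Space d, x ∈ S → y ∈ S → y - x ∈ S₀) ∧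
      x ≠ 0 ∧ x ∈ S := by
    by_contra! hcon
    refine hSpos (measure_eq_zero_iff_ae_notMem.2 ?_)
    filter_upwards [hae, hne] with x h1 h2
    exact hcon x h1 h2
  have hSfin : volume S ≠ ⊤ := by
    refine ne_top_of_le_ne_top hS0fin ?_
    rw [← (measurePreserving_add_right volume (-x)).measure_preimage hS0m.nullMeasurableSet]
    refine measure_mono_ae ?_
    filter_upwards [hx] with y hy hyS
    have := hy hxS hyS
    rwa [sub_eq_add_neg] at this
  refine hSpos (volume_eq_zero_of_invariant hSm hSfin hx0 ?_)
  filter_upwards [hx] with y hy hyS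
  exact hsub (hy hxS hyS)

end RepulsiveGas

end

noncomputable section

namespace RepulsiveGas

open MeasureTheory Finset

/-! ### Strict convexity of `Ψ(t) / t` -/

section Convex

variable {a : ℕ → ℝ}

lemma convexOn_tsum_pow (ha : ∀ n, 0 ≤ a n) (hs : ∀ t : ℝ, Summable fun n => a n * t ^ n) :
    ConvexOn ℝ (Set.Ioi 0) fun t : ℝ => ∑' n, a n * t ^ n := by
  refine ⟨convex_Ioi 0, fun x hx y hy b c hb hc hbc => ?_⟩
  simp only [smul_eq_mul]
  rw [← tsum_mul_left, ← tsum_mul_left, ← ((hs x).mul_left b).tsum_add ((hs y).mul_left c)]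
  refine (hs _).tsum_le_tsum (fun n => ?_) (((hs x).mul_left b).add ((hs y).mul_left c))
  have h := (convexOn_pow (𝕜 := ℝ) n).2 (Set.mem_Ici.2 (le_of_lt hx)) (Set.mem_Ici.2 (le_of_lt hy))
    hb hc hbc
  simp only [smul_eq_mul] at h
  calc a n * (b * x + c * y) ^ n ≤ a n * (b * x ^ n + c * y ^ n) :=
        mul_le_mul_of_nonneg_left h (ha n)
    _ = _ := by ring

lemma strictConvexOn_inv_add_tsum (ha : ∀ n, 0 ≤ a n)
    (hs : ∀ t : ℝ, Summable fun n => a n * t ^ n) :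
    StrictConvexOn ℝ (Set.Ioi 0) fun t : ℝ => t⁻¹ + ∑' n, a n * t ^ n := by
  have h1 : StrictConvexOn ℝ (Set.Ioi 0) fun t : ℝ => t⁻¹ := by
    simpa using strictConvexOn_zpow (m := -1) (by norm_num) (by norm_num)
  exact h1.add_convexOn (convexOn_tsum_pow ha hs)

lemma exists_isMinOn_inv_add_tsum (ha : ∀ n, 0 ≤ a n)
    (hs : ∀ t : ℝ, Summable fun n => a n * t ^ n) (h1 : 0 < a 1) :
    ∃ m : ℝ, 0 < m ∧ IsMinOn (fun t : ℝ => t⁻¹ + ∑' n, a n * t ^ n) (Set.Ioi 0) m := by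
  set k : ℝ → ℝ := fun t => t⁻¹ + ∑' n, a n * t ^ n with hk
  have hcont : ContinuousOn k (Set.Ioi 0) :=
    (strictConvexOn_inv_add_tsum ha hs).convexOn.continuousOn isOpen_Ioi
  have hnn : ∀ t : ℝ, 0 ≤ t → 0 ≤ ∑' n, a n * t ^ n := fun t ht =>
    tsum_nonneg fun n => mul_nonneg (ha n) (pow_nonneg ht n)
  have hlow1 : ∀ t : ℝ, 0 < t → t⁻¹ ≤ k t := fun t ht => le_add_of_nonneg_right (hnn t ht.le)
  have hlow2 : ∀ t : ℝ, 0 < t → a 1 * t ≤ k t := by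
    intro t ht
    have := (hs t).le_tsum 1 fun n _ => mul_nonneg (ha n) (pow_nonneg ht.le n)
    rw [pow_one] at this
    have h2 : 0 < t⁻¹ := inv_pos.2 ht
    simp only [hk]
    linarith
  have hK : 1 ≤ k 1 := by simpa using hlow1 1 one_pos
  set l : ℝ := (k 1)⁻¹ with hl
  set u : ℝ := max 1 (k 1 / a 1) with hu
  have hl0 : 0 < l := inv_pos.2 (by linarith)
  have hl1 : l ≤ 1 := inv_le_one_of_one_le₀ hK
  have hu1 : 1 ≤ u := le_max_left _ _
  obtain ⟨m, hm, hmin⟩ := isCompact_Icc.exists_isMinOn (⟨1, hl1, hu1⟩ : (Set.Icc l u).Nonempty)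
    (hcont.mono fun t ht => lt_of_lt_of_le hl0 ht.1)
  have hm1 : k m ≤ k 1 := hmin ⟨hl1, hu1⟩
  refine ⟨m, lt_of_lt_of_le hl0 hm.1, fun t ht => ?_⟩
  rw [Set.mem_Ioi] at ht
  change k m ≤ k t
  by_cases htl : t < l
  · refine hm1.trans (le_trans ?_ (hlow1 t ht))
    rw [hl] at htl
    exact (le_inv_comm₀ (by linarith) ht).2 htl.le
  by_cases htu : u < t
  · refine hm1.trans (le_trans ?_ (hlow2 t ht))
    have : k 1 / a 1 ≤ t := (le_max_right _ _).trans htu.le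
    rwa [div_le_iff₀ h1, mul_comm] at this
  · exact hmin ⟨not_lt.1 htl, not_lt.1 htu⟩

end Convex

variable {d : ℕ} {β : ℝ} {φ : ℝ≥0 → ℝ≥0∞}

/-! ### The maximizer of `μ / Ψ(μ)` -/

lemma vertexSum_eq (μ : ℝ≥0) :
    vertexSum d β φ μ =
      ∑' m : ℕ, ((m.factorial : ℝ≥0∞))⁻¹ * (vertexIntegral d β φ m * (μ : ℝ≥0∞) ^ m) := by
  rw [tsum_eq_zero_add' ENNReal.summable, vertexIntegral_zero, vertexSum]
  simp only [Nat.factorial_zero, Nat.cast_one, inv_one, pow_zero, one_mul]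
  congr 1
  exact tsum_congr fun m => by rw [div_eq_mul_inv]; ring

variable (d β φ) in
/-- The coefficients of `(Ψ(t) - 1) / t`. -/
def vertexCoeff (n : ℕ) : ℝ := (vertexIntegral d β φ (n + 1)).toReal / ((n + 1).factorial : ℝ)

lemma vertexCoeff_nonneg (n : ℕ) : 0 ≤ vertexCoeff d β φ n := by
  unfold vertexCoeff; positivity

lemma vertexIntegral_ne_top (hβ : 0 < β) (hφ : Measurable φ) (hC : tempered d β φ ≠ ⊤) (n : ℕ) :
    vertexIntegral d β φ n ≠ ⊤ :=
  ne_top_of_le_ne_top (ENNReal.pow_ne_top hC) (vertexIntegral_le hβ hφ n)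

lemma summable_vertexCoeff (hβ : 0 < β) (hφ : Measurable φ) (hC : tempered d β φ ≠ ⊤) (t : ℝ) :
    Summable fun n => vertexCoeff d β φ n * t ^ n := by
  set C := (tempered d β φ).toReal with hCdef
  refine Summable.of_norm_bounded
    ((Real.summable_pow_div_factorial (C * |t|)).mul_left C) fun n => ?_
  have hle : (vertexIntegral d β φ (n + 1)).toReal ≤ C ^ (n + 1) := by
    rw [hCdef, ← ENNReal.toReal_pow]
    exact ENNReal.toReal_mono (ENNReal.pow_ne_top hC) (vertexIntegral_le hβ hφ _)
  have hfac : (n.factorial : ℝ) ≤ ((n + 1).factorial : ℝ) := by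
    exact_mod_cast Nat.factorial_le (Nat.le_succ n)
  have hC0 : 0 ≤ C := ENNReal.toReal_nonneg
  rw [norm_mul, norm_pow, Real.norm_eq_abs, Real.norm_eq_abs, abs_of_nonneg (vertexCoeff_nonneg n),
    vertexCoeff]
  calc (vertexIntegral d β φ (n + 1)).toReal / ((n + 1).factorial : ℝ) * |t| ^ n
      ≤ C ^ (n + 1) / (n.factorial : ℝ) * |t| ^ n := by gcongr
    _ = _ := by rw [mul_pow]; ring

variable (d β φ) in
/-- `Ψ(t) / t`. -/
def vertexRatio (t : ℝ) : ℝ := t⁻¹ + ∑' n, vertexCoeff d β φ n * t ^ n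

lemma vertexRatio_pos {t : ℝ} (ht : 0 < t) : 0 < vertexRatio d β φ t :=
  add_pos_of_pos_of_nonneg (inv_pos.2 ht)
    (tsum_nonneg fun n => mul_nonneg (vertexCoeff_nonneg n) (pow_nonneg ht.le n))

lemma vertexSum_eq_mul (hβ : 0 < β) (hφ : Measurable φ) (hC : tempered d β φ ≠ ⊤) {μ : ℝ≥0}
    (hμ : μ ≠ 0) : vertexSum d β φ μ = μ * ENNReal.ofReal (vertexRatio d β φ μ) := by
  have hμ' : (0 : ℝ) < μ := by exact_mod_cast pos_iff_ne_zero.2 hμ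
  have hsum := summable_vertexCoeff hβ hφ hC (μ : ℝ)
  rw [vertexRatio, ENNReal.ofReal_add (inv_pos.2 hμ').le (tsum_nonneg fun n =>
      mul_nonneg (vertexCoeff_nonneg n) (pow_nonneg hμ'.le n)),
    ENNReal.ofReal_tsum_of_nonneg (fun n => mul_nonneg (vertexCoeff_nonneg n)
      (pow_nonneg hμ'.le n)) hsum, mul_add, ENNReal.ofReal_inv_of_pos hμ',
    ENNReal.ofReal_coe_nnreal, ENNReal.mul_inv_cancel (by simpa using hμ) ENNReal.coe_ne_top,
    vertexSum, ← ENNReal.tsum_mul_left]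
  congr 1
  refine tsum_congr fun n => ?_
  rw [vertexCoeff, ENNReal.ofReal_mul (by positivity), ENNReal.ofReal_pow hμ'.le,
    ENNReal.ofReal_coe_nnreal, ENNReal.ofReal_div_of_pos (by positivity), ENNReal.ofReal_toReal
    (vertexIntegral_ne_top hβ hφ hC _), ENNReal.ofReal_natCast, div_eq_mul_inv, div_eq_mul_inv]
  ring

lemma vertexSum_ne_top (hβ : 0 < β) (hφ : Measurable φ) (hC : tempered d β φ ≠ ⊤) (μ : ℝ≥0) :
    vertexSum d β φ μ ≠ ⊤ := by
  by_cases hμ : μ = 0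
  · subst hμ; simp [vertexSum]
  · rw [vertexSum_eq_mul hβ hφ hC hμ]
    exact ENNReal.mul_ne_top ENNReal.coe_ne_top ENNReal.ofReal_ne_top

lemma one_le_vertexSum (μ : ℝ≥0) : 1 ≤ vertexSum d β φ μ := le_self_add

lemma div_vertexSum (hβ : 0 < β) (hφ : Measurable φ) (hC : tempered d β φ ≠ ⊤) {μ : ℝ≥0}
    (hμ : μ ≠ 0) :
    (μ : ℝ≥0∞) / vertexSum d β φ μ = (ENNReal.ofReal (vertexRatio d β φ μ))⁻¹ := by
  have h0 : (μ : ℝ≥0∞) ≠ 0 := by simpa using hμ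
  rw [vertexSum_eq_mul hβ hφ hC hμ, div_eq_mul_inv,
    ENNReal.mul_inv (Or.inl h0) (Or.inl ENNReal.coe_ne_top), ← mul_assoc,
    ENNReal.mul_inv_cancel h0 ENNReal.coe_ne_top, one_mul]

lemma isMaximizer_iff (hβ : 0 < β) (hφ : Measurable φ) (hC : tempered d β φ ≠ ⊤) {m : ℝ≥0} :
    IsMaximizer d β φ m ↔ m ≠ 0 ∧ IsMinOn (vertexRatio d β φ) (Set.Ioi 0) m := by
  have hle : ∀ {μ ν : ℝ≥0}, μ ≠ 0 → ν ≠ 0 → ((μ : ℝ≥0∞) / vertexSum d β φ μ ≤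
      (ν : ℝ≥0∞) / vertexSum d β φ ν ↔ vertexRatio d β φ ν ≤ vertexRatio d β φ μ) := by
    intro μ ν hμ hν
    have hμ' : (0 : ℝ) < μ := by exact_mod_cast pos_iff_ne_zero.2 hμ
    rw [div_vertexSum hβ hφ hC hμ, div_vertexSum hβ hφ hC hν, ENNReal.inv_le_inv,
      ENNReal.ofReal_le_ofReal_iff (vertexRatio_pos hμ').le]
  constructor
  · intro h
    have hm : m ≠ 0 := by
      rintro rfl
      have := h 1
      simp only [ENNReal.coe_zero, ENNReal.zero_div, nonpos_iff_eq_zero, ENNReal.div_eq_zero_iff,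
        ENNReal.coe_eq_zero, one_ne_zero, false_or] at this
      exact vertexSum_ne_top hβ hφ hC 1 this
    refine ⟨hm, fun t ht => ?_⟩
    rw [Set.mem_Ioi] at ht
    have h0 : (⟨t, ht.le⟩ : ℝ≥0) ≠ 0 := fun h => ht.ne' (congrArg NNReal.toReal h)
    exact (hle h0 hm).1 (h ⟨t, ht.le⟩)
  · rintro ⟨hm, h⟩ μ
    by_cases hμ : μ = 0
    · subst hμ; simp
    · exact (hle hμ hm).2 (h (by simpa using pos_iff_ne_zero.2 hμ))

lemma strictConvexOn_vertexRatio (hβ : 0 < β) (hφ : Measurable φ) (hC : tempered d β φ ≠ ⊤) :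
    StrictConvexOn ℝ (Set.Ioi 0) (vertexRatio d β φ) :=
  strictConvexOn_inv_add_tsum vertexCoeff_nonneg (summable_vertexCoeff hβ hφ hC)

theorem existsUnique_isMaximizer (hd : 1 ≤ d) (hβ : 0 < β) (hφ : Measurable φ)
    (hC : tempered d β φ ≠ ⊤) (hC0 : tempered d β φ ≠ 0) :
    ∃! m : ℝ≥0, IsMaximizer d β φ m := by
  have h1 : 0 < vertexCoeff d β φ 1 := by
    have := ENNReal.toReal_pos (vertexIntegral_two_ne_zero hd hβ hφ hC hC0)
      (vertexIntegral_ne_top hβ hφ hC 2)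
    unfold vertexCoeff
    positivity
  obtain ⟨m, hm, hmin⟩ := exists_isMinOn_inv_add_tsum vertexCoeff_nonneg
    (summable_vertexCoeff hβ hφ hC) h1
  refine ⟨⟨m, hm.le⟩, ?_, ?_⟩
  · exact (isMaximizer_iff hβ hφ hC).2 ⟨fun h => hm.ne' (congrArg NNReal.toReal h), hmin⟩
  · intro m' hm'
    obtain ⟨h0, hmin'⟩ := (isMaximizer_iff hβ hφ hC).1 hm'
    refine NNReal.eq ?_
    exact (strictConvexOn_vertexRatio hβ hφ hC).eq_of_isMinOn hmin' hmin
      (by simpa using pos_iff_ne_zero.2 h0) hm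

/-! ### Comparison of the two lower bounds -/

lemma le_treeRadius (hβ : 0 < β) (hφ : Measurable φ) {r : ℝ≥0} (hr : treeSum d β φ r ≠ ⊤) :
    (r : ℝ≥0∞) ≤ treeRadius d β φ := by
  unfold treeRadius convergenceRadius
  refine FormalMultilinearSeries.le_radius_of_bound _ (treeSum d β φ r).toReal fun n => ?_
  rw [FormalMultilinearSeries.ofScalars_norm, Real.norm_of_nonneg (by positivity)]
  have hterm : (r : ℝ≥0∞) ^ n / (n.factorial : ℝ≥0∞) * treeIntegral d β φ n ≤
      treeSum d β φ r := by
    obtain _ | n := n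
    · simp [treeIntegral_zero hβ hφ, treeSum]
    · exact (ENNReal.le_tsum n).trans le_add_self
  have := ENNReal.toReal_mono hr hterm
  rw [ENNReal.toReal_mul, ENNReal.toReal_div, ENNReal.toReal_pow, ENNReal.toReal_natCast,
    ENNReal.coe_toReal] at this
  calc _ = (r : ℝ) ^ n / (n.factorial : ℝ) * (treeIntegral d β φ n).toReal := by ring
    _ ≤ _ := this

lemma one_le_treeSum (r : ℝ≥0) : 1 ≤ treeSum d β φ r := le_self_add

lemma vertexRatio_injective_below (hd : 1 ≤ d) (hβ : 0 < β) (hφ : Measurable φ)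
    (hC : tempered d β φ ≠ ⊤) {t μ : ℝ≥0} (ht : t ≠ 0) (htμ : t ≤ μ)
    (hμ : (μ : ℝ≥0∞) ≤ muStar d β φ) (h : vertexRatio d β φ t = vertexRatio d β φ μ) :
    t = μ := by
  by_contra hne
  have htμ' : (t : ℝ) < μ := by exact_mod_cast lt_of_le_of_ne htμ hne
  have ht0 : (0 : ℝ) < t := by exact_mod_cast pos_iff_ne_zero.2 ht
  by_cases hC0 : tempered d β φ = 0
  · have hz : ∀ n, vertexCoeff d β φ n = 0 := by
      intro n
      have := vertexIntegral_le (d := d) hβ hφ (n + 1)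
      rw [hC0, zero_pow n.succ_ne_zero, nonpos_iff_eq_zero] at this
      simp [vertexCoeff, this]
    simp only [vertexRatio, hz, zero_mul, tsum_zero, add_zero, inv_inj] at h
    exact htμ'.ne h
  · obtain ⟨m, hm, -⟩ := existsUnique_isMaximizer hd hβ hφ hC hC0
    have hμm : μ ≤ m := by
      have : muStar d β φ ≤ m := sInf_le ⟨m, hm, rfl⟩
      exact_mod_cast hμ.trans this
    obtain ⟨hm0, hmin⟩ := (isMaximizer_iff hβ hφ hC).1 hm
    have hm0' : (0 : ℝ) < m := by exact_mod_cast pos_iff_ne_zero.2 hm0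
    have hconv := strictConvexOn_vertexRatio (d := d) hβ hφ hC
    rcases hμm.eq_or_lt with rfl | hlt
    · have hmint : IsMinOn (vertexRatio d β φ) (Set.Ioi 0) (t : ℝ) := fun s hs => by
        change vertexRatio d β φ t ≤ vertexRatio d β φ s
        rw [h]
        exact hmin hs
      exact htμ'.ne (hconv.eq_of_isMinOn hmint hmin ht0 hm0')
    · have hlt' : (μ : ℝ) < m := by exact_mod_cast hlt
      have h1 := hconv.slope_strict_mono_adjacent (Set.mem_Ioi.2 ht0) (Set.mem_Ioi.2 hm0')
        htμ' hlt'
      rw [h, sub_self, zero_div] at h1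
      have h2 : vertexRatio d β φ m ≤ vertexRatio d β φ μ := hmin (ht0.trans htμ')
      have h3 : (vertexRatio d β φ m - vertexRatio d β φ μ) / ((m : ℝ) - μ) ≤ 0 :=
        div_nonpos_of_nonpos_of_nonneg (sub_nonpos.2 h2) (sub_pos.2 hlt').le
      linarith

theorem MStar_le_RStar (hd : 1 ≤ d) (hβ : 0 < β) (hφ : Measurable φ)
    (hC : tempered d β φ ≠ ⊤) : MStar d β φ ≤ RStar d β φ := by
  refine iSup₂_le fun μ hμ => ?_
  by_cases hμ0 : μ = 0
  · subst hμ0; simp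
  have hΨ := vertexSum_ne_top (d := d) hβ hφ hC μ
  have hΨ0 : vertexSum d β φ μ ≠ 0 := (lt_of_lt_of_le one_pos (one_le_vertexSum μ)).ne'
  have hμE : (μ : ℝ≥0∞) ≠ 0 := by simpa using hμ0
  obtain ⟨r, hr⟩ : ∃ r : ℝ≥0, (r : ℝ≥0∞) = μ / vertexSum d β φ μ :=
    ⟨_, ENNReal.coe_toNNReal (ENNReal.div_ne_top ENNReal.coe_ne_top hΨ0)⟩
  have hr0 : (r : ℝ≥0∞) ≠ 0 := by rw [hr]; exact ENNReal.div_ne_zero.2 ⟨hμE, hΨ⟩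
  have hrμ : (r : ℝ≥0∞) * vertexSum d β φ μ = μ := by
    rw [hr, ENNReal.div_mul_cancel hΨ0 hΨ]
  set T := forestSum (vertexIntegral d β φ) r 1 with hT
  have hTtree : T = r * treeSum d β φ r := by rw [hT, forestSum_one, treeSum_eq hβ hφ]
  have hTμ : T ≤ μ := forestSum_le _ (by rw [← vertexSum_eq, hrμ])
  have hTtop : T ≠ ⊤ := ne_top_of_le_ne_top ENNReal.coe_ne_top hTμ
  obtain ⟨t, ht⟩ : ∃ t : ℝ≥0, (t : ℝ≥0∞) = T := ⟨_, ENNReal.coe_toNNReal hTtop⟩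
  have htree : treeSum d β φ r = vertexSum d β φ t := by
    rw [treeSum_eq hβ hφ, tsum_forestCoeff_one, vertexSum_eq, ht]
  have ht0 : t ≠ 0 := by
    rintro rfl
    rw [ENNReal.coe_zero, hTtree] at ht
    rcases mul_eq_zero.1 ht.symm with h | h
    · exact hr0 h
    · exact (lt_of_lt_of_le one_pos (one_le_treeSum r)).ne' h
  have hratio : ∀ {ν : ℝ≥0}, ν ≠ 0 → (r : ℝ≥0∞) * vertexSum d β φ ν = ν →
      ENNReal.ofReal (vertexRatio d β φ ν) = (r : ℝ≥0∞)⁻¹ := by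
    intro ν hν h
    have hν' : (ν : ℝ≥0∞) ≠ 0 := by simpa using hν
    rw [vertexSum_eq_mul hβ hφ hC hν, mul_left_comm] at h
    refine ENNReal.eq_inv_of_mul_eq_one_left ?_
    rw [mul_comm]
    have h' : (ν : ℝ≥0∞) * (r * ENNReal.ofReal (vertexRatio d β φ ν)) = ν * 1 := by
      rw [h, mul_one]
    exact (ENNReal.mul_right_inj hν' ENNReal.coe_ne_top).1 h'
  have heq : vertexRatio d β φ t = vertexRatio d β φ μ := by
    have h1 := hratio ht0 (by rw [← htree, ← hTtree, ht])
    have h2 := hratio hμ0 hrμ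
    have hp : ∀ {ν : ℝ≥0}, ν ≠ 0 → 0 ≤ vertexRatio d β φ ν := fun {ν} hν =>
      (vertexRatio_pos (by exact_mod_cast pos_iff_ne_zero.2 hν)).le
    rw [← h2] at h1
    exact (ENNReal.ofReal_eq_ofReal_iff (hp ht0) (hp hμ0)).1 h1
  have htμ : t = μ := vertexRatio_injective_below hd hβ hφ hC ht0
    (by rw [← ENNReal.coe_le_coe, ht]; exact hTμ) hμ heq
  rw [htμ] at htree
  refine le_iSup₂_of_le r (le_treeRadius hβ hφ (by rw [htree]; exact hΨ)) ?_
  rw [htree, hrμ]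

end RepulsiveGas

end

noncomputable section

namespace RepulsiveGas

open MeasureTheory Finset

variable {d : ℕ} {β : ℝ} {φ : ℝ≥0 → ℝ≥0∞}

/-! ### Renewal structure of the explorations in infinite volume -/

lemma forestCoeff_ne_top {g : ℕ → ℝ≥0∞} (hg : ∀ m, g m ≠ ⊤) (N k : ℕ) :
    forestCoeff g N k ≠ ⊤ := by
  induction N generalizing k with
  | zero => simp only [forestCoeff]; split_ifs <;> simp
  | succ N ih =>
    obtain _ | k := k
    · simp [forestCoeff]
    · rw [forestCoeff, tsum_eq_sum (s := range (N + 1))]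
      · refine ENNReal.sum_ne_top.2 fun m _ => ENNReal.mul_ne_top ?_ (ENNReal.mul_ne_top (hg m) (ih _))
        exact ENNReal.inv_ne_top.2 (by exact_mod_cast m.factorial_ne_zero)
      · intro m hm
        have : N < m := by simpa using hm
        rw [forestCoeff_eq_zero_of_lt _ (by omega)]
        simp

variable (d β φ) in
/-- The coefficient of order `n` of `ρ(-z) / (-z)`, where `ρ` is the infinite volume density. -/
def densityCoeff (n : ℕ) : ℝ≥0∞ := explore d β φ 0 Set.univ (n + 1) 1 fun _ => 0

lemma explore_univ_one (s N : ℕ) (x : Fin 1 → Space d) :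
    explore d β φ s Set.univ N 1 x = explore d β φ s Set.univ N 1 fun _ => 0 := by
  have := explore_add_right (d := d) (β := β) (φ := φ) s Set.univ (x 0) N 1 fun _ => 0
  rw [Set.preimage_univ] at this
  rw [this]
  congr 1
  funext i
  rw [Subsingleton.elim i 0, zero_add]

lemma explore_one (N : ℕ) (x : Fin 1 → Space d) :
    explore d β φ 1 Set.univ N 1 x = if N = 1 then 1 else 0 := by
  cases N <;> simp [explore]

lemma explore_univ_eq_sum_antidiagonal (hφ : Measurable φ) (N k : ℕ) (x : Fin (k + 1) → Space d) :
    explore d β φ 0 Set.univ N (k + 1) x = ∑ p ∈ antidiagonal (N + 1),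
      explore d β φ 1 Set.univ p.1 (k + 1) x * explore d β φ 0 Set.univ p.2 1 fun _ => 0 := by
  induction N generalizing k with
  | zero => simp [explore, Nat.antidiagonal_succ]
  | succ N ih =>
    obtain _ | k := k
    · rw [explore_univ_one, sum_eq_single (1, N + 1)]
      · rw [explore_one, if_pos rfl, one_mul]
      · rintro ⟨i, j⟩ hij hne
        rw [HasAntidiagonal.mem_antidiagonal] at hij
        simp only at hij
        have hi : i ≠ 1 := by
          rintro rfl
          exact hne (by rw [Prod.mk.injEq]; omega)
        rw [explore_one, if_neg hi, zero_mul]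
      · intro h
        exact absurd (HasAntidiagonal.mem_antidiagonal.2 (by ring)) h
    · rw [Nat.antidiagonal_succ (n := N + 1), sum_cons, sum_map]
      simp only [Function.Embedding.prodMap, Function.Embedding.coeFn_mk, Prod.map,
        Function.Embedding.refl_apply, Nat.succ_eq_add_one]
      rw [explore_succ_succ _ _ _ _ (Nat.succ_ne_zero _)]
      have h0 : explore d β φ 1 Set.univ 0 (k + 1 + 1) x = 0 := by simp [explore]
      have h1 : ∀ n, explore d β φ 1 Set.univ (n + 1) (k + 1 + 1) x = _ :=
        fun n => explore_succ_succ _ _ _ _ (by omega)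
      simp only [h0, h1, zero_mul, zero_add, ← ENNReal.tsum_mul_right]
      rw [← Summable.tsum_finsetSum fun _ _ => ENNReal.summable]
      refine tsum_congr fun m => ?_
      simp only [mul_assoc]
      rw [← mul_sum]
      congr 1
      have hmeas : ∀ n, Measurable fun y : Fin m → Space d => ENNReal.ofReal (stepWeight d β φ x y) *
          explore d β φ 1 Set.univ n (k + 1 + m) (Fin.append (Fin.tail x) y) := fun n =>
        (measurable_stepWeight hφ measurable_const measurable_id).ennreal_ofReal.mul
          ((measurable_explore hφ _ _ _ _).comp (measurable_append measurable_const measurable_id))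
      simp_rw [← lintegral_mul_const _ (hmeas _)]
      rw [← lintegral_finsetSum _ fun p _ => (hmeas p.1).mul_const _]
      refine lintegral_congr fun y => ?_
      have h2 : ∀ l (hl : l = k + m + 1) (z : Fin l → Space d),
          explore d β φ 0 Set.univ N l z = ∑ p ∈ antidiagonal (N + 1),
            explore d β φ 1 Set.univ p.1 l z * explore d β φ 0 Set.univ p.2 1 fun _ => 0 := by
        rintro l rfl z
        exact ih _ _
      rw [h2 _ (by omega), mul_sum]
      exact sum_congr rfl fun p _ => by rw [mul_assoc]

variable (d β φ) in
/-- The total weight of the explorations from one point with `n` further points that have exactly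
one active point at the end, but at no time between the start and the end. -/
def renewalCoeff (n : ℕ) : ℝ≥0∞ :=
  ∑' m : ℕ, (((m + 1).factorial : ℝ≥0∞))⁻¹ * ∫⁻ y : Fin (m + 1) → Space d,
    ENNReal.ofReal (stepWeight d β φ (fun _ : Fin 1 => (0 : Space d)) y) *
      explore d β φ 1 Set.univ n (0 + (m + 1)) (Fin.append (Fin.tail fun _ : Fin 1 => (0 : Space d)) y)

lemma renewalCoeff_zero : renewalCoeff d β φ 0 = 0 := by
  simp [renewalCoeff, explore]

/-- The renewal equation. -/
lemma densityCoeff_eq (hφ : Measurable φ) (n : ℕ) :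
    densityCoeff d β φ n = (if n = 0 then 1 else 0) +
      ∑ p ∈ antidiagonal n, renewalCoeff d β φ p.1 * densityCoeff d β φ p.2 := by
  have hq0 : explore d β φ 0 Set.univ 0 1 (fun _ => (0 : Space d)) = 0 := by simp [explore]
  have hshift : ∑ p ∈ antidiagonal n, renewalCoeff d β φ p.1 * densityCoeff d β φ p.2 =
      ∑ p ∈ antidiagonal (n + 1), renewalCoeff d β φ p.1 *
        explore d β φ 0 Set.univ p.2 1 fun _ => 0 := by
    rw [Nat.antidiagonal_succ', sum_cons, sum_map, hq0, mul_zero, zero_add]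
    rfl
  rw [hshift, densityCoeff, explore_succ_succ _ _ _ _ (Nat.succ_ne_zero _),
    tsum_eq_zero_add' ENNReal.summable]
  congr 1
  · have h0 : ∀ z : Fin (0 + 0) → Space d, explore d β φ 0 Set.univ n (0 + 0) z =
        if n = 0 then 1 else 0 := by
      intro z
      cases n <;> simp [explore]
    rw [Set.pi_univ, Measure.restrict_univ, volume_pi, Measure.pi_of_empty _ default,
      lintegral_dirac, h0]
    simp [stepWeight, vertexWeight, crossProd]
  · simp only [renewalCoeff, ← ENNReal.tsum_mul_right]
    rw [← Summable.tsum_finsetSum fun _ _ => ENNReal.summable]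
    refine tsum_congr fun m => ?_
    simp only [mul_assoc]
    rw [← mul_sum, Set.pi_univ, Measure.restrict_univ]
    congr 1
    have hmeas : ∀ n, Measurable fun y : Fin (m + 1) → Space d =>
        ENNReal.ofReal (stepWeight d β φ (fun _ : Fin 1 => (0 : Space d)) y) *
          explore d β φ 1 Set.univ n (0 + (m + 1))
            (Fin.append (Fin.tail fun _ : Fin 1 => (0 : Space d)) y) := fun n =>
      (measurable_stepWeight hφ measurable_const measurable_id).ennreal_ofReal.mul
        ((measurable_explore hφ _ _ _ _).comp (measurable_append measurable_const measurable_id))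
    simp_rw [← lintegral_mul_const _ (hmeas _)]
    rw [← lintegral_finsetSum _ fun p _ => (hmeas p.1).mul_const _]
    refine lintegral_congr fun y => ?_
    have h2 : ∀ l (hl : l = m + 1) (z : Fin l → Space d),
        explore d β φ 0 Set.univ n l z = ∑ p ∈ antidiagonal (n + 1),
          explore d β φ 1 Set.univ p.1 l z * explore d β φ 0 Set.univ p.2 1 fun _ => 0 := by
      rintro l rfl z
      exact explore_univ_eq_sum_antidiagonal hφ _ _ _
    rw [h2 _ (by omega), mul_sum]
    exact sum_congr rfl fun p _ => by rw [mul_assoc]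

lemma densityCoeff_zero (hφ : Measurable φ) : densityCoeff d β φ 0 = 1 := by
  rw [densityCoeff_eq hφ]
  simp [renewalCoeff_zero]

lemma densityCoeff_le (hβ : 0 < β) (hφ : Measurable φ) (n : ℕ) :
    densityCoeff d β φ n ≤ forestCoeff (vertexIntegral d β φ) (n + 1) 1 :=
  explore_le_forestCoeff hβ hφ _ _ _ _

lemma densityCoeff_ne_top (hβ : 0 < β) (hφ : Measurable φ) (hC : tempered d β φ ≠ ⊤) (n : ℕ) :
    densityCoeff d β φ n ≠ ⊤ :=
  ne_top_of_le_ne_top (forestCoeff_ne_top (vertexIntegral_ne_top hβ hφ hC) _ _)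
    (densityCoeff_le hβ hφ n)

lemma renewalCoeff_le (hφ : Measurable φ) (n : ℕ) :
    renewalCoeff d β φ n ≤ densityCoeff d β φ n := by
  rw [densityCoeff_eq hφ n]
  refine le_trans ?_ le_add_self
  have h := single_le_sum (s := antidiagonal n) (f := fun p : ℕ × ℕ =>
    renewalCoeff d β φ p.1 * densityCoeff d β φ p.2) (fun _ _ => zero_le)
    (HasAntidiagonal.mem_antidiagonal.2 (add_zero n) : (n, 0) ∈ antidiagonal n)
  simpa [densityCoeff_zero hφ] using h

/-- The generating function of the renewal coefficients, in terms of the tree sum. -/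
lemma one_add_tsum_renewalCoeff_le (hβ : 0 < β) (hφ : Measurable φ) {r : ℝ≥0}
    (hr : treeSum d β φ r ≠ ⊤) :
    (1 + ∑' n, renewalCoeff d β φ n * (r : ℝ≥0∞) ^ n) * treeSum d β φ r ≤
      2 * treeSum d β φ r - 1 := by
  set Y := ∑' n, renewalCoeff d β φ n * (r : ℝ≥0∞) ^ n with hY
  set F := ∑' n, densityCoeff d β φ n * (r : ℝ≥0∞) ^ n with hF
  set B := treeSum d β φ r with hB
  have hFB : F ≤ B := by
    rw [hB, treeSum_eq hβ hφ]
    exact ENNReal.tsum_le_tsum fun n => mul_le_mul_left (densityCoeff_le hβ hφ n) _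
  have hFtop : F ≠ ⊤ := ne_top_of_le_ne_top hr hFB
  have hrenew : F = 1 + Y * F := by
    rw [hF, hY, tsum_mul_tsum_antidiagonal]
    conv_lhs => enter [1, n]; rw [densityCoeff_eq hφ, add_mul, sum_mul]
    rw [ENNReal.tsum_add, tsum_eq_single 0 (by intro n hn; simp [hn])]
    congr 1
    · simp
    · refine tsum_congr fun n => sum_congr rfl fun p hp => ?_
      rw [← mem_antidiagonal.1 hp, pow_add]
      ring
  have hF1 : 1 ≤ F := by rw [hrenew]; exact le_self_add
  have hB0 : B ≠ 0 := (lt_of_lt_of_le one_pos (one_le_treeSum r)).ne'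
  have hY1 : Y ≤ 1 := by
    have h1 : Y * F ≤ 1 * F := by
      rw [one_mul]
      conv_rhs => rw [hrenew]
      exact le_add_self
    exact (ENNReal.mul_le_mul_iff_left (zero_lt_one.trans_le hF1).ne' hFtop).1 h1
  have key : Y * B + 1 ≤ B := by
    calc Y * B + 1 = Y * (F + (B - F)) + 1 := by rw [add_tsub_cancel_of_le hFB]
      _ = (1 + Y * F) + Y * (B - F) := by ring
      _ = F + Y * (B - F) := by rw [← hrenew]
      _ ≤ F + 1 * (B - F) := by gcongr
      _ = B := by rw [one_mul, add_tsub_cancel_of_le hFB]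
  refine ENNReal.le_sub_of_add_le_right ENNReal.one_ne_top ?_
  calc (1 + Y) * B + 1 = B + (Y * B + 1) := by ring
    _ ≤ B + B := by gcongr
    _ = 2 * B := by ring

end RepulsiveGas

end

noncomputable section

namespace RepulsiveGas

open Finset PowerSeries

/-! ### Lagrange inversion -/

/-- The coefficients in Lagrange's inversion formula for `∫ f` as a power series in `X * f`. -/
def lagrangeCoeff (f : ℝ⟦X⟧) : ℕ → ℝ
  | 0 => 0
  | n + 1 => (f⁻¹ ^ n).coeff n / (n + 1)

section Lagrange

variable {f : ℝ⟦X⟧}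

lemma inv_mul_self (hf : constantCoeff f = 1) : f⁻¹ * f = 1 :=
  PowerSeries.inv_mul_cancel f (by rw [hf]; exact one_ne_zero)

lemma derivative_inv_eq (hf : constantCoeff f = 1) :
    derivative ℝ f⁻¹ = -(derivative ℝ f * f⁻¹ ^ 2) := by
  have h := congrArg (derivative ℝ) (inv_mul_self hf)
  rw [Derivation.leibniz, Derivation.map_one_eq_zero, smul_eq_mul, smul_eq_mul] at h
  have h1 : (f⁻¹ * derivative ℝ f + f * derivative ℝ f⁻¹) * f⁻¹ = 0 := by rw [h, zero_mul]
  have h2 := inv_mul_self hf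
  linear_combination h1 - derivative ℝ f⁻¹ * h2

/-- The residue of the logarithmic derivative, and of the derivatives of the other powers. -/
lemma coeff_residue (hf : constantCoeff f = 1) (j : ℕ) :
    ((f + X * derivative ℝ f) * f⁻¹ ^ (j + 1)).coeff j = if j = 0 then 1 else 0 := by
  have h1 : (f + X * derivative ℝ f) * f⁻¹ ^ (j + 1) =
      f⁻¹ ^ j + X * (derivative ℝ f * f⁻¹ ^ (j + 1)) := by
    rw [pow_succ]
    linear_combination f⁻¹ ^ j * inv_mul_self hf
  rw [h1, map_add]
  obtain _ | j := j
  · simp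
  · rw [coeff_succ_X_mul, if_neg j.succ_ne_zero]
    have h2 : derivative ℝ (f⁻¹ ^ (j + 1)) =
        -((j + 1 : ℕ) • (derivative ℝ f * f⁻¹ ^ (j + 1 + 1))) := by
      rw [Derivation.leibniz_pow, derivative_inv_eq hf, smul_eq_mul, Nat.add_sub_cancel,
        ← smul_neg]
      congr 1
      ring
    have h3 := congrArg (coeff j) h2
    rw [coeff_derivative, map_neg, map_nsmul, nsmul_eq_mul] at h3
    push_cast at h3
    have hj : (j : ℝ) + 1 ≠ 0 := by positivity
    refine mul_left_cancel₀ hj ?_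
    linear_combination h3

lemma coeff_subst_eq_sum (hρ : constantCoeff f = 0) (V : ℝ⟦X⟧) {m n : ℕ} (hmn : m ≤ n) :
    coeff m (V.subst f : ℝ⟦X⟧) = ∑ k ∈ range (n + 1), V.coeff k * (f ^ k).coeff m := by
  rw [coeff_subst' (HasSubst.of_constantCoeff_zero' hρ), finsum_eq_sum_of_support_subset (s := range (n + 1))]
  · simp only [smul_eq_mul]
  · intro k hk
    simp only [coe_range, Set.mem_Iio]
    by_contra hkn
    refine hk ?_
    change coeff k V • coeff m (f ^ k) = 0
    rw [coeff_of_lt_order m, smul_zero]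
    have h1 : (1 : ℕ∞) ≤ f.order := by
      rw [Order.one_le_iff_ne_zero]
      exact order_ne_zero_iff_constCoeff_eq_zero.2 hρ
    calc (m : ℕ∞) < (k : ℕ∞) := by exact_mod_cast (show m < k by omega)
      _ = k • (1 : ℕ∞) := by simp
      _ ≤ k • f.order := nsmul_le_nsmul_right h1 k
      _ ≤ (f ^ k).order := le_order_pow _ _

/-- Lagrange's inversion formula, for a series `V` such that the derivative of `V(X f)` is `f`. -/
lemma coeff_eq_lagrangeCoeff (hf : constantCoeff f = 1) {V : ℝ⟦X⟧} (hV : V.coeff 0 = 0)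
    (h : derivative ℝ (V.subst (X * f) : ℝ⟦X⟧) = f) (n : ℕ) : V.coeff n = lagrangeCoeff f n := by
  obtain _ | n := n
  · exact hV
  set h' := f⁻¹ with hh
  set Q : ℝ⟦X⟧ := ∑ k ∈ range (n + 1 + 1), V.coeff k • (X * f) ^ k with hQ
  have hcoeff : ∀ m ≤ n, (derivative ℝ Q).coeff m = f.coeff m := by
    intro m hm
    have hm' := congrArg (coeff m) h
    rw [coeff_derivative,
      coeff_subst_eq_sum (by simp) V (show m + 1 ≤ n + 1 by omega)] at hm'
    rw [coeff_derivative, ← hm', hQ, map_sum]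
    simp only [coeff_smul, smul_eq_mul]
  have h1 : (derivative ℝ Q * h' ^ (n + 1)).coeff n = (h' ^ n).coeff n := by
    have h2 : f * h' ^ (n + 1) = h' ^ n := by
      rw [pow_succ]
      linear_combination h' ^ n * inv_mul_self hf
    rw [← h2, coeff_mul, coeff_mul]
    refine sum_congr rfl fun p hp => ?_
    rw [hcoeff p.1 (by have := HasAntidiagonal.mem_antidiagonal.1 hp; omega)]
  have h3 : (derivative ℝ Q * h' ^ (n + 1)).coeff n = V.coeff (n + 1) * (n + 1) := by
    rw [hQ, map_sum, sum_mul, map_sum, sum_range_succ']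
    have hzero : (derivative ℝ (V.coeff 0 • (X * f) ^ 0) * h' ^ (n + 1)).coeff n = 0 := by
      rw [hV, zero_smul, map_zero, zero_mul, map_zero]
    rw [hzero, add_zero, sum_eq_single n]
    · have hd : derivative ℝ (V.coeff (n + 1) • (X * f) ^ (n + 1)) * h' ^ (n + 1) =
          (V.coeff (n + 1) * (n + 1)) • (X ^ n * ((f + X * derivative ℝ f) * h' ^ (0 + 1))) := by
        rw [Derivation.map_smul, Derivation.leibniz_pow, Derivation.leibniz, derivative_X,
          mul_smul, smul_mul_assoc]
        congr 1
        have hp : (f * h') ^ n = 1 := by rw [mul_comm, inv_mul_self hf, one_pow]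
        rw [Nat.add_sub_cancel, smul_eq_mul, smul_eq_mul, smul_eq_mul, mul_one,
          nsmul_eq_mul, smul_eq_C_mul]
        push_cast
        rw [mul_pow] at hp
        simp only [map_add, map_natCast, map_one]
        linear_combination ((n : ℝ⟦X⟧) + 1) * X ^ n * (f + X * derivative ℝ f) * h' * hp
      rw [hd, coeff_smul, coeff_X_pow_mul', if_pos le_rfl, Nat.sub_self, coeff_residue hf,
        if_pos rfl, smul_eq_mul, mul_one]
    · intro k hk hkn
      have hk' : k < n := lt_of_le_of_ne (by simpa [Nat.lt_succ_iff] using hk) hkn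
      have hd : derivative ℝ (V.coeff (k + 1) • (X * f) ^ (k + 1)) * h' ^ (n + 1) =
          (V.coeff (k + 1) * (k + 1)) •
            (X ^ k * ((f + X * derivative ℝ f) * h' ^ (n - k + 1))) := by
        rw [Derivation.map_smul, Derivation.leibniz_pow, Derivation.leibniz, derivative_X,
          mul_smul, smul_mul_assoc]
        congr 1
        have hp : (f * h') ^ k = 1 := by rw [mul_comm, inv_mul_self hf, one_pow]
        rw [Nat.add_sub_cancel, smul_eq_mul, smul_eq_mul, smul_eq_mul, mul_one,
          nsmul_eq_mul, smul_eq_C_mul, show n + 1 = k + (n - k + 1) by omega, pow_add]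
        push_cast
        rw [mul_pow] at hp
        simp only [map_add, map_natCast, map_one]
        linear_combination ((k : ℝ⟦X⟧) + 1) * X ^ k * (f + X * derivative ℝ f) *
          h' ^ (n - k + 1) * hp
      rw [hd, coeff_smul, coeff_X_pow_mul', if_pos hk'.le, coeff_residue hf,
        if_neg (by omega), smul_zero]
    · intro h; simp at h
  have hn : (n : ℝ) + 1 ≠ 0 := by positivity
  rw [lagrangeCoeff, eq_div_iff hn, ← h1, h3]

/-- The coefficients of a power series composed with the inverse of `X` times its derivative. -/
lemma coeff_subst_compInverse {P : ℝ⟦X⟧} (hP0 : constantCoeff P = 0)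
    (hP : constantCoeff (derivative ℝ P) = 1) (n : ℕ) :
    coeff n (P.subst (compInverse (X * derivative ℝ P)) : ℝ⟦X⟧) = lagrangeCoeff (derivative ℝ P) n := by
  set f := derivative ℝ P with hf
  have hc : (X * f).coeff 1 = 1 := by
    rw [show (1 : ℕ) = 0 + 1 from rfl, coeff_succ_X_mul, coeff_zero_eq_constantCoeff_apply, hP]
  have hu : IsUnit ((X * f).coeff 1) := by rw [hc]; exact isUnit_one
  have hinv : compInverse (X * f) = (X * f).substInvOfIsUnit hu := by
    unfold compInverse
    rw [dif_pos hu]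
  have hX0 : constantCoeff (X * f) = 0 := by simp
  have hs : HasSubst ((X * f).substInvOfIsUnit hu) := HasSubst.substInvOfIsUnit _ hu
  refine coeff_eq_lagrangeCoeff hP ?_ ?_ n
  · rw [hinv, coeff_zero_eq_constantCoeff_apply]
    exact constantCoeff_subst_eq_zero (constantCoeff_substInvOfIsUnit _ hu) P hP0
  · rw [hinv, subst_comp_subst_apply hs (HasSubst.of_constantCoeff_zero' hX0),
      subst_substInvOfIsUnit_left _ hX0, ← map_algebraMap_eq_subst_X, hf]
    simp

end Lagrange

/-! ### Continuity of the Lagrange coefficients -/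

section Continuity

variable {g : ℕ → ℝ⟦X⟧} {f : ℝ⟦X⟧}

lemma tendsto_coeff_inv (hg : ∀ k, constantCoeff (g k) = 1) (hf : constantCoeff f = 1)
    (h : ∀ n, Filter.Tendsto (fun k => (g k).coeff n) Filter.atTop (𝓝 (f.coeff n))) (n : ℕ) :
    Filter.Tendsto (fun k => ((g k)⁻¹).coeff n) Filter.atTop (𝓝 ((f⁻¹).coeff n)) := by
  induction n using Nat.strong_induction_on with
  | _ n ih =>
    have hrec : ∀ {F : ℝ⟦X⟧}, constantCoeff F = 1 → coeff n F⁻¹ = if n = 0 then 1 else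
        -1 * ∑ p ∈ antidiagonal n, if p.2 < n then coeff p.1 F * coeff p.2 F⁻¹ else 0 := by
      intro F hF
      rw [PowerSeries.coeff_inv, hF, inv_one]
    rw [hrec hf, funext fun k => hrec (hg k)]
    split_ifs with hn
    · exact tendsto_const_nhds
    · refine Filter.Tendsto.const_mul _ (tendsto_finsetSum _ fun p _ => ?_)
      split_ifs with hp
      · exact (h _).mul (ih _ hp)
      · exact tendsto_const_nhds

lemma tendsto_coeff_pow (h : ∀ n, Filter.Tendsto (fun k => (g k).coeff n) Filter.atTop
    (𝓝 (f.coeff n))) (m n : ℕ) :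
    Filter.Tendsto (fun k => (g k ^ m).coeff n) Filter.atTop (𝓝 ((f ^ m).coeff n)) := by
  induction m generalizing n with
  | zero => simp
  | succ m ih =>
    simp only [pow_succ, coeff_mul]
    exact tendsto_finsetSum _ fun p _ => (ih _).mul (h _)

lemma tendsto_lagrangeCoeff (hg : ∀ k, constantCoeff (g k) = 1) (hf : constantCoeff f = 1)
    (h : ∀ n, Filter.Tendsto (fun k => (g k).coeff n) Filter.atTop (𝓝 (f.coeff n))) (n : ℕ) :
    Filter.Tendsto (fun k => lagrangeCoeff (g k) n) Filter.atTop (𝓝 (lagrangeCoeff f n)) := by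
  obtain _ | n := n
  · exact tendsto_const_nhds
  · exact (tendsto_coeff_pow (tendsto_coeff_inv hg hf h) n n).div_const _

end Continuity

/-! ### A submultiplicative norm on power series -/

/-- The sum of the absolute values of the terms of a power series at `r`. -/
def seriesNorm (r : ℝ≥0∞) (A : ℝ⟦X⟧) : ℝ≥0∞ := ∑' n, ‖A.coeff n‖ₑ * r ^ n

lemma enorm_coeff_mul_le (r : ℝ≥0∞) (A : ℝ⟦X⟧) (n : ℕ) : ‖A.coeff n‖ₑ * r ^ n ≤ seriesNorm r A :=
  ENNReal.le_tsum n

lemma seriesNorm_one (r : ℝ≥0∞) : seriesNorm r 1 = 1 := by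
  unfold seriesNorm
  rw [tsum_eq_single 0]
  · simp
  · intro n hn
    simp [coeff_one, hn]

lemma seriesNorm_mul_le (r : ℝ≥0∞) (A B : ℝ⟦X⟧) :
    seriesNorm r (A * B) ≤ seriesNorm r A * seriesNorm r B := by
  unfold seriesNorm
  rw [tsum_mul_tsum_antidiagonal]
  refine ENNReal.tsum_le_tsum fun n => ?_
  rw [coeff_mul]
  calc ‖∑ p ∈ antidiagonal n, A.coeff p.1 * B.coeff p.2‖ₑ * r ^ n
      ≤ (∑ p ∈ antidiagonal n, ‖A.coeff p.1 * B.coeff p.2‖ₑ) * r ^ n := by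
        gcongr
        exact enorm_sum_le _ _
    _ = _ := by
        rw [sum_mul]
        refine sum_congr rfl fun p hp => ?_
        rw [enorm_mul, ← HasAntidiagonal.mem_antidiagonal.1 hp, pow_add]
        ring

lemma seriesNorm_pow_le (r : ℝ≥0∞) (A : ℝ⟦X⟧) (m : ℕ) :
    seriesNorm r (A ^ m) ≤ seriesNorm r A ^ m := by
  induction m with
  | zero => rw [pow_zero, pow_zero, seriesNorm_one]
  | succ m ih =>
    rw [pow_succ, pow_succ]
    exact (seriesNorm_mul_le _ _ _).trans (mul_le_mul_left ih _)

end RepulsiveGas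

end

noncomputable section

namespace RepulsiveGas

open MeasureTheory Finset

variable {d : ℕ} {β : ℝ} {φ : ℝ≥0 → ℝ≥0∞}

/-! ### Splitting configurations -/

/-- Two configurations, put together along an equivalence of their index sets. -/
def glue {m l N : ℕ} (e : Fin m ⊕ Fin l ≃ Fin N) (a : Fin m → Space d) (b : Fin l → Space d) :
    Fin N → Space d := fun i => Sum.elim a b (e.symm i)

section Glue

variable {m l N : ℕ} (e : Fin m ⊕ Fin l ≃ Fin N) (a : Fin m → Space d) (b : Fin l → Space d)

lemma pairProd_sq {ι : Type*} [Fintype ι] [LinearOrder ι] (y : ι → Space d) :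
    pairProd d β φ y ^ 2 = ∏ i, ∏ j, if i = j then 1 else pairWeight d β φ (y i) (y j) := by
  have h1 : pairProd d β φ y =
      ∏ i, ∏ j, if i < j then pairWeight d β φ (y i) (y j) else 1 := by
    unfold pairProd
    simp_rw [prod_filter]
  have h2 : pairProd d β φ y =
      ∏ i, ∏ j, if j < i then pairWeight d β φ (y i) (y j) else 1 := by
    rw [h1, prod_comm]
    exact prod_congr rfl fun i _ => prod_congr rfl fun j _ => by rw [pairWeight_comm]
  rw [sq]
  nth_rewrite 1 [h1]
  rw [h2, ← prod_mul_distrib]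
  refine prod_congr rfl fun i _ => ?_
  rw [← prod_mul_distrib]
  refine prod_congr rfl fun j _ => ?_
  rcases lt_trichotomy i j with h | h | h
  · simp [h, h.ne, h.not_gt]
  · simp [h]
  · simp [h, h.ne', h.not_gt]

lemma pairProd_glue :
    pairProd d β φ (glue e a b) =
      pairProd d β φ a * pairProd d β φ b * crossProd d β φ a b := by
  have hnn : 0 ≤ pairProd d β φ a * pairProd d β φ b * crossProd d β φ a b :=
    mul_nonneg (mul_nonneg (pairProd_nonneg _) (pairProd_nonneg _)) (crossProd_nonneg _ _)
  refine (pow_left_inj₀ (pairProd_nonneg _) hnn two_ne_zero).1 ?_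
  have hcomm : crossProd d β φ a b = ∏ j, ∏ i, pairWeight d β φ (b j) (a i) := by
    rw [crossProd, prod_comm]
    exact prod_congr rfl fun i _ => prod_congr rfl fun j _ => pairWeight_comm _ _
  rw [mul_pow, mul_pow, pairProd_sq, pairProd_sq, pairProd_sq, ← e.prod_comp]
  simp_rw [← e.prod_comp (fun j => if _ = j then (1 : ℝ) else _)]
  simp only [glue, Equiv.symm_apply_apply, e.injective.eq_iff, Fintype.prod_sum_type,
    Sum.elim_inl, Sum.elim_inr, Sum.inl.injEq, Sum.inr.injEq, reduceCtorEq, if_false,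
    prod_mul_distrib]
  have hab : ∏ i, ∏ j, pairWeight d β φ (a i) (b j) = crossProd d β φ a b := rfl
  rw [← hcomm, hab]
  ring

lemma crossProd_glue {k : ℕ} (x : Fin k → Space d) :
    crossProd d β φ x (glue e a b) = crossProd d β φ x a * crossProd d β φ x b := by
  unfold crossProd
  rw [← prod_mul_distrib]
  refine prod_congr rfl fun i _ => ?_
  rw [← e.prod_comp]
  simp [glue, Fintype.prod_sum_type]

lemma crossProd_append {k m l : ℕ} (x : Fin k → Space d) (a : Fin m → Space d)
    (b : Fin l → Space d) :
    crossProd d β φ (Fin.append x a) b = crossProd d β φ x b * crossProd d β φ a b := by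
  unfold crossProd
  rw [Fin.prod_univ_add]
  simp

lemma volume_restrict_pi (Λ : Set (Space d)) (n : ℕ) :
    (volume : Measure (Fin n → Space d)).restrict (Set.univ.pi fun _ => Λ) =
      Measure.pi fun _ => volume.restrict Λ := by
  rw [volume_pi, Measure.restrict_pi_pi]

lemma integral_glue {Λ : Set (Space d)} (hΛ : volume Λ ≠ ⊤) (F : (Fin N → Space d) → ℝ)
    {C : ℝ} (hF : Measurable F) (hC : ∀ y, |F y| ≤ C) :
    ∫ y in Set.univ.pi (fun _ => Λ), F y =
      ∫ a in Set.univ.pi (fun _ => Λ), ∫ b in Set.univ.pi (fun _ => Λ), F (glue e a b) := by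
  have : IsFiniteMeasure (volume.restrict Λ) := isFiniteMeasure_restrict.2 hΛ
  simp only [volume_restrict_pi]
  set ν := volume.restrict Λ
  have h1 := measurePreserving_sumPiEquivProdPi_symm (fun _ : Fin m ⊕ Fin l => ν)
  have h2 := measurePreserving_piCongrLeft (fun _ : Fin N => ν) e
  have h3 := h2.comp h1
  have hglue : (fun z : (Fin m → Space d) × (Fin l → Space d) => glue e z.1 z.2) =
      (MeasurableEquiv.piCongrLeft (fun _ => Space d) e) ∘
        (MeasurableEquiv.sumPiEquivProdPi fun _ => Space d).symm := by
    funext z i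
    obtain ⟨j, rfl⟩ := e.surjective i
    rw [Function.comp_apply, MeasurableEquiv.coe_piCongrLeft, Equiv.piCongrLeft_apply_apply]
    simp only [glue, Equiv.symm_apply_apply]
    cases j <;> rfl
  rw [← hglue] at h3
  rw [← h3.map_eq, integral_map h3.measurable.aemeasurable hF.aestronglyMeasurable,
    integral_prod]
  refine Integrable.of_bound (hF.comp h3.measurable).aestronglyMeasurable C ?_
  exact Filter.Eventually.of_forall fun z => hC _

end Glue

/-! ### Partition functions in the presence of fixed particles -/

variable (d β φ) in
/-- The coefficient of order `N` of the partition function of the region `Λ`, in the presence of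
fixed particles at the points `x`. -/
def zCoeff (Λ : Set (Space d)) (N : ℕ) {k : ℕ} (x : Fin k → Space d) : ℝ :=
  (N.factorial : ℝ)⁻¹ * ∫ y in Set.univ.pi (fun _ : Fin N => Λ),
    pairProd d β φ y * crossProd d β φ x y

lemma abs_pairProd_mul_crossProd_le (hβ : 0 < β) {k N : ℕ} (x : Fin k → Space d)
    (y : Fin N → Space d) : |pairProd d β φ y * crossProd d β φ x y| ≤ 1 := by
  rw [abs_of_nonneg (mul_nonneg (pairProd_nonneg _) (crossProd_nonneg _ _))]
  exact mul_le_one₀ (pairProd_le_one hβ _) (crossProd_nonneg _ _) (crossProd_le_one hβ _ _)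

lemma integral_subset_term (hβ : 0 < β) (hφ : Measurable φ) {Λ : Set (Space d)}
    (hΛ : volume Λ ≠ ⊤) {N k : ℕ} (x : Fin (k + 1) → Space d) (S : Finset (Fin N)) :
    ∫ y in Set.univ.pi (fun _ : Fin N => Λ), (pairProd d β φ y * crossProd d β φ (Fin.tail x) y) *
        ∏ i ∈ S, (1 - pairWeight d β φ (x 0) (y i)) =
      ∫ a in Set.univ.pi (fun _ : Fin #S => Λ), stepWeight d β φ x a *
        (((N - #S).factorial : ℝ) * zCoeff d β φ Λ (N - #S) (Fin.append (Fin.tail x) a)) := by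
  have hcard : #Sᶜ = N - #S := by simp [card_compl]
  set e := finSumEquivOfFinset (rfl : #S = #S) hcard with he
  have hprod0 : ∀ y : Fin N → Space d, 0 ≤ ∏ i ∈ S, (1 - pairWeight d β φ (x 0) (y i)) :=
    fun y => prod_nonneg fun _ _ => sub_nonneg.2 (pairWeight_le_one hβ _ _)
  have hprod1 : ∀ y : Fin N → Space d, ∏ i ∈ S, (1 - pairWeight d β φ (x 0) (y i)) ≤ 1 :=
    fun y => prod_le_one (fun _ _ => sub_nonneg.2 (pairWeight_le_one hβ _ _))
      fun _ _ => sub_le_self _ (pairWeight_nonneg _ _)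
  rw [integral_glue e hΛ _ (C := 1)]
  · refine integral_congr_ae (Filter.Eventually.of_forall fun a => ?_)
    simp only [zCoeff]
    rw [← mul_assoc (((N - #S).factorial : ℝ)), mul_inv_cancel₀ (by positivity), one_mul,
      ← integral_const_mul]
    refine integral_congr_ae (Filter.Eventually.of_forall fun b => ?_)
    simp only
    have hS : ∏ i ∈ S, (1 - pairWeight d β φ (x 0) (glue e a b i)) =
        ∏ i, (1 - pairWeight d β φ (x 0) (a i)) := by
      have himg : S = univ.image fun i : Fin #S => e (Sum.inl i) := by
        ext j
        simp [he, finSumEquivOfFinset_inl]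
      refine (prod_congr himg fun _ _ => rfl).trans ?_
      rw [prod_image fun i _ j _ h => Sum.inl_injective (e.injective h)]
      simp [glue]
    rw [hS, pairProd_glue, crossProd_glue, crossProd_append, stepWeight, vertexWeight_univ]
    ring
  · exact ((measurable_pairProd hφ measurable_id).mul
      (measurable_crossProd hφ measurable_const measurable_id)).mul
      (Finset.measurable_prod _ fun i _ => measurable_const.sub
        (measurable_pairWeight hφ measurable_const (measurable_pi_apply i)))
  · intro y
    rw [abs_mul, abs_of_nonneg (hprod0 y)]
    exact mul_le_one₀ (abs_pairProd_mul_crossProd_le hβ _ _) (hprod0 y) (hprod1 y)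

lemma prod_one_sub_eq_sum {ι : Type*} [DecidableEq ι] (s : Finset ι) (u : ι → ℝ) :
    ∏ i ∈ s, (1 - u i) = ∑ t ∈ s.powerset, (-1) ^ #t * ∏ i ∈ t, u i := by
  rw [prod_sub]
  simp

/-- The Kirkwood–Salsburg equations. -/
lemma zCoeff_eq_sum (hβ : 0 < β) (hφ : Measurable φ) {Λ : Set (Space d)} (hΛ : volume Λ ≠ ⊤)
    (N : ℕ) {k : ℕ} (x : Fin (k + 1) → Space d) :
    zCoeff d β φ Λ N x = ∑ m ∈ range (N + 1), (-1) ^ m * ((m.factorial : ℝ)⁻¹ *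
      ∫ a in Set.univ.pi (fun _ : Fin m => Λ), stepWeight d β φ x a *
        zCoeff d β φ Λ (N - m) (Fin.append (Fin.tail x) a)) := by
  have : IsFiniteMeasure (volume.restrict Λ) := isFiniteMeasure_restrict.2 hΛ
  have hexp : ∀ y : Fin N → Space d, pairProd d β φ y * crossProd d β φ x y =
      ∑ S ∈ (univ : Finset (Fin N)).powerset, (-1) ^ #S *
        ((pairProd d β φ y * crossProd d β φ (Fin.tail x) y) *
          ∏ i ∈ S, (1 - pairWeight d β φ (x 0) (y i))) := by
    intro y
    have h1 : crossProd d β φ x y = (∏ i, (1 - (1 - pairWeight d β φ (x 0) (y i)))) *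
        crossProd d β φ (Fin.tail x) y := by
      simp only [sub_sub_cancel]
      rw [crossProd, Fin.prod_univ_succ]
      rfl
    rw [h1, prod_one_sub_eq_sum, sum_mul, mul_sum]
    exact sum_congr rfl fun S _ => by ring
  unfold zCoeff
  simp_rw [hexp]
  rw [integral_finsetSum]
  · simp_rw [integral_const_mul, integral_subset_term hβ hφ hΛ x]
    rw [sum_powerset_apply_card (fun m => (-1 : ℝ) ^ m *
      ∫ a in Set.univ.pi (fun _ : Fin m => Λ), stepWeight d β φ x a *
        (((N - m).factorial : ℝ) * zCoeff d β φ Λ (N - m) (Fin.append (Fin.tail x) a))),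
      card_univ, Fintype.card_fin, mul_sum]
    refine sum_congr rfl fun m hm => ?_
    have hm' : m ≤ N := by simpa [Nat.lt_succ_iff] using hm
    rw [nsmul_eq_mul]
    simp_rw [mul_left_comm (stepWeight d β φ x _)]
    rw [integral_const_mul]
    have hfac : (N.factorial : ℝ) = (N.choose m : ℝ) * m.factorial * (N - m).factorial := by
      exact_mod_cast (Nat.choose_mul_factorial_mul_factorial hm').symm
    have hc : (N.choose m : ℝ) ≠ 0 := by exact_mod_cast (Nat.choose_pos hm').ne'
    rw [hfac]
    simp only [zCoeff]
    field_simp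
  · intro S _
    refine Integrable.const_mul ?_ _
    rw [volume_restrict_pi]
    refine Integrable.of_bound (Measurable.aestronglyMeasurable ?_) 1
      (Filter.Eventually.of_forall fun y => ?_)
    · exact ((measurable_pairProd hφ measurable_id).mul
        (measurable_crossProd hφ measurable_const measurable_id)).mul
        (Finset.measurable_prod _ fun i _ => measurable_const.sub
          (measurable_pairWeight hφ measurable_const (measurable_pi_apply i)))
    · have h0 : 0 ≤ ∏ i ∈ S, (1 - pairWeight d β φ (x 0) (y i)) :=
        prod_nonneg fun _ _ => sub_nonneg.2 (pairWeight_le_one hβ _ _)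
      rw [Real.norm_eq_abs, abs_mul, abs_of_nonneg h0]
      exact mul_le_one₀ (abs_pairProd_mul_crossProd_le hβ _ _) h0
        (prod_le_one (fun _ _ => sub_nonneg.2 (pairWeight_le_one hβ _ _))
          fun _ _ => sub_le_self _ (pairWeight_nonneg _ _))

/-! ### Solution of the Kirkwood–Salsburg equations by explorations -/

lemma explore_ne_top (hβ : 0 < β) (hφ : Measurable φ) (hC : tempered d β φ ≠ ⊤)
    (Λ : Set (Space d)) (N k : ℕ) (x : Fin k → Space d) : explore d β φ 0 Λ N k x ≠ ⊤ :=
  ne_top_of_le_ne_top (forestCoeff_ne_top (vertexIntegral_ne_top hβ hφ hC) _ _)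
    (explore_le_forestCoeff hβ hφ _ _ _ _)

lemma integrable_explore (hβ : 0 < β) (hφ : Measurable φ) (hC : tempered d β φ ≠ ⊤)
    {Λ : Set (Space d)} (hΛ : volume Λ ≠ ⊤) (M : ℕ) {k m : ℕ} (x : Fin (k + 1) → Space d) :
    IntegrableOn (fun a : Fin m → Space d => stepWeight d β φ x a *
      (explore d β φ 0 Λ M (k + m) (Fin.append (Fin.tail x) a)).toReal)
      (Set.univ.pi fun _ => Λ) := by
  have : IsFiniteMeasure (volume.restrict Λ) := isFiniteMeasure_restrict.2 hΛ
  rw [IntegrableOn, volume_restrict_pi]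
  refine Integrable.of_bound (Measurable.aestronglyMeasurable ?_)
    (forestCoeff (vertexIntegral d β φ) M (k + m)).toReal (Filter.Eventually.of_forall fun a => ?_)
  · exact (measurable_stepWeight hφ measurable_const measurable_id).mul
      ((measurable_explore hφ _ _ _ _).comp
        (measurable_append measurable_const measurable_id)).ennreal_toReal
  · rw [Real.norm_eq_abs, abs_mul, abs_of_nonneg (stepWeight_nonneg hβ _ _),
      abs_of_nonneg ENNReal.toReal_nonneg]
    calc _ ≤ 1 * (forestCoeff (vertexIntegral d β φ) M (k + m)).toReal :=
          mul_le_mul (stepWeight_le_one hβ _ _) (ENNReal.toReal_mono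
            (forestCoeff_ne_top (vertexIntegral_ne_top hβ hφ hC) _ _)
            (explore_le_forestCoeff hβ hφ _ _ _ _)) ENNReal.toReal_nonneg zero_le_one
      _ = _ := one_mul _

/-- One step of the exploration, with real integrals. -/
lemma toReal_explore_succ_succ (hβ : 0 < β) (hφ : Measurable φ) (hC : tempered d β φ ≠ ⊤)
    (Λ : Set (Space d)) (i k : ℕ) (x : Fin (k + 1) → Space d) :
    (explore d β φ 0 Λ (i + (k + 1)) (k + 1) x).toReal = ∑ m ∈ range (i + 1),
      ((m.factorial : ℝ)⁻¹ * ∫ a in Set.univ.pi (fun _ : Fin m => Λ), stepWeight d β φ x a *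
        (explore d β φ 0 Λ (i + k) (k + m) (Fin.append (Fin.tail x) a)).toReal) := by
  have htop := explore_ne_top hβ hφ hC Λ (i + k + 1) (k + 1) x
  rw [← add_assoc, explore_succ_succ _ _ _ _ k.succ_ne_zero] at *
  rw [tsum_eq_sum (s := range (i + 1))]
  · rw [ENNReal.toReal_sum]
    · refine sum_congr rfl fun m _ => ?_
      rw [ENNReal.toReal_mul, ENNReal.toReal_inv, ENNReal.toReal_natCast]
      congr 1
      rw [← integral_toReal]
      · refine integral_congr_ae (Filter.Eventually.of_forall fun a => ?_)
        simp only
        rw [ENNReal.toReal_mul, ENNReal.toReal_ofReal (stepWeight_nonneg hβ _ _)]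
      · exact ((measurable_stepWeight hφ measurable_const measurable_id).ennreal_ofReal.mul
          ((measurable_explore hφ _ _ _ _).comp
            (measurable_append measurable_const measurable_id))).aemeasurable
      · exact Filter.Eventually.of_forall fun a => (ENNReal.mul_ne_top ENNReal.ofReal_ne_top
          (explore_ne_top hβ hφ hC _ _ _ _)).lt_top
    · exact fun m _ => ENNReal.ne_top_of_tsum_ne_top htop m
  · intro m hm
    have hm' : i < m := by simpa using hm
    simp [explore_eq_zero_of_lt 0 Λ (show i + k < k + m by omega)]

lemma sum_antidiagonal_shift {A Z : ℕ → ℝ} {m N : ℕ} (hm : m ≤ N) (hA : ∀ i < m, A i = 0) :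
    (-1) ^ m * ∑ p ∈ antidiagonal (N - m), (-1) ^ p.1 * A (p.1 + m) * Z p.2 =
      ∑ p ∈ antidiagonal N, (-1) ^ p.1 * A p.1 * Z p.2 := by
  obtain ⟨l, rfl⟩ := Nat.exists_eq_add_of_le hm
  rw [Nat.add_sub_cancel_left,
    Finset.Nat.sum_antidiagonal_eq_sum_range_succ (fun i j => (-1 : ℝ) ^ i * A (i + m) * Z j),
    Finset.Nat.sum_antidiagonal_eq_sum_range_succ (fun i j => (-1 : ℝ) ^ i * A i * Z j),
    Nat.succ_eq_add_one, Nat.succ_eq_add_one, add_assoc, sum_range_add _ m (l + 1),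
    sum_eq_zero (s := range m), zero_add, mul_sum]
  · refine sum_congr rfl fun i _ => ?_
    rw [show m + l - (m + i) = l - i by omega, add_comm i m, pow_add]
    ring
  · intro i hi
    rw [hA i (by simpa using hi)]
    ring

/-- The partition function in the presence of fixed particles, divided by the partition function:
the coefficients of the quotient are, up to signs, the exploration coefficients. -/
lemma zCoeff_eq_sum_explore (hβ : 0 < β) (hφ : Measurable φ) (hC : tempered d β φ ≠ ⊤)
    {Λ : Set (Space d)} (hΛ : volume Λ ≠ ⊤) (M : ℕ) :
    ∀ N k, N + k = M → ∀ x : Fin k → Space d, zCoeff d β φ Λ N x = ∑ p ∈ antidiagonal N,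
      (-1) ^ p.1 * (explore d β φ 0 Λ (p.1 + k) k x).toReal *
        zCoeff d β φ Λ p.2 (Fin.elim0 : Fin 0 → Space d) := by
  have hbase : ∀ N, ∀ x : Fin 0 → Space d, zCoeff d β φ Λ N x = ∑ p ∈ antidiagonal N,
      (-1) ^ p.1 * (explore d β φ 0 Λ (p.1 + 0) 0 x).toReal *
        zCoeff d β φ Λ p.2 (Fin.elim0 : Fin 0 → Space d) := by
    intro N x
    rw [sum_eq_single (0, N)]
    · rw [Subsingleton.elim x Fin.elim0]
      simp [explore]
    · rintro ⟨i, j⟩ hij hne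
      obtain _ | i := i
      · exact absurd (by simpa using hij) (fun h : j = N => hne (by rw [h]))
      · simp [explore]
    · intro h
      exact absurd (HasAntidiagonal.mem_antidiagonal.2 (zero_add N)) h
  induction M with
  | zero =>
    intro N k hNk x
    obtain rfl : k = 0 := by omega
    exact hbase N x
  | succ M ih =>
    intro N k hNk x
    obtain _ | k := k
    · exact hbase N x
    set Z : ℕ → ℝ := fun j => zCoeff d β φ Λ j (Fin.elim0 : Fin 0 → Space d) with hZ
    set A : ℕ → ℕ → ℝ := fun m i => ∫ a in Set.univ.pi (fun _ : Fin m => Λ),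
      stepWeight d β φ x a *
        (explore d β φ 0 Λ (i + k) (k + m) (Fin.append (Fin.tail x) a)).toReal with hA
    have hA0 : ∀ m i, i < m → A m i = 0 := by
      intro m i him
      simp [hA, explore_eq_zero_of_lt 0 Λ (show i + k < k + m by omega)]
    have hterm : ∀ m ∈ range (N + 1), (-1 : ℝ) ^ m * ((m.factorial : ℝ)⁻¹ *
        ∫ a in Set.univ.pi (fun _ : Fin m => Λ), stepWeight d β φ x a *
          zCoeff d β φ Λ (N - m) (Fin.append (Fin.tail x) a)) =
        ∑ p ∈ antidiagonal N, (-1) ^ p.1 * ((m.factorial : ℝ)⁻¹ * A m p.1) * Z p.2 := by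
      intro m hm
      have hm' : m ≤ N := by simpa [Nat.lt_succ_iff] using hm
      have hint : ∫ a in Set.univ.pi (fun _ : Fin m => Λ), stepWeight d β φ x a *
          zCoeff d β φ Λ (N - m) (Fin.append (Fin.tail x) a) =
          ∑ p ∈ antidiagonal (N - m), (-1) ^ p.1 * A m (p.1 + m) * Z p.2 := by
        have hinner : ∀ a : Fin m → Space d, stepWeight d β φ x a *
            zCoeff d β φ Λ (N - m) (Fin.append (Fin.tail x) a) =
            ∑ p ∈ antidiagonal (N - m), ((-1) ^ p.1 * Z p.2) * (stepWeight d β φ x a *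
              (explore d β φ 0 Λ (p.1 + m + k) (k + m) (Fin.append (Fin.tail x) a)).toReal) := by
          intro a
          rw [ih (N - m) (k + m) (by omega), mul_sum]
          refine sum_congr rfl fun p _ => ?_
          rw [show p.1 + (k + m) = p.1 + m + k by ring]
          ring
        simp_rw [hinner]
        rw [integral_finsetSum _ fun p _ =>
          (integrable_explore hβ hφ hC hΛ (p.1 + m + k) x).const_mul _]
        refine sum_congr rfl fun p _ => ?_
        rw [integral_const_mul]
        simp only [hA]
        ring
      rw [hint, mul_left_comm, sum_antidiagonal_shift hm' (hA0 m), mul_sum]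
      exact sum_congr rfl fun p _ => by ring
    rw [zCoeff_eq_sum hβ hφ hΛ, sum_congr rfl hterm, sum_comm]
    refine sum_congr rfl fun p hp => ?_
    rw [toReal_explore_succ_succ hβ hφ hC, ← sum_mul, ← mul_sum]
    congr 2
    have hpN : p.1 ≤ N := by have := HasAntidiagonal.mem_antidiagonal.1 hp; omega
    symm
    refine sum_subset (range_subset_range.2 (by omega)) fun m _ hm => ?_
    have : p.1 < m := by simpa using hm
    exact mul_eq_zero_of_right _ (hA0 m p.1 this)

variable (d β φ) in
/-- The coefficients, up to signs, of the expected number of particles in `Λ` divided by the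
fugacity. -/
def numberCoeff (Λ : Set (Space d)) (n : ℕ) : ℝ :=
  ∫ a in Set.univ.pi (fun _ : Fin 1 => Λ), (explore d β φ 0 Λ (n + 1) 1 a).toReal

/-- The derivative of the partition function. -/
lemma succ_mul_zCoeff_succ (hβ : 0 < β) (hφ : Measurable φ) (hC : tempered d β φ ≠ ⊤)
    {Λ : Set (Space d)} (hΛ : volume Λ ≠ ⊤) (N : ℕ) :
    ((N : ℝ) + 1) * zCoeff d β φ Λ (N + 1) (Fin.elim0 : Fin 0 → Space d) =
      ∑ p ∈ antidiagonal N, ((-1) ^ p.1 * numberCoeff d β φ Λ p.1) *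
        zCoeff d β φ Λ p.2 (Fin.elim0 : Fin 0 → Space d) := by
  have : IsFiniteMeasure (volume.restrict Λ) := isFiniteMeasure_restrict.2 hΛ
  have h1 : ((N : ℝ) + 1) * zCoeff d β φ Λ (N + 1) (Fin.elim0 : Fin 0 → Space d) =
      ∫ a in Set.univ.pi (fun _ : Fin 1 => Λ), zCoeff d β φ Λ N a := by
    set e : Fin 1 ⊕ Fin N ≃ Fin (N + 1) := finSumFinEquiv.trans (finCongr (add_comm 1 N))
    rw [zCoeff, integral_glue e hΛ _ (C := 1), Nat.factorial_succ, ← integral_const_mul,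
      ← integral_const_mul]
    · refine integral_congr_ae (Filter.Eventually.of_forall fun a => ?_)
      simp only [zCoeff]
      rw [← mul_assoc]
      congr 1
      · push_cast
        have : (N : ℝ) + 1 ≠ 0 := by positivity
        field_simp
      · refine integral_congr_ae (Filter.Eventually.of_forall fun b => ?_)
        simp only
        rw [pairProd_glue]
        have ha : pairProd d β φ a = 1 :=
          prod_eq_one fun i _ => prod_eq_one fun j hj =>
            absurd (mem_filter.1 hj).2 (by rw [Subsingleton.elim i j]; exact lt_irrefl j)
        have hx : crossProd d β φ (Fin.elim0 : Fin 0 → Space d) (glue e a b) = 1 := by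
          simp [crossProd]
        rw [ha, hx, one_mul, mul_one]
    · exact (measurable_pairProd hφ measurable_id).mul
        (measurable_crossProd hφ measurable_const measurable_id)
    · exact fun y => abs_pairProd_mul_crossProd_le hβ _ _
  rw [h1]
  simp_rw [zCoeff_eq_sum_explore hβ hφ hC hΛ (N + 1) N 1 rfl]
  rw [integral_finsetSum]
  · refine sum_congr rfl fun p _ => ?_
    rw [integral_mul_const, integral_const_mul, numberCoeff]
  · intro p _
    refine Integrable.mul_const (Integrable.const_mul ?_ _) _
    rw [volume_restrict_pi]
    refine Integrable.of_bound (measurable_explore hφ _ _ _ _).ennreal_toReal.aestronglyMeasurable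
      (forestCoeff (vertexIntegral d β φ) (p.1 + 1) 1).toReal
      (Filter.Eventually.of_forall fun a => ?_)
    rw [Real.norm_eq_abs, abs_of_nonneg ENNReal.toReal_nonneg]
    exact ENNReal.toReal_mono (forestCoeff_ne_top (vertexIntegral_ne_top hβ hφ hC) _ _)
      (explore_le_forestCoeff hβ hφ _ _ _ _)

/-! ### Taylor series -/

/-- The Taylor series of `f` at `0`. -/
def taylorSeries (f : ℝ → ℝ) : ℝ⟦X⟧ := PowerSeries.mk fun n => iteratedDeriv n f 0 / n.factorial

lemma taylorSeries_congr {f g : ℝ → ℝ} (h : f =ᶠ[𝓝 0] g) : taylorSeries f = taylorSeries g := by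
  ext n
  simp [taylorSeries, h.iteratedDeriv_eq n]

lemma taylorSeries_mul {f g : ℝ → ℝ} (hf : AnalyticAt ℝ f 0) (hg : AnalyticAt ℝ g 0) :
    taylorSeries (f * g) = taylorSeries f * taylorSeries g := by
  ext n
  rw [PowerSeries.coeff_mul, taylorSeries, PowerSeries.coeff_mk,
    iteratedDeriv_mul hf.contDiffAt hg.contDiffAt,
    Finset.Nat.sum_antidiagonal_eq_sum_range_succ
      (fun i j => (taylorSeries f).coeff i * (taylorSeries g).coeff j), sum_div]
  refine sum_congr rfl fun i hi => ?_
  have hi' : i ≤ n := by simpa [Nat.lt_succ_iff] using hi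
  simp only [taylorSeries, PowerSeries.coeff_mk]
  rw [Nat.cast_choose ℝ hi']
  have h0 : (n.factorial : ℝ) ≠ 0 := by positivity
  have h1 : (i.factorial : ℝ) ≠ 0 := by positivity
  have h2 : ((n - i).factorial : ℝ) ≠ 0 := by positivity
  field_simp

lemma derivative_taylorSeries (f : ℝ → ℝ) :
    PowerSeries.derivative ℝ (taylorSeries f) = taylorSeries (deriv f) := by
  ext n
  rw [PowerSeries.coeff_derivative]
  simp only [taylorSeries, PowerSeries.coeff_mk]
  rw [iteratedDeriv_succ', Nat.factorial_succ]
  have h0 : (n.factorial : ℝ) ≠ 0 := by positivity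
  have h1 : (n : ℝ) + 1 ≠ 0 := by positivity
  push_cast
  field_simp

lemma taylorSeries_const_mul {f : ℝ → ℝ} (c : ℝ) :
    taylorSeries (fun z => c * f z) = PowerSeries.C c * taylorSeries f := by
  ext n
  rw [PowerSeries.coeff_C_mul]
  simp only [taylorSeries, PowerSeries.coeff_mk]
  rw [iteratedDeriv_const_mul_field, mul_div_assoc]

lemma taylorSeries_eq_mk {f : ℝ → ℝ} {c : ℕ → ℝ}
    (h : HasFPowerSeriesAt f (FormalMultilinearSeries.ofScalars ℝ c) 0) :
    taylorSeries f = PowerSeries.mk c := by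
  have := FormalMultilinearSeries.ofScalars_series_injective ℝ ℝ
    (h.analyticAt.hasFPowerSeriesAt.eq_formalMultilinearSeries h)
  rw [taylorSeries, this]

/-! ### The cluster expansion -/

variable (d β φ) in
/-- The coefficients of the partition function. -/
def partitionCoeff (Λ : Set (Space d)) (n : ℕ) : ℝ :=
  zCoeff d β φ Λ n (Fin.elim0 : Fin 0 → Space d)

lemma partitionCoeff_eq (Λ : Set (Space d)) (n : ℕ) :
    partitionCoeff d β φ Λ n = (n.factorial : ℝ)⁻¹ *
      ∫ y in Set.univ.pi (fun _ : Fin n => Λ), boltzmann β (energy d φ y) := by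
  simp [partitionCoeff, zCoeff, boltzmann_energy, crossProd]

lemma partitionCoeff_zero (Λ : Set (Space d)) : partitionCoeff d β φ Λ 0 = 1 := by
  rw [partitionCoeff_eq]
  simp [boltzmann_energy, pairProd, measureReal_def, volume_pi]

lemma abs_partitionCoeff_le (hβ : 0 < β) {Λ : Set (Space d)} (hΛ : volume Λ ≠ ⊤) (n : ℕ) :
    |partitionCoeff d β φ Λ n| ≤ volume.real Λ ^ n / n.factorial := by
  rw [partitionCoeff_eq, abs_mul, abs_of_nonneg (by positivity), div_eq_inv_mul]
  gcongr
  have hvol : volume.real (Set.univ.pi fun _ : Fin n => Λ) = volume.real Λ ^ n := by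
    simp [measureReal_def, volume_pi_pi]
  rw [← hvol, ← Real.norm_eq_abs]
  refine (norm_setIntegral_le_of_norm_le_const (C := 1) ?_ fun y _ => ?_).trans_eq (one_mul _)
  · rw [volume_pi_pi]
    exact ENNReal.prod_lt_top fun _ _ => hΛ.lt_top
  · rw [Real.norm_eq_abs, abs_of_nonneg (boltzmann_nonneg _ _)]
    exact boltzmann_le_one hβ _

lemma hasFPowerSeriesAt_partitionFunction (hβ : 0 < β) {Λ : Set (Space d)}
    (hΛ : volume Λ ≠ ⊤) : HasFPowerSeriesAt (partitionFunction d β φ Λ)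
      (FormalMultilinearSeries.ofScalars ℝ (partitionCoeff d β φ Λ)) 0 := by
  rw [hasFPowerSeriesAt_iff]
  refine Filter.Eventually.of_forall fun z => ?_
  have hs : Summable fun n => z ^ n * partitionCoeff d β φ Λ n := by
    refine Summable.of_norm_bounded
      (Real.summable_pow_div_factorial (|z| * volume.real Λ)) fun n => ?_
    rw [norm_mul, norm_pow, Real.norm_eq_abs, Real.norm_eq_abs, mul_pow, mul_div_assoc]
    gcongr
    exact abs_partitionCoeff_le hβ hΛ n
  simp only [FormalMultilinearSeries.coeff_ofScalars, smul_eq_mul, zero_add]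
  suffices h : partitionFunction d β φ Λ z = ∑' n, z ^ n * partitionCoeff d β φ Λ n by
    rw [h]
    exact hs.hasSum
  rw [hs.tsum_eq_zero_add, partitionCoeff_zero, pow_zero, one_mul, partitionFunction]
  congr 1
  refine tsum_congr fun n => ?_
  rw [partitionCoeff_eq]
  ring

lemma partitionFunction_zero (Λ : Set (Space d)) : partitionFunction d β φ Λ 0 = 1 := by
  simp [partitionFunction]

lemma clusterSeries_eq_taylorSeries (Λ : Set (Space d)) :
    clusterSeries d β φ Λ = taylorSeries (betaPressure d β φ Λ) := rfl

lemma constantCoeff_clusterSeries (Λ : Set (Space d)) :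
    PowerSeries.constantCoeff (clusterSeries d β φ Λ) = 0 := by
  rw [← PowerSeries.coeff_zero_eq_constantCoeff_apply]
  simp [clusterSeries, clusterCoeff, betaPressure, partitionFunction_zero]

lemma derivative_clusterSeries_mul (hβ : 0 < β) {Λ : Set (Space d)} (hΛ : volume Λ ≠ ⊤)
    (hΛ0 : volume Λ ≠ 0) :
    PowerSeries.C (volume.real Λ) * PowerSeries.derivative ℝ (clusterSeries d β φ Λ) *
        PowerSeries.mk (partitionCoeff d β φ Λ) =
      PowerSeries.derivative ℝ (PowerSeries.mk (partitionCoeff d β φ Λ)) := by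
  have hp := hasFPowerSeriesAt_partitionFunction (φ := φ) hβ hΛ
  have ha := hp.analyticAt
  have hV : volume.real Λ ≠ 0 := ENNReal.toReal_ne_zero.2 ⟨hΛ0, hΛ⟩
  have hb : AnalyticAt ℝ (betaPressure d β φ Λ) 0 :=
    (ha.log (by rw [partitionFunction_zero]; exact one_pos)).div_const
  rw [← taylorSeries_eq_mk hp, derivative_taylorSeries, clusterSeries_eq_taylorSeries,
    derivative_taylorSeries, ← taylorSeries_const_mul,
    ← taylorSeries_mul (show AnalyticAt ℝ (fun z => volume.real Λ * deriv _ z) 0 from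
      analyticAt_const.mul hb.deriv) ha]
  refine taylorSeries_congr ?_
  have hpos : ∀ᶠ z in 𝓝 (0 : ℝ), 0 < partitionFunction d β φ Λ z :=
    ha.continuousAt.eventually (lt_mem_nhds (by rw [partitionFunction_zero]; exact one_pos))
  filter_upwards [hpos, ha.eventually_analyticAt] with z hz hza
  have : deriv (betaPressure d β φ Λ) z =
      deriv (partitionFunction d β φ Λ) z / partitionFunction d β φ Λ z / volume.real Λ := by
    exact ((hza.differentiableAt.hasDerivAt.log hz.ne').div_const _).deriv
  simp only [Pi.mul_apply, this]
  field_simp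

lemma derivative_mk_partitionCoeff (hβ : 0 < β) (hφ : Measurable φ) (hC : tempered d β φ ≠ ⊤)
    {Λ : Set (Space d)} (hΛ : volume Λ ≠ ⊤) :
    PowerSeries.derivative ℝ (PowerSeries.mk (partitionCoeff d β φ Λ)) =
      PowerSeries.mk (fun n => (-1) ^ n * numberCoeff d β φ Λ n) *
        PowerSeries.mk (partitionCoeff d β φ Λ) := by
  ext n
  rw [PowerSeries.coeff_derivative, PowerSeries.coeff_mul]
  simp only [PowerSeries.coeff_mk]
  rw [mul_comm]
  exact succ_mul_zCoeff_succ hβ hφ hC hΛ n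

/-- The coefficients of the density, divided by the fugacity, in a finite volume. -/
lemma coeff_derivative_clusterSeries (hβ : 0 < β) (hφ : Measurable φ) (hC : tempered d β φ ≠ ⊤)
    {Λ : Set (Space d)} (hΛ : volume Λ ≠ ⊤) (hΛ0 : volume Λ ≠ 0) (n : ℕ) :
    (PowerSeries.derivative ℝ (clusterSeries d β φ Λ)).coeff n =
      (-1) ^ n * (numberCoeff d β φ Λ n / volume.real Λ) := by
  have hV : volume.real Λ ≠ 0 := ENNReal.toReal_ne_zero.2 ⟨hΛ0, hΛ⟩
  have hne : PowerSeries.mk (partitionCoeff d β φ Λ) ≠ 0 := by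
    intro h
    have := congrArg (PowerSeries.coeff 0) h
    simp [partitionCoeff_zero] at this
  have h := mul_right_cancel₀ hne ((derivative_clusterSeries_mul hβ hΛ hΛ0).trans
    (derivative_mk_partitionCoeff hβ hφ hC hΛ))
  have h' := congrArg (PowerSeries.coeff n) h
  rw [PowerSeries.coeff_C_mul, PowerSeries.coeff_mk] at h'
  rw [← mul_div_assoc, eq_div_iff hV, mul_comm, h']

lemma explore_zero_one_one (Λ : Set (Space d)) (x : Fin 1 → Space d) :
    explore d β φ 0 Λ 1 1 x = 1 := by
  rw [explore_succ_succ _ _ _ _ one_ne_zero, tsum_eq_single 0]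
  · simp [explore, stepWeight, crossProd, volume_pi, vertexWeight]
  · intro m hm
    simp [explore_eq_zero_of_lt 0 Λ (show 0 < 0 + m by omega)]

lemma numberCoeff_zero (Λ : Set (Space d)) : numberCoeff d β φ Λ 0 = volume.real Λ := by
  simp [numberCoeff, explore_zero_one_one, measureReal_def, volume_pi_pi]

lemma constantCoeff_derivative_clusterSeries (hβ : 0 < β) (hφ : Measurable φ)
    (hC : tempered d β φ ≠ ⊤) {Λ : Set (Space d)} (hΛ : volume Λ ≠ ⊤) (hΛ0 : volume Λ ≠ 0) :
    PowerSeries.constantCoeff (PowerSeries.derivative ℝ (clusterSeries d β φ Λ)) = 1 := by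
  have hV : volume.real Λ ≠ 0 := ENNReal.toReal_ne_zero.2 ⟨hΛ0, hΛ⟩
  rw [← PowerSeries.coeff_zero_eq_constantCoeff_apply,
    coeff_derivative_clusterSeries hβ hφ hC hΛ hΛ0, numberCoeff_zero, div_self hV]
  simp

lemma virialCoeff_eq (hβ : 0 < β) (hφ : Measurable φ) (hC : tempered d β φ ≠ ⊤)
    {Λ : Set (Space d)} (hΛ : volume Λ ≠ ⊤) (hΛ0 : volume Λ ≠ 0) (n : ℕ) :
    virialCoeff d β φ Λ n = n.factorial *
      lagrangeCoeff (PowerSeries.derivative ℝ (clusterSeries d β φ Λ)) n := by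
  rw [virialCoeff, virialSeries, densitySeries, coeff_subst_compInverse
    (constantCoeff_clusterSeries Λ)
    (constantCoeff_derivative_clusterSeries hβ hφ hC hΛ hΛ0)]

/-! ### The thermodynamic limit -/

lemma tendsto_explore_ball (hφ : Measurable φ) (s N k : ℕ) (x : Fin k → Space d) :
    Filter.Tendsto (fun h : ℕ => explore d β φ s (Metric.ball 0 h) N k x) Filter.atTop
      (𝓝 (explore d β φ s Set.univ N k x)) := by
  induction N generalizing k with
  | zero => simp [explore]
  | succ N ih =>
    obtain _ | k := k
    · simp [explore]
    by_cases hk : k + 1 = s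
    · simp [explore, hk]
    have hfin : ∀ Λ : Set (Space d), explore d β φ s Λ (N + 1) (k + 1) x =
        ∑ m ∈ range (N + 1), ((m.factorial : ℝ≥0∞))⁻¹ *
          ∫⁻ y in Set.univ.pi (fun _ : Fin m => Λ), ENNReal.ofReal (stepWeight d β φ x y) *
            explore d β φ s Λ N (k + m) (Fin.append (Fin.tail x) y) := by
      intro Λ
      rw [explore_succ_succ _ _ _ _ hk]
      refine tsum_eq_sum fun m hm => ?_
      have : N < m := by simpa using hm
      simp [explore_eq_zero_of_lt s Λ (show N < k + m by omega)]
    simp_rw [hfin]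
    refine tendsto_finsetSum _ fun m _ => ENNReal.Tendsto.const_mul ?_
      (Or.inr (ENNReal.inv_ne_top.2 (by simp [m.factorial_ne_zero])))
    have hmeas : ∀ h : ℕ, MeasurableSet (Set.univ.pi fun _ : Fin m => Metric.ball (0 : Space d) h) :=
      fun h => MeasurableSet.univ_pi fun _ => measurableSet_ball
    have hF : ∀ Λ : Set (Space d), Measurable fun y : Fin m → Space d =>
        ENNReal.ofReal (stepWeight d β φ x y) *
          explore d β φ s Λ N (k + m) (Fin.append (Fin.tail x) y) := fun Λ =>
      (measurable_stepWeight hφ measurable_const measurable_id).ennreal_ofReal.mul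
        ((measurable_explore hφ _ _ _ _).comp (measurable_append measurable_const measurable_id))
    rw [Set.pi_univ, Measure.restrict_univ]
    simp_rw [← lintegral_indicator (hmeas _)]
    refine lintegral_tendsto_of_tendsto_of_monotone
      (fun h => ((hF _).indicator (hmeas h)).aemeasurable)
      (Filter.Eventually.of_forall fun y h h' hh => ?_) (Filter.Eventually.of_forall fun y => ?_)
    · have hb : Metric.ball (0 : Space d) h ⊆ Metric.ball 0 h' :=
        Metric.ball_subset_ball (by exact_mod_cast hh)
      refine (Set.indicator_le_indicator_of_subset (Set.pi_mono fun _ _ => hb)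
        (fun _ => zero_le) y).trans (Set.indicator_le_indicator ?_)
      exact mul_le_mul_right (explore_mono s hb _ _ _) _
    · refine Filter.Tendsto.congr' ?_ (ENNReal.Tendsto.const_mul
        (ih (k + m) (Fin.append (Fin.tail x) y)) (Or.inr ENNReal.ofReal_ne_top))
      obtain ⟨R, hR⟩ := exists_nat_gt (∑ i, ‖y i‖)
      filter_upwards [Filter.eventually_ge_atTop R] with h hh
      rw [Set.indicator_of_mem]
      intro i _
      rw [mem_ball_zero_iff]
      calc ‖y i‖ ≤ ∑ i, ‖y i‖ := single_le_sum (f := fun i => ‖y i‖) (fun _ _ => norm_nonneg _)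
            (mem_univ i)
        _ < R := hR
        _ ≤ h := by exact_mod_cast hh

lemma ball_subset_of_notMem_cthickening_frontier {X : Type*} [NormedAddCommGroup X]
    [NormedSpace ℝ X] {Λ : Set X} {x : X} {h : ℝ} (hx : x ∈ Λ)
    (hxh : x ∉ Metric.cthickening h (frontier Λ)) : Metric.ball x h ⊆ Λ := by
  intro y hy
  by_contra hyΛ
  have hpos : 0 < h := dist_nonneg.trans_lt hy
  have hfr : Metric.ball x h ⊆ interior Λ ∪ interior Λᶜ := fun w hw => by
    rw [← compl_frontier_eq_union_interior]
    exact fun hwΛ => hxh (Metric.mem_cthickening_of_dist_le x w h _ hwΛ (Metric.mem_ball'.1 hw).le)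
  have hxi : x ∈ interior Λ := (hfr (Metric.mem_ball_self hpos)).resolve_right
    fun hxc => interior_subset hxc hx
  have hyi : y ∈ interior Λᶜ := (hfr hy).resolve_left fun hyc => hyΛ (interior_subset hyc)
  obtain ⟨w, _, hw⟩ := (convex_ball x h).isPreconnected _ _ isOpen_interior isOpen_interior hfr
    ⟨x, Metric.mem_ball_self hpos, hxi⟩ ⟨y, hy, hyi⟩
  exact interior_subset hw.2 (interior_subset hw.1)

lemma explore_ball_le (s N : ℕ) {Λ : Set (Space d)} {h : ℝ} (a : Fin 1 → Space d)
    (ha : Metric.ball (a 0) h ⊆ Λ) :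
    explore d β φ s (Metric.ball 0 h) N 1 (fun _ => 0) ≤ explore d β φ s Λ N 1 a := by
  refine le_trans (le_of_eq ?_) (explore_mono s ha N 1 a)
  have hb : (· + a 0) ⁻¹' Metric.ball (a 0) h = Metric.ball 0 h := by
    ext y
    simp
  rw [← hb, explore_add_right]
  congr 1
  funext i
  rw [zero_add, Subsingleton.elim i 0]

lemma volume_pi_one (Λ : Set (Space d)) :
    volume (Set.univ.pi fun _ : Fin 1 => Λ) = volume Λ := by
  simp [volume_pi_pi]

lemma tendsto_lintegral_explore_div (hβ : 0 < β) (hφ : Measurable φ) (hC : tempered d β φ ≠ ⊤)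
    {Λ : ℕ → Set (Space d)} (hΛ : IsVanHove d Λ) (n : ℕ) :
    Filter.Tendsto (fun k => (∫⁻ a in Set.univ.pi (fun _ : Fin 1 => Λ k),
        explore d β φ 0 (Λ k) (n + 1) 1 a) / volume (Λ k)) Filter.atTop
      (𝓝 (densityCoeff d β φ n)) := by
  have hpos : ∀ k, volume (Λ k) ≠ 0 := fun k => (hΛ.volume_pos k).ne'
  have hfin : ∀ k, volume (Λ k) ≠ ⊤ := fun k => (hΛ.isBounded k).measure_lt_top.ne
  have hupper : ∀ k, (∫⁻ a in Set.univ.pi (fun _ : Fin 1 => Λ k),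
      explore d β φ 0 (Λ k) (n + 1) 1 a) / volume (Λ k) ≤ densityCoeff d β φ n := by
    intro k
    refine ENNReal.div_le_of_le_mul ?_
    rw [← volume_pi_one, ← setLIntegral_const]
    refine lintegral_mono fun a => ?_
    exact (explore_mono 0 (Set.subset_univ _) _ _ _).trans_eq (explore_univ_one _ _ _)
  have hlower : ∀ (h : ℝ) k, explore d β φ 0 (Metric.ball 0 h) (n + 1) 1 (fun _ => 0) *
      (1 - volume (Metric.cthickening h (frontier (Λ k))) / volume (Λ k)) ≤
      (∫⁻ a in Set.univ.pi (fun _ : Fin 1 => Λ k),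
        explore d β φ 0 (Λ k) (n + 1) 1 a) / volume (Λ k) := by
    intro h k
    rw [ENNReal.le_div_iff_mul_le (Or.inl (hpos k)) (Or.inl (hfin k)), mul_assoc,
      ENNReal.sub_mul (fun _ _ => hfin k), one_mul, ENNReal.div_mul_cancel (hpos k) (hfin k)]
    calc _ ≤ explore d β φ 0 (Metric.ball 0 h) (n + 1) 1 (fun _ => 0) *
          volume (Λ k \ Metric.cthickening h (frontier (Λ k))) :=
          mul_le_mul_right (le_measure_sdiff) _
      _ = ∫⁻ _ in Set.univ.pi (fun _ : Fin 1 => Λ k \ Metric.cthickening h (frontier (Λ k))),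
          explore d β φ 0 (Metric.ball 0 h) (n + 1) 1 (fun _ => 0) := by
          rw [setLIntegral_const, volume_pi_one]
      _ ≤ ∫⁻ a in Set.univ.pi (fun _ : Fin 1 => Λ k \ Metric.cthickening h (frontier (Λ k))),
          explore d β φ 0 (Λ k) (n + 1) 1 a := by
          refine setLIntegral_mono (measurable_explore hφ _ _ _ _) fun a ha => ?_
          have h0 := ha 0 (Set.mem_univ 0)
          exact explore_ball_le 0 _ a (ball_subset_of_notMem_cthickening_frontier h0.1 h0.2)
      _ ≤ _ := lintegral_mono_set (Set.pi_mono fun _ _ => Set.sdiff_subset)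
  refine tendsto_order.2 ⟨fun a ha => ?_, fun a ha =>
    Filter.Eventually.of_forall fun k => (hupper k).trans_lt ha⟩
  obtain ⟨h, hh, hh0⟩ := (((tendsto_order.1 (tendsto_explore_ball (d := d) (β := β) hφ 0 (n + 1) 1
    fun _ => 0)).1 a ha).and (Filter.eventually_gt_atTop 0)).exists
  have hlim : Filter.Tendsto (fun k => explore d β φ 0 (Metric.ball 0 h) (n + 1) 1 (fun _ => 0) *
      (1 - volume (Metric.cthickening h (frontier (Λ k))) / volume (Λ k))) Filter.atTop
      (𝓝 (explore d β φ 0 (Metric.ball 0 h) (n + 1) 1 (fun _ => 0))) := by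
    have h1 := ENNReal.Tendsto.sub (tendsto_const_nhds (x := (1 : ℝ≥0∞)))
      (hΛ.boundary h (by exact_mod_cast hh0)) (Or.inl ENNReal.one_ne_top)
    have h2 := ENNReal.Tendsto.const_mul
      (a := explore d β φ 0 (Metric.ball 0 h) (n + 1) 1 (fun _ => 0)) h1
      (Or.inr (explore_ne_top hβ hφ hC _ _ _ _))
    simpa using h2
  filter_upwards [(tendsto_order.1 hlim).1 a hh] with k hk
  exact hk.trans_le (hlower h k)

lemma tendsto_numberCoeff_div (hβ : 0 < β) (hφ : Measurable φ) (hC : tempered d β φ ≠ ⊤)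
    {Λ : ℕ → Set (Space d)} (hΛ : IsVanHove d Λ) (n : ℕ) :
    Filter.Tendsto (fun k => numberCoeff d β φ (Λ k) n / volume.real (Λ k)) Filter.atTop
      (𝓝 (densityCoeff d β φ n).toReal) := by
  refine ((ENNReal.tendsto_toReal (densityCoeff_ne_top hβ hφ hC n)).comp
    (tendsto_lintegral_explore_div hβ hφ hC hΛ n)).congr fun k => ?_
  rw [Function.comp_apply, ENNReal.toReal_div, numberCoeff, integral_toReal
    (measurable_explore hφ _ _ _ _).aemeasurable
    (Filter.Eventually.of_forall fun a => (explore_ne_top hβ hφ hC _ _ _ _).lt_top)]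
  rfl

variable (d β φ) in
/-- The fugacity expansion of the density, divided by the fugacity, in infinite volume. -/
def densityPowerSeries : ℝ⟦X⟧ :=
  PowerSeries.mk fun n => (-1) ^ n * (densityCoeff d β φ n).toReal

lemma constantCoeff_densityPowerSeries (hφ : Measurable φ) :
    PowerSeries.constantCoeff (densityPowerSeries d β φ) = 1 := by
  rw [← PowerSeries.coeff_zero_eq_constantCoeff_apply]
  simp [densityPowerSeries, densityCoeff_zero hφ]

lemma isThermodynamicLimit_virialCoeff (hβ : 0 < β) (hφ : Measurable φ)
    (hC : tempered d β φ ≠ ⊤) (n : ℕ) :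
    IsThermodynamicLimit d (fun Λ => virialCoeff d β φ Λ n)
      (n.factorial * lagrangeCoeff (densityPowerSeries d β φ) n) := by
  intro Λ hΛ
  have hpos : ∀ k, volume (Λ k) ≠ 0 := fun k => (hΛ.volume_pos k).ne'
  have hfin : ∀ k, volume (Λ k) ≠ ⊤ := fun k => (hΛ.isBounded k).measure_lt_top.ne
  simp_rw [virialCoeff_eq hβ hφ hC (hfin _) (hpos _)]
  refine (tendsto_lagrangeCoeff
    (fun k => constantCoeff_derivative_clusterSeries hβ hφ hC (hfin k) (hpos k))
    (constantCoeff_densityPowerSeries hφ) (fun i => ?_) n).const_mul _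
  simp_rw [coeff_derivative_clusterSeries hβ hφ hC (hfin _) (hpos _), densityPowerSeries,
    PowerSeries.coeff_mk]
  exact (tendsto_numberCoeff_div hβ hφ hC hΛ i).const_mul _

/-! ### The radius of convergence -/

lemma densityPowerSeries_inv (hβ : 0 < β) (hφ : Measurable φ) (hC : tempered d β φ ≠ ⊤) :
    (densityPowerSeries d β φ)⁻¹ =
      1 - PowerSeries.mk fun n => (-1) ^ n * (renewalCoeff d β φ n).toReal := by
  have hr : ∀ n, renewalCoeff d β φ n ≠ ⊤ := fun n =>
    ne_top_of_le_ne_top (densityCoeff_ne_top hβ hφ hC n) (renewalCoeff_le hφ n)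
  rw [PowerSeries.inv_eq_iff_mul_eq_one
    (by rw [constantCoeff_densityPowerSeries hφ]; exact one_ne_zero), sub_mul, one_mul,
    sub_eq_iff_eq_add]
  ext n
  rw [map_add, PowerSeries.coeff_mul, densityPowerSeries, PowerSeries.coeff_mk,
    densityCoeff_eq hφ n, PowerSeries.coeff_one, ENNReal.toReal_add (by split_ifs <;> simp)
    (ENNReal.sum_ne_top.2 fun p _ => ENNReal.mul_ne_top (hr _) (densityCoeff_ne_top hβ hφ hC _)),
    ENNReal.toReal_sum fun p _ => ENNReal.mul_ne_top (hr _) (densityCoeff_ne_top hβ hφ hC _),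
    mul_add, mul_sum]
  congr 1
  · split_ifs with h <;> simp [h]
  · refine sum_congr rfl fun p hp => ?_
    rw [← HasAntidiagonal.mem_antidiagonal.1 hp, PowerSeries.coeff_mk, PowerSeries.coeff_mk,
      ENNReal.toReal_mul, pow_add]
    ring

lemma seriesNorm_densityPowerSeries_inv_le (hβ : 0 < β) (hφ : Measurable φ)
    (hC : tempered d β φ ≠ ⊤) (r : ℝ≥0∞) :
    seriesNorm r (densityPowerSeries d β φ)⁻¹ ≤ 1 + ∑' n, renewalCoeff d β φ n * r ^ n := by
  have hr : ∀ n, renewalCoeff d β φ n ≠ ⊤ := fun n =>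
    ne_top_of_le_ne_top (densityCoeff_ne_top hβ hφ hC n) (renewalCoeff_le hφ n)
  rw [← seriesNorm_one r, seriesNorm, seriesNorm, ← ENNReal.tsum_add]
  refine ENNReal.tsum_le_tsum fun n => ?_
  rw [densityPowerSeries_inv hβ hφ hC, map_sub, PowerSeries.coeff_mk, ← add_mul]
  refine mul_le_mul_left ((enorm_sub_le).trans_eq ?_) _
  congr 1
  rw [enorm_mul, enorm_pow, enorm_neg, enorm_one, one_pow, one_mul,
    Real.enorm_of_nonneg ENNReal.toReal_nonneg, ENNReal.ofReal_toReal (hr n)]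

lemma le_convergenceRadius_of_enorm_le {a : ℕ → ℝ} {R : ℝ≥0} {C : ℝ≥0}
    (h : ∀ n, ‖a n‖ₑ * (R : ℝ≥0∞) ^ n ≤ C) : (R : ℝ≥0∞) ≤ convergenceRadius a := by
  refine FormalMultilinearSeries.le_radius_of_bound _ (C : ℝ) fun n => ?_
  rw [FormalMultilinearSeries.ofScalars_norm]
  have := h n
  rw [enorm_eq_nnnorm] at this
  exact_mod_cast this

lemma RStar_le_convergenceRadius (hβ : 0 < β) (hφ : Measurable φ) (hC : tempered d β φ ≠ ⊤) :
    RStar d β φ ≤ convergenceRadius (lagrangeCoeff (densityPowerSeries d β φ)) := by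
  refine iSup₂_le fun r _ => ?_
  have hB1 := one_le_treeSum (d := d) (β := β) (φ := φ) r
  set B := treeSum d β φ r with hB
  by_cases htop : B = ⊤
  · simp [htop, ENNReal.top_sub ENNReal.one_ne_top, ENNReal.div_top]
  set Y := 1 + ∑' n, renewalCoeff d β φ n * (r : ℝ≥0∞) ^ n with hY
  have hYB : Y * B ≤ 2 * B - 1 := one_add_tsum_renewalCoeff_le hβ hφ htop
  have hY1 : 1 ≤ Y := le_self_add
  have hB0 : B ≠ 0 := (one_pos.trans_le hB1).ne'
  have hYtop : Y ≠ ⊤ := by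
    intro h
    rw [h, ENNReal.top_mul hB0, top_le_iff] at hYB
    exact ENNReal.sub_ne_top (ENNReal.mul_ne_top (by simp) htop) hYB
  have hY0 : Y ≠ 0 := (one_pos.trans_le hY1).ne'
  have hle : (r * B) / (2 * B - 1) ≤ (r : ℝ≥0∞) / Y := by
    calc (r * B) / (2 * B - 1) ≤ (r * B) / (Y * B) := ENNReal.div_le_div_left hYB _
      _ = r / Y := ENNReal.mul_div_mul_right _ _ hB0 htop
  refine hle.trans ?_
  have hq : (r : ℝ≥0∞) / Y ≠ ⊤ := ENNReal.div_ne_top ENNReal.coe_ne_top hY0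
  have hqr : ((r : ℝ≥0∞) / Y) * Y = r := ENNReal.div_mul_cancel hY0 hYtop
  lift (r : ℝ≥0∞) / Y to ℝ≥0 using hq with q
  refine le_convergenceRadius_of_enorm_le (C := q) fun n => ?_
  obtain _ | n := n
  · simp [lagrangeCoeff]
  have h1 : ‖lagrangeCoeff (densityPowerSeries d β φ) (n + 1)‖ₑ ≤
      ‖((densityPowerSeries d β φ)⁻¹ ^ n).coeff n‖ₑ := by
    rw [lagrangeCoeff]
    rw [enorm_le_iff_norm_le, norm_div]
    refine div_le_self (norm_nonneg _) ?_
    rw [Real.norm_eq_abs, abs_of_nonneg (by positivity)]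
    linarith [n.cast_nonneg (α := ℝ)]
  have h2 : ‖((densityPowerSeries d β φ)⁻¹ ^ n).coeff n‖ₑ * (r : ℝ≥0∞) ^ n ≤ Y ^ n :=
    (enorm_coeff_mul_le _ _ _).trans ((seriesNorm_pow_le _ _ _).trans
      (pow_le_pow_left' (seriesNorm_densityPowerSeries_inv_le hβ hφ hC r) n))
  have h3 : ‖((densityPowerSeries d β φ)⁻¹ ^ n).coeff n‖ₑ * (q : ℝ≥0∞) ^ n ≤ 1 := by
    rw [← hqr, mul_pow, ← mul_assoc] at h2
    have hYn0 : Y ^ n ≠ 0 := pow_ne_zero n hY0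
    have hYnt : Y ^ n ≠ ⊤ := ENNReal.pow_ne_top hYtop
    exact (ENNReal.mul_le_mul_iff_left hYn0 hYnt).1 (h2.trans_eq (one_mul _).symm)
  calc _ ≤ ‖((densityPowerSeries d β φ)⁻¹ ^ n).coeff n‖ₑ * (q : ℝ≥0∞) ^ (n + 1) :=
        mul_le_mul_left h1 _
    _ = ‖((densityPowerSeries d β φ)⁻¹ ^ n).coeff n‖ₑ * (q : ℝ≥0∞) ^ n * q := by
        rw [pow_succ, mul_assoc]
    _ ≤ 1 * q := mul_le_mul_left h3 _
    _ = q := one_mul _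

end RepulsiveGas

end

theorem mainTheorem10 (d : ℕ) (hd : 1 ≤ d) (β : ℝ) (hβ : 0 < β) (φ : ℝ≥0 → ℝ≥0∞)
    (hφ : Measurable φ) (hC : RepulsiveGas.tempered d β φ ≠ ⊤) :
    (RepulsiveGas.tempered d β φ ≠ 0 → ∃! m : ℝ≥0, RepulsiveGas.IsMaximizer d β φ m) ∧
    ∃ b : ℕ → ℝ,
      (∀ n : ℕ, RepulsiveGas.IsThermodynamicLimit d
        (fun Λ => RepulsiveGas.virialCoeff d β φ Λ n) (b n)) ∧
      RepulsiveGas.RStar d β φ ≤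
        RepulsiveGas.convergenceRadius (fun n => b n / (n.factorial : ℝ)) ∧
      RepulsiveGas.MStar d β φ ≤ RepulsiveGas.RStar d β φ := by
  refine ⟨RepulsiveGas.existsUnique_isMaximizer hd hβ hφ hC,
    fun n => n.factorial * RepulsiveGas.lagrangeCoeff (RepulsiveGas.densityPowerSeries d β φ) n,
    RepulsiveGas.isThermodynamicLimit_virialCoeff hβ hφ hC, ?_,
    RepulsiveGas.MStar_le_RStar hd hβ hφ hC⟩
  have h : (fun n : ℕ => (n.factorial : ℝ) *
      RepulsiveGas.lagrangeCoeff (RepulsiveGas.densityPowerSeries d β φ) n / n.factorial) =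
      RepulsiveGas.lagrangeCoeff (RepulsiveGas.densityPowerSeries d β φ) := by
    funext n
    rw [mul_div_cancel_left₀]
    positivity
  rw [h]
  exact RepulsiveGas.RStar_le_convergenceRadius hβ hφ hC
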